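/- Let $\nu\ge 2$, $I=\{1,\dots,\nu,\infty\}$, $t_1=0$, $t_2=1$, $t_\infty=\infty$, let $n_i\ge 1$ $(i\in I)$ be integers, $n=\sum_{i\in I}n_i$, $N=n-3$, and $I_{\mathrm{un}}=\{i\in I: n_i>1\}$ (all irregular singularities are unramified, all others are regular). Fix complex numbers $\theta^{\pm}_{n_i-1,t_i}$ $(i\in I)$ with $\sum_{i\in I}(\theta^+_{n_i-1,t_i}+\theta^-_{n_i-1,t_i})=-1$ and $\theta^+_{0,t_i}-\theta^-_{0,t_i}\notin\mathbb Z$ whenever $n_i=1$. Let $T$ be the space of deformation parameters $(\boldsymbol t,\boldsymbol\theta)$, $\boldsymbol t=(t_3,\dots,t_\nu)$, $\boldsymbol\theta=(\theta^{\pm}_{l,t_i})_{i\in I_{\mathrm{un}},\,0\le l\le n_i-2}$, where $t_1,\dots,t_\nu$ are distinct and $\theta^+_{0,t_i}\ne\theta^-_{0,t_i}$ for $i\in I_{\mathrm{un}}$. Let $\widehat M$ be the space of pairs of a point of $T$ and an unordered $N$-tuple $\{(q_j,p_j)\}$ in $\mathbb C^2$ with distinct $q_j\notin\{t_1,\dots,t_\nu\}$,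 and let $\pi\colon\widehat M\to T$ be the projection. Put $P(x)=\prod_{i=1}^\nu(x-t_i)^{n_i}$. For each point of $\widehat M$ there is exactly one connection $d+\Omega$ on $E_{n-2}=\mathcal O\oplus\mathcal O(n-2)$ over $\mathbb P^1$ (trivializations related by $\mathrm{diag}(1,x^{n-2})$) of the form $$\Omega=\begin{pmatrix}0&1/P\\ c_0&d_0\end{pmatrix}dx,\qquad c_0=\sum_{i=1}^\nu\frac{C_i}{(x-t_i)^{n_i}}+\sum_{j=1}^N\frac{p_j}{x-q_j}+\tilde C+x^{N}C_\infty,\qquad d_0=\sum_{i=1}^\nu\frac{D_i}{(x-t_i)^{n_i}}-\sum_{j=1}^N\frac1{x-q_j}+D_\infty,$$ with polynomials $C_i,D_i$ $(i\le\nu)$ of degree $\le n_i-1$, $C_\infty$ of degree $\le n_\infty-1$, $D_\infty$ of degree $\le n_\infty-2$, $\tilde C$ of degree $\le n-4$, such that: gauge transformation by $\begin{pmatrix}1&0\\p_j&x-q_j\end{pmatrix}$ removes the pole at $q_j$ for each $j$ (apparent singularities); and the connection on $\mathcal O\oplus\mathcal O(1)$ obtained by gauge transformation with $\begin{pmatrix}1&0\\Q_2&Q_1\end{pmatrix}$,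 where $Q_1=\prod_j(x-q_j)$, $\deg Q_2\le n-4$, $Q_2(q_j)=p_j$, is at each $t_i$ formally holomorphically gauge equivalent to $\sum_{l=0}^{n_i-1}\mathrm{diag}(\theta^+_{l,t_i},\theta^-_{l,t_i})\,x_{t_i}^{l-n_i}dx_{t_i}$, where $x_{t_i}=x-t_i$ and $x_{t_\infty}=1/x$. At each $t_i$, $i\in I$ (at $\infty$ in the trivialization near $\infty$) there are formal solutions $\psi_i=\Phi_i\Xi_i\exp(-\Lambda_i)$ of $(d+\Omega)\psi_i=0$, depending holomorphically on the point of $\widehat M$, with $\Phi_i$ an invertible matrix, $\Xi_i=1+\sum_{s\ge1}\xi^{(i)}_sx_{t_i}^s$ with all $\xi_s^{(i)}$ having zero diagonal, and $\Lambda_i=\sum_{k\ge0}\mathrm{diag}(\theta^+_{k,t_i},\theta^-_{k,t_i})\int x_{t_i}^{k-n_i}dx_{t_i}$; this defines the functions $\theta^{\pm}_{k,t_i}$ for $k\ge n_i$. At each $q_j$ there are solutions $\psi_{q_j}=\begin{pmatrix}1&0\\p_j&1\end{pmatrix}\Xi_{q_j}\,\mathrm{diag}(1,x-q_j)$ with $\Xi_{q_j}=1+O(x-q_j)$,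 also holomorphic in the parameters (locally, after numbering the $q_j$). For any such choice define the isomonodromy $2$-form on $\widehat M$ by $$\hat\omega(\delta_1,\delta_2)=\tfrac12\sum_{i\in I}\mathrm{res}_{x=t_i}\mathrm{Tr}\big(\delta_1(\Omega)\,\delta_2(\psi_i)\psi_i^{-1}-\delta_1(\psi_i)\psi_i^{-1}\,\delta_2(\Omega)\big)+\tfrac12\sum_{j=1}^{N}\mathrm{res}_{x=q_j}\mathrm{Tr}\big(\delta_1(\Omega)\,\delta_2(\psi_{q_j})\psi_{q_j}^{-1}-\delta_1(\psi_{q_j})\psi_{q_j}^{-1}\,\delta_2(\Omega)\big),$$ variations being taken with $x$ fixed. Put $$\eta_j=\frac{p_j}{P(q_j)}-\sum_{i=1}^\nu\frac{D_i(q_j)}{(q_j-t_i)^{n_i}}-D_\infty(q_j),\qquad H_{\theta^\pm_{l,t_i}}=\frac{\theta^\pm_{2n_i-l-2,t_i}}{n_i-l-1}\quad(i\in I_{\mathrm{un}},\,0\le l\le n_i-2),$$ $$H_{t_i}=\sum_{l=0}^{n_i-1}\big(\theta^+_{l,t_i}\theta^+_{2n_i-l-1,t_i}+\theta^-_{l,t_i}\theta^-_{2n_i-l-1,t_i}\big)\quad(3\le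 i\le\nu).$$ Then $$\hat\omega-\Big(\sum_{j=1}^{N}d\eta_j\wedge dq_j+\sum_{i\in I_{\mathrm{un}}}\sum_{l=0}^{n_i-2}\big(dH_{\theta^+_{l,t_i}}\wedge d\theta^+_{l,t_i}+dH_{\theta^-_{l,t_i}}\wedge d\theta^-_{l,t_i}\big)+\sum_{i=3}^{\nu}dH_{t_i}\wedge dt_i\Big)$$ is a section over $\widehat M$ of the pulled-back bundle $\pi^*\Omega^2_T$. -/

import Mathlib

open scoped Matrix

noncomputable section

namespace IsoMon

/-! ### Laurent series -/

/-- Formal Laurent series over `ℂ` in a local coordinate. -/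
abbrev LS : Type := LaurentSeries ℂ

/-- The local coordinate, as a Laurent series. -/
def lX : LS := HahnSeries.single (1 : ℤ) (1 : ℂ)

/-- Derivative with respect to the local coordinate. -/
def lD (f : LS) : LS := LaurentSeries.derivative ℂ f

/-- A power series as a Laurent series. -/
def ofPS (f : PowerSeries ℂ) : LS := HahnSeries.ofPowerSeries ℤ ℂ f

/-- The residue of `f dX`. -/
def res (f : LS) : ℂ := f.coeff (-1)

abbrev Mat2 (R : Type) : Type := Matrix (Fin 2) (Fin 2) R

/-- No negative powers of the local coordinate. -/
def NoPole (A : Mat2 LS) : Prop := ∀ a b, ∀ k : ℤ, k < 0 → (A a b).coeff k = 0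

/-- The gauge transform `g⁻¹ dg + g⁻¹ A g` of the connection matrix `A`
(coefficients of the differential of the local coordinate). -/
def gauge (g A : Mat2 LS) : Mat2 LS := g⁻¹ * g.map lD + g⁻¹ * A * g

/-! ### Parameters -/

/-- The poles `t_1 = 0, t_2 = 1, t_3, …, t_ν` (the values `some k`, `ν = μ + 2`)
and `t_∞ = ∞` (the value `none`). -/
abbrev Pole (μ : ℕ) : Type := Option (Fin (μ + 2))

variable {μ : ℕ}

/-- The degree of the polar divisor. -/
def degD (n : Pole μ → ℕ) : ℕ := ∑ i, n i

/-- The number of apparent singularities. -/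
def numApp (n : Pole μ → ℕ) : ℕ := degD n - 3

/-- Coordinates on the space of deformation parameters: the positions `t_3, …, t_ν` and, for each
pole `i`, the numbers `θ^±_{l,t_i}` with `0 ≤ l ≤ n_i - 2`. In the index type `Fin 2` of the sign,
`0` is `+` and `1` is `-`. There are no `θ`-coordinates at poles of order one. -/
abbrev Base (n : Pole μ → ℕ) : Type :=
  (Fin μ → ℂ) × ((i : Pole μ) → Fin 2 → Fin (n i - 1) → ℂ)

/-- Coordinates `(q, p, (t, θ))` of the extended phase space. -/
abbrev Param (n : Pole μ → ℕ) : Type :=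
  (Fin (numApp n) → ℂ) × (Fin (numApp n) → ℂ) × Base n

def qOf {n : Pole μ → ℕ} (m : Param n) : Fin (numApp n) → ℂ := m.1

def pOf {n : Pole μ → ℕ} (m : Param n) : Fin (numApp n) → ℂ := m.2.1

/-- The projection to the space of deformation parameters. -/
def proj {n : Pole μ → ℕ} (m : Param n) : Base n := m.2.2

def tOf {n : Pole μ → ℕ} (m : Param n) : Fin μ → ℂ := m.2.2.1

def thetaOf {n : Pole μ → ℕ} (m : Param n) (i : Pole μ) (a : Fin 2) (l : Fin (n i - 1)) : ℂ :=
  m.2.2.2 i a l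

/-- The finite poles `0, 1, t_3, …, t_ν`. -/
def pos {n : Pole μ → ℕ} (m : Param n) : Fin (μ + 2) → ℂ :=
  Fin.cons 0 (Fin.cons 1 (tOf m))

/-- The extended phase space, as an open subset of the coordinate space. The points
`(q_j, p_j)` are numbered; since the `q_j` are distinct, this is a finite étale covering of the
space of unordered configurations, with `q_j, p_j, t_i, θ^±_{l,t_i}` as local coordinates. -/
def phaseSpace (n : Pole μ → ℕ) : Set (Param n) :=
  {m | Function.Injective (pos m) ∧ Function.Injective (qOf m) ∧
    (∀ j k, qOf m j ≠ pos m k) ∧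
    ∀ (i : Pole μ) (h : 0 < n i - 1), thetaOf m i 0 ⟨0, h⟩ ≠ thetaOf m i 1 ⟨0, h⟩}

/-- `θ^±_{l,t_i}` for `0 ≤ l ≤ n_i - 1`; the residue `θ^±_{n_i-1,t_i}` is the constant `θ₀`. -/
def polarCoeff {n : Pole μ → ℕ} (θ₀ : Pole μ → Fin 2 → ℂ) (m : Param n) (i : Pole μ) (a : Fin 2)
    (l : ℕ) : ℂ :=
  if h : l < n i - 1 then thetaOf m i a ⟨l, h⟩ else θ₀ i a

/-- The diagonal polar part
`diag(Σ_{l<n_i} θ^+_{l,t_i} X^{l-n_i}, Σ_{l<n_i} θ^-_{l,t_i} X^{l-n_i})`. -/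
def polarDiag {n : Pole μ → ℕ} (θ₀ : Pole μ → Fin 2 → ℂ) (m : Param n) (i : Pole μ) : Mat2 LS :=
  Matrix.diagonal fun a =>
    ∑ l ∈ Finset.range (n i), HahnSeries.single ((l : ℤ) - (n i : ℤ)) (polarCoeff θ₀ m i a l)

/-! ### The global normal form -/

/-- The polynomials `C_i, D_i` (`i = 1, …, ν, ∞`) and `C̃`. -/
structure NFData (μ : ℕ) where
  C : Pole μ → Polynomial ℂ
  D : Pole μ → Polynomial ℂ
  Ct : Polynomial ℂ

instance : Nonempty (NFData μ) := ⟨⟨fun _ => 0, fun _ => 0, 0⟩⟩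

/-- `P(x)` at `x = z`. -/
def Pz {n : Pole μ → ℕ} (m : Param n) (z : LS) : LS :=
  ∏ k, (z - HahnSeries.C (pos m k)) ^ n (some k)

/-- `c_0(x)` at `x = z`. -/
def c0 {n : Pole μ → ℕ} (m : Param n) (F : NFData μ) (z : LS) : LS :=
  ∑ k, Polynomial.aeval z (F.C (some k)) / (z - HahnSeries.C (pos m k)) ^ n (some k)
    + ∑ j, HahnSeries.C (pOf m j) / (z - HahnSeries.C (qOf m j))
    + Polynomial.aeval z F.Ct
    + z ^ numApp n * Polynomial.aeval z (F.C none)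

/-- `d_0(x)` at `x = z`. -/
def d0 {n : Pole μ → ℕ} (m : Param n) (F : NFData μ) (z : LS) : LS :=
  ∑ k, Polynomial.aeval z (F.D (some k)) / (z - HahnSeries.C (pos m k)) ^ n (some k)
    + ∑ j, (-1) / (z - HahnSeries.C (qOf m j))
    + Polynomial.aeval z (F.D none)

/-- The coefficient of `dx` in the connection matrix of the normal form on `E_{n-2}` over `U_0`,
at `x = z`. -/
def connMat {n : Pole μ → ℕ} (m : Param n) (F : NFData μ) (z : LS) : Mat2 LS :=
  !![0, 1 / Pz m z; c0 m F z, d0 m F z]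

/-- The global coordinate `x` in terms of the local coordinate at the pole `i`:
`x = t_i + X`, and `x = 1/X` at infinity. -/
def xAt {n : Pole μ → ℕ} (m : Param n) : Pole μ → LS
  | some k => HahnSeries.C (pos m k) + lX
  | none => lX⁻¹

/-- The normal form over `U_0`, expanded in the local coordinate `X` at the pole `i`
(coefficient of `dX`, where `dx` is the derivative of `xAt m i` times `dX`). -/
def connAt {n : Pole μ → ℕ} (m : Param n) (F : NFData μ) (i : Pole μ) : Mat2 LS :=
  lD (xAt m i) • connMat m F (xAt m i)

/-- The change of trivialization of `E_k = 𝒪 ⊕ 𝒪(k)` at the pole `i`: the identity over `U_0`, and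
`G_k = diag(1, x^k)` at infinity. -/
def triv {n : Pole μ → ℕ} (m : Param n) (k : ℕ) : Pole μ → Mat2 LS
  | some _ => 1
  | none => Matrix.diagonal ![1, xAt m (none : Pole μ) ^ k]

/-- The connection matrix on `E_{n-2}` near the pole `i`. -/
def omegaAt {n : Pole μ → ℕ} (m : Param n) (F : NFData μ) (i : Pole μ) : Mat2 LS :=
  gauge (triv m (degD n - 2) i) (connAt m F i)

/-- `Q_1(x) = ∏_j (x - q_j)`. -/
def Q1 {n : Pole μ → ℕ} (m : Param n) : Polynomial ℂ :=
  ∏ j, (Polynomial.X - Polynomial.C (qOf m j))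

/-- `Q_2(x)`: the polynomial of degree at most `n - 4` with `Q_2(q_j) = p_j`. -/
def Q2 {n : Pole μ → ℕ} (m : Param n) : Polynomial ℂ :=
  Lagrange.interpolate Finset.univ (qOf m) (pOf m)

/-- The transformation `G̃` between `E_1` and `E_{n-2}`, at `x = z`. -/
def Gtilde {n : Pole μ → ℕ} (m : Param n) (z : LS) : Mat2 LS :=
  !![1, 0; Polynomial.aeval z (Q2 m), Polynomial.aeval z (Q1 m)]

/-- The connection matrix of the corresponding connection on `E_1` near the pole `i`. -/
def omegaOneAt {n : Pole μ → ℕ} (m : Param n) (F : NFData μ) (i : Pole μ) : Mat2 LS :=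
  gauge (triv m 1 i) (gauge (Gtilde m (xAt m i)) (connAt m F i))

/-- The connection matrix on `E_{n-2}` in the coordinate `X = x - q_j`. -/
def omegaApp {n : Pole μ → ℕ} (m : Param n) (F : NFData μ) (j : Fin (numApp n)) : Mat2 LS :=
  connMat m F (HahnSeries.C (qOf m j) + lX)

/-- There is a holomorphic formal gauge transformation of `A` to `Λ`. -/
def FormallyEquiv (A Λ : Mat2 LS) : Prop :=
  ∃ g : Mat2 (PowerSeries ℂ), IsUnit g ∧ gauge (g.map ofPS) A = Λ

/-- `F` is the normal form with parameters `m`: the degree bounds hold, the `q_j` are apparent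
singularities, and the corresponding connection on `E_1` has local formal data `(θ, θ₀)`. -/
structure IsNormalForm (n : Pole μ → ℕ) (θ₀ : Pole μ → Fin 2 → ℂ) (m : Param n)
    (F : NFData μ) : Prop where
  degC : ∀ i, (F.C i).degree < n i
  degD : ∀ k, (F.D (some k)).degree < n (some k)
  degDinf : (F.D none).degree < (n none - 1 : ℕ)
  degCt : F.Ct.degree < numApp n
  apparent : ∀ j, NoPole (gauge !![1, 0; HahnSeries.C (pOf m j), lX] (omegaApp m F j))
  formal : ∀ i, FormallyEquiv (omegaOneAt m F i) (polarDiag θ₀ m i)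

/-- The normal form with parameters `m`. -/
def normalForm (n : Pole μ → ℕ) (θ₀ : Pole μ → Fin 2 → ℂ) (m : Param n) : NFData μ :=
  Classical.epsilon (IsNormalForm n θ₀ m)

/-! ### Formal solutions at the poles and at the apparent singularities -/

/-- The matrix of power series `Σ_s ξ_s X^s`, as a matrix of Laurent series. -/
def seriesMat (ξ : ℕ → Mat2 ℂ) : Mat2 LS :=
  Matrix.of fun a b => ofPS (PowerSeries.mk fun s => ξ s a b)

def constMat (A : Mat2 ℂ) : Mat2 LS := A.map fun c => HahnSeries.C c

/-- A choice, depending holomorphically on the parameters, of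
* formal solutions `Φ_i Ξ_i exp(-Λ_i)` at each pole, where `Φ_i` is invertible,
  `Ξ_i = 1 + Σ_{s>0} ξ_s X^s` with all `ξ_s` off-diagonal and
  `Λ_i = ∫ diag(Σ_k θ^±_{k,t_i} X^{k-n_i}) dX` with `θ^±_{k,t_i}` prescribed for `k < n_i`;
* solutions `Φ_{q_j} Ξ_{q_j} diag(1, x - q_j)` at each apparent singularity, where
  `Ξ_{q_j} = 1 + O(x - q_j)` and `Φ_{q_j}` is unipotent with entry `p_j`. -/
structure LocalSolutions (n : Pole μ → ℕ) (θ₀ : Pole μ → Fin 2 → ℂ) where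
  Φ : Pole μ → Param n → Mat2 ℂ
  Ξ : Pole μ → Param n → ℕ → Mat2 ℂ
  /-- `θ^±_{k,t_i}` for all `k ≥ 0`. -/
  θ : Pole μ → Fin 2 → ℕ → Param n → ℂ
  Ξq : Fin (numApp n) → Param n → ℕ → Mat2 ℂ
  analytic_Φ : ∀ i a b, AnalyticOnNhd ℂ (fun m => Φ i m a b) (phaseSpace n)
  analytic_Ξ : ∀ i s a b, AnalyticOnNhd ℂ (fun m => Ξ i m s a b) (phaseSpace n)
  analytic_θ : ∀ i a k, AnalyticOnNhd ℂ (θ i a k) (phaseSpace n)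
  analytic_Ξq : ∀ j s a b, AnalyticOnNhd ℂ (fun m => Ξq j m s a b) (phaseSpace n)
  isUnit_Φ : ∀ i, ∀ m ∈ phaseSpace n, IsUnit (Φ i m)
  Ξ_zero : ∀ i, ∀ m ∈ phaseSpace n, Ξ i m 0 = 1
  Ξ_diag : ∀ i, ∀ m ∈ phaseSpace n, ∀ s, 0 < s → ∀ a, Ξ i m s a a = 0
  θ_polar : ∀ i a k, k < n i → ∀ m ∈ phaseSpace n, θ i a k m = polarCoeff θ₀ m i a k
  solution : ∀ i, ∀ m ∈ phaseSpace n,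
    gauge (constMat (Φ i m) * seriesMat (Ξ i m)) (omegaAt m (normalForm n θ₀ m) i) =
      Matrix.diagonal fun a =>
        HahnSeries.single (-(n i : ℤ)) (1 : ℂ) * ofPS (PowerSeries.mk fun k => θ i a k m)
  Ξq_zero : ∀ j, ∀ m ∈ phaseSpace n, Ξq j m 0 = 1
  solutionq : ∀ j, ∀ m ∈ phaseSpace n,
    (constMat !![1, 0; pOf m j, 1] * seriesMat (Ξq j m) * Matrix.diagonal ![1, lX]).map lD
      + omegaApp m (normalForm n θ₀ m) j *
        (constMat !![1, 0; pOf m j, 1] * seriesMat (Ξq j m) * Matrix.diagonal ![1, lX]) = 0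

/-! ### Variations and the 2-form -/

open Classical in
/-- The Laurent series with coefficients `c` (zero if infinitely many negative powers occur). -/
def lsMk (c : ℤ → ℂ) : LS :=
  if h : BddBelow (Function.support c) then HahnSeries.ofSuppBddBelow c h else 0

variable {n : Pole μ → ℕ}

/-- The derivative in direction `v` at `m`, with the global coordinate `x` fixed, of a family
`Σ_k a_k(m) (x - s(m))^k` of Laurent series in the local coordinate `X = x - s(m)`. -/
def variation (s : Param n → ℂ) (f : Param n → LS) (m v : Param n) : LS :=
  lsMk (fun k => fderiv ℂ (fun m' => (f m').coeff k) m v)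
    - HahnSeries.C (fderiv ℂ s m v) * lD (f m)

def variationMat (s : Param n → ℂ) (A : Param n → Mat2 LS) (m v : Param n) : Mat2 LS :=
  Matrix.of fun a b => variation s (fun m' => A m' a b) m v

/-- The origin of the local coordinate at the pole `i`: `t_i` for `X = x - t_i`, and the constant
`0` for `X = w` at infinity. -/
def center (i : Pole μ) (m : Param n) : ℂ :=
  match i with
  | some k => pos m k
  | none => 0

namespace LocalSolutions

variable {θ₀ : Pole μ → Fin 2 → ℂ} (S : LocalSolutions n θ₀)

/-- `Φ_i Ξ_i`. -/
def frame (i : Pole μ) (m : Param n) : Mat2 LS := constMat (S.Φ i m) * seriesMat (S.Ξ i m)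

/-- `ψ_{q_j}`. -/
def psiq (j : Fin (numApp n)) (m : Param n) : Mat2 LS :=
  constMat !![1, 0; pOf m j, 1] * seriesMat (S.Ξq j m) * Matrix.diagonal ![1, lX]

/-- The variation of `Σ_k θ^±_{k,t_i} ∫ X^{k-n_i} dX`, that is
`Σ_{k ≠ n_i-1} δ(θ^±_{k,t_i}) X^{k-n_i+1}/(k-n_i+1) - δ(t_i) Σ_k θ^±_{k,t_i} X^{k-n_i}`.
The term `k = n_i - 1` of the first sum is absent since the residue is constant. -/
def varLambda (i : Pole μ) (a : Fin 2) (m v : Param n) : LS :=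
  HahnSeries.single (1 - (n i : ℤ)) (1 : ℂ) * ofPS (PowerSeries.mk fun k =>
      if k + 1 = n i then 0 else fderiv ℂ (S.θ i a k) m v / ((k : ℂ) + 1 - (n i : ℂ)))
    - HahnSeries.C (fderiv ℂ (center i) m v) *
      (HahnSeries.single (-(n i : ℤ)) (1 : ℂ) * ofPS (PowerSeries.mk fun k => S.θ i a k m))

/-- `δ(ψ_i) ψ_i⁻¹` for `ψ_i = Φ_i Ξ_i exp(-Λ_i)`, that is
`δ(Φ_i Ξ_i) (Φ_i Ξ_i)⁻¹ - Φ_i Ξ_i δ(Λ_i) (Φ_i Ξ_i)⁻¹`. -/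
def logVar (i : Pole μ) (m v : Param n) : Mat2 LS :=
  variationMat (center i) (S.frame i) m v * (S.frame i m)⁻¹
    - S.frame i m * Matrix.diagonal (fun a => S.varLambda i a m v) * (S.frame i m)⁻¹

/-- `δ(ψ_{q_j}) ψ_{q_j}⁻¹`. -/
def logVarq (j : Fin (numApp n)) (m v : Param n) : Mat2 LS :=
  variationMat (fun m' => qOf m' j) (S.psiq j) m v * (S.psiq j m)⁻¹

/-- `δ(Ω)` at the pole `i`. -/
def varOmega (_S : LocalSolutions n θ₀) (i : Pole μ) (m v : Param n) : Mat2 LS :=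
  variationMat (center i) (fun m' => omegaAt m' (normalForm n θ₀ m') i) m v

/-- `δ(Ω)` at `q_j`. -/
def varOmegaq (_S : LocalSolutions n θ₀) (j : Fin (numApp n)) (m v : Param n) : Mat2 LS :=
  variationMat (fun m' => qOf m' j) (fun m' => omegaApp m' (normalForm n θ₀ m') j) m v

/-- The 2-form `ω̂` on the extended phase space:
`ω̂(δ₁, δ₂) = 1/2 Σ_i res_{t_i} Tr(δ(Ω) ∧ δ(ψ_i)ψ_i⁻¹) + 1/2 Σ_j res_{q_j} Tr(δ(Ω) ∧ δ(ψ_{q_j})ψ_{q_j}⁻¹)`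
with `δ(Ω) ∧ δ(ψ)ψ⁻¹ = δ₁(Ω) δ₂(ψ)ψ⁻¹ - δ₁(ψ)ψ⁻¹ δ₂(Ω)`. -/
def omegaHat (m v w : Param n) : ℂ :=
  (1 / 2) * ∑ i, res (Matrix.trace
      (S.varOmega i m v * S.logVar i m w - S.logVar i m v * S.varOmega i m w))
    + (1 / 2) * ∑ j, res (Matrix.trace
      (S.varOmegaq j m v * S.logVarq j m w - S.logVarq j m v * S.varOmegaq j m w))

/-- The Hamiltonian associated to `θ^±_{l,t_i}`. -/
def hamTheta (i : Pole μ) (a : Fin 2) (l : Fin (n i - 1)) (m : Param n) : ℂ :=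
  S.θ i a (2 * n i - (l : ℕ) - 2) m / ((n i : ℂ) - (l : ℂ) - 1)

/-- The Hamiltonian associated to `t_i`. -/
def hamT (i : Pole μ) (m : Param n) : ℂ :=
  ∑ a, ∑ l ∈ Finset.range (n i), S.θ i a l m * S.θ i a (2 * n i - l - 1) m

end LocalSolutions

/-- `η_j = p_j / P(q_j) - Σ_i D_i(q_j) / (q_j - t_i)^{n_i} - D_∞(q_j)`. -/
def eta (θ₀ : Pole μ → Fin 2 → ℂ) (j : Fin (numApp n)) (m : Param n) : ℂ :=
  pOf m j / ∏ k, (qOf m j - pos m k) ^ n (some k)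
    - ∑ k, ((normalForm n θ₀ m).D (some k)).eval (qOf m j) / (qOf m j - pos m k) ^ n (some k)
    - ((normalForm n θ₀ m).D none).eval (qOf m j)

/-- `(df ∧ dg)(v, w)` at `m`. -/
def dWedge (f g : Param n → ℂ) (m v w : Param n) : ℂ :=
  fderiv ℂ f m v * fderiv ℂ g m w - fderiv ℂ f m w * fderiv ℂ g m v

/-- The field of bilinear forms `ω` is a holomorphic section, over the extended phase space, of the
pull-back of the bundle of 2-forms on the space of deformation parameters. -/
def IsSectionOfPullback (ω : Param n → Param n → Param n → ℂ) : Prop :=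
  ∃ β : Param n → Base n [⋀^Fin 2]→ₗ[ℂ] ℂ,
    (∀ x y, AnalyticOnNhd ℂ (fun m => β m ![x, y]) (phaseSpace n)) ∧
    ∀ m ∈ phaseSpace n, ∀ v w, ω m v w = β m ![proj v, proj w]

end IsoMon

end

/-! The difference of the two forms is bilinear, alternating and holomorphic. It therefore descends
to a section of the pulled-back bundle as soon as it vanishes whenever one argument is vertical,
that is, leaves the deformation parameters fixed (`isSectionOfPullback_of`). So ω̂(v, w) is needed
only for vertical v and arbitrary w.

Differentiating the equation of a solution ψ gives δΩ = -(δψ ψ⁻¹)' - [Ω, δψ ψ⁻¹]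
(`variation_connection`). Hence the two halves of the integrand differ by an exact derivative, and
ω̂(v, w) is the sum of the residues of Tr(δ_vΩ · δ_wψ ψ⁻¹) (`omegaHat_eq`).

Poles. The first row of Ω is (0, 1/P), so trace and determinant determine the polar part of Ω, and
these are prescribed by the formal exponents. The polar part thus depends on the base point only,
and δ_vΩ is holomorphic for vertical v. Write F = ΦΞ, L for the diagonal matrix of exponents, and G
= F⁻¹δ_vF. Then F⁻¹ δ_vΩ F = δ_vL + [G, L] - G'. Holomorphy of the left side forces the off-diagonal
entries of G to be O(X^{n_i}); the normalization of Ξ (unit diagonal) then forces G_aa' =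
O(X^{n_i}). Since δ_wΛ has pole order at most n_i, only δ_vL survives: the residue is -Σ_a
res(δ_vL_a · δ_wΛ_a) (`res_pole_eq`). Comparing coefficients turns this into the Hamiltonians of θ
and t (`res_variation_expo_mul`).

Apparent singularities. Here the computation is valid in all directions. The logarithmic variation
of ψ_{q_j} splits into the variation of the unipotent factor, that of Ξ_{q_j}, and a term δq_j · Ω
caused by the moving centre (`logVarq_eq`). The residue is -dα_j ∧ dq_j, where α_j is the constant
term of the (2,2) entry after conjugation by the unipotent factor (`res_app`). Finally η_j = -α_j -
Σ_{l≠j} 1/(q_j - q_l), and the correction terms cancel in pairs (`sum_dWedge_inv_sub`).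

Existence and uniqueness. The polar parts determine every C_i and D_i; the one coefficient that is
not free, the residue of the (2,2) entry at infinity, agrees by the Fuchs relation. The
apparent-singularity conditions prescribe C̃ at N points, and deg C̃ < N. This yields the explicit
normal form `nf`. That the polar data suffice for formal equivalence follows from diagonalizing by a
matrix with unit diagonal and off-diagonal entries U, V: these solve two decoupled Riccati
equations, solvable because the leading eigenvalues are distinct and nonresonant. All recursions are
explicit, so their coefficients are holomorphic in the parameters, and local solutions exist. -/

noncomputable section

namespace IsoMon

/-! ### Laurent series: order, coefficients of products, derivative -/

/-- `f = O(X^a)`. -/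
def Ord (f : LS) (a : ℤ) : Prop := ∀ k < a, f.coeff k = 0

lemma exists_ord (f : LS) : ∃ a, Ord f a :=
  ⟨f.order, fun _ hk => HahnSeries.coeff_eq_zero_of_lt_order hk⟩

/-- The Cauchy product over an index interval that depends only on the order bounds. In a family
with uniform bounds the same finite sum works at every parameter, so it can be differentiated and
shown holomorphic term by term. -/
lemma coeff_mul_eq_sum {f g : LS} {a b : ℤ} (hf : Ord f a) (hg : Ord g b) (k : ℤ) :
    (f * g).coeff k = ∑ i ∈ Finset.Icc a (k - b), f.coeff i * g.coeff (k - i) := by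
  rw [HahnSeries.coeff_mul]
  refine Finset.sum_of_injOn Prod.fst ?_ ?_ ?_ ?_
  · rintro ⟨x, y⟩ hx ⟨x', y'⟩ hx' h
    simp only [Finset.mem_coe, Finset.mem_antidiagonal] at hx hx' h
    ext <;> grind
  · rintro ⟨x, y⟩ hx
    simp only [Finset.mem_coe, Finset.mem_antidiagonal, HahnSeries.mem_support,
      Finset.mem_Icc] at hx ⊢
    obtain ⟨h1, h2, h3⟩ := hx
    have := mt (hf x) h1
    have := mt (hg y) h2
    omega
  · intro i _ h
    by_contra hne
    refine h ⟨(i, k - i), ?_, rfl⟩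
    simp only [Finset.mem_coe, Finset.mem_antidiagonal, HahnSeries.mem_support]
    exact ⟨left_ne_zero_of_mul hne, right_ne_zero_of_mul hne, by omega⟩
  · rintro ⟨x, y⟩ hx
    simp only [Finset.mem_antidiagonal] at hx
    obtain ⟨_, _, h3⟩ := hx
    simp only
    rw [← h3, add_sub_cancel_left]

lemma coeff_C_mul (c : ℂ) (f : LS) (k : ℤ) : (HahnSeries.C c * f).coeff k = c * f.coeff k := by
  rw [HahnSeries.C_mul_eq_smul]; rfl

lemma coeff_C (c : ℂ) (k : ℤ) : (HahnSeries.C c : LS).coeff k = if k = 0 then c else 0 := by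
  rw [HahnSeries.C_apply, HahnSeries.coeff_single]
  congr

lemma coeff_lX (k : ℤ) : lX.coeff k = if k = 1 then 1 else 0 := by
  rw [lX, HahnSeries.coeff_single]
  congr

lemma coeff_one' (k : ℤ) : (1 : LS).coeff k = if k = 0 then 1 else 0 := coeff_C 1 k

/-- The monomial `X^k`. -/
def sX (k : ℤ) : LS := HahnSeries.single k (1 : ℂ)

lemma coeff_sX (a k : ℤ) : (sX a).coeff k = if k = a then 1 else 0 := by
  rw [sX, HahnSeries.coeff_single]
  congr

lemma coeff_sX_mul (a : ℤ) (f : LS) (k : ℤ) : (sX a * f).coeff k = f.coeff (k - a) := by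
  rw [sX, HahnSeries.coeff_single_mul, one_mul]

lemma sX_zero : sX 0 = 1 := rfl

lemma sX_mul_sX (a b : ℤ) : sX a * sX b = sX (a + b) := by
  rw [sX, sX, HahnSeries.single_mul_single, mul_one]; rfl

lemma sX_ne_zero (a : ℤ) : sX a ≠ 0 := fun h => by
  simpa [coeff_sX] using congrArg (fun f : LS => f.coeff a) h

lemma sX_neg (a : ℤ) : sX (-a) = (sX a)⁻¹ :=
  eq_inv_of_mul_eq_one_left (by rw [sX_mul_sX, neg_add_cancel, sX_zero])

lemma lX_zpow (a : ℤ) : lX ^ a = sX a := by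
  have hp : ∀ k : ℕ, lX ^ k = sX k := fun k => by
    induction k with
    | zero => simp [sX_zero]
    | succ k ih => rw [pow_succ, ih, show lX = sX 1 from rfl, sX_mul_sX]; simp
  obtain ⟨k, rfl | rfl⟩ := a.eq_nat_or_neg
  · rw [zpow_natCast, hp]
  · rw [zpow_neg, zpow_natCast, hp, sX_neg]

lemma lX_inv : lX⁻¹ = sX (-1) := by rw [← lX_zpow, zpow_neg_one]

namespace Ord

variable {f g : LS} {a b : ℤ}

lemma mono (hf : Ord f a) (h : b ≤ a) : Ord f b := fun k hk => hf k (by omega)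

lemma add (hf : Ord f a) (hg : Ord g a) : Ord (f + g) a := fun k hk => by
  rw [HahnSeries.coeff_add, hf k hk, hg k hk, add_zero]

lemma neg (hf : Ord f a) : Ord (-f) a := fun k hk => by
  rw [HahnSeries.coeff_neg, hf k hk, neg_zero]

lemma sub (hf : Ord f a) (hg : Ord g a) : Ord (f - g) a := fun k hk => by
  rw [HahnSeries.coeff_sub, hf k hk, hg k hk, sub_zero]

lemma zero : Ord 0 a := fun _ _ => rfl

lemma sum {ι : Type*} {s : Finset ι} {F : ι → LS} (h : ∀ i ∈ s, Ord (F i) a) :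
    Ord (∑ i ∈ s, F i) a := by
  classical
  induction s using Finset.induction_on with
  | empty => exact zero
  | insert i s hi ih =>
    rw [Finset.sum_insert hi]
    exact (h i (Finset.mem_insert_self i s)).add
      (ih fun j hj => h j (Finset.mem_insert_of_mem hj))

lemma mul (hf : Ord f a) (hg : Ord g b) : Ord (f * g) (a + b) := fun k hk => by
  rw [coeff_mul_eq_sum hf hg, Finset.Icc_eq_empty (by omega), Finset.sum_empty]

lemma single (c : ℂ) : Ord (HahnSeries.single a c) a := fun k hk => by
  rw [HahnSeries.coeff_single, if_neg (by omega)]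

lemma sX (a : ℤ) : Ord (IsoMon.sX a) a := single 1

lemma C (c : ℂ) : Ord (HahnSeries.C c) 0 := single c

lemma one : Ord 1 0 := C 1

lemma X : Ord lX 1 := single 1

lemma pow (hf : Ord f a) (N : ℕ) : Ord (f ^ N) (N * a) := by
  induction N with
  | zero => simpa using one
  | succ N ih =>
    rw [pow_succ]
    convert ih.mul hf using 1
    push_cast; ring

lemma ofPS (p : PowerSeries ℂ) : Ord (ofPS p) 0 := fun k hk => by
  have := PowerSeries.coeff_coe p k
  rw [if_pos hk] at this
  exact this

/-- The lowest coefficient of a product. -/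
lemma coeff_mul (hf : Ord f a) (hg : Ord g b) :
    (f * g).coeff (a + b) = f.coeff a * g.coeff b := by
  rw [coeff_mul_eq_sum hf hg]
  simp

lemma coeff_mul_of_eq (hf : Ord f a) (hg : Ord g b) {k : ℤ} (hk : k = a + b) :
    (f * g).coeff k = f.coeff a * g.coeff b := by
  rw [hk, hf.coeff_mul hg]

/-- The next-to-lowest coefficient of a product. -/
lemma coeff_mul_next (hf : Ord f a) (hg : Ord g b) {k : ℤ} (hk : k = a + b + 1) :
    (f * g).coeff k = f.coeff a * g.coeff (b + 1) + f.coeff (a + 1) * g.coeff b := by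
  rw [coeff_mul_eq_sum hf hg, show k - b = a + 1 by omega,
    show Finset.Icc a (a + 1) = {a, a + 1} by ext; simp; omega, Finset.sum_pair (by omega), hk]
  congr 3 <;> ring_nf

end Ord

lemma coeff_ofPS (p : PowerSeries ℂ) (k : ℕ) : (ofPS p).coeff (k : ℤ) = PowerSeries.coeff k p :=
  LaurentSeries.coeff_coe_powerSeries p k

lemma coeff_ofPS_mk (c : ℕ → ℂ) (k : ℕ) : (ofPS (PowerSeries.mk c)).coeff (k : ℤ) = c k := by
  rw [coeff_ofPS, PowerSeries.coeff_mk]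

lemma ofPS_mk_of_ord {f : LS} (hf : Ord f 0) :
    ofPS (PowerSeries.mk fun k : ℕ => f.coeff k) = f := by
  ext k
  rcases lt_or_ge k 0 with hk | hk
  · rw [hf k hk, Ord.ofPS _ k hk]
  · lift k to ℕ using hk
    rw [coeff_ofPS_mk]

lemma ord_succ {f : LS} {a : ℤ} (hf : Ord f a) (h0 : f.coeff a = 0) : Ord f (a + 1) :=
  fun k hk => by
    rcases lt_or_eq_of_le (Int.lt_add_one_iff.1 hk) with h | h
    · exact hf k h
    · rw [h, h0]

lemma ne_zero_of_coeff {f : LS} {k : ℤ} (h : f.coeff k ≠ 0) : f ≠ 0 := by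
  rintro rfl; exact h rfl

/-- The product of the two lowest nonzero coefficients is a coefficient of 1, so it must sit in
degree 0; this fixes the order of the inverse. -/
lemma Ord.inv {f : LS} {a : ℤ} (hf : Ord f a) (h0 : f.coeff a ≠ 0) : Ord f⁻¹ (-a) := by
  have hne := ne_zero_of_coeff h0
  have hg : Ord f⁻¹ f⁻¹.order := fun _ hk => HahnSeries.coeff_eq_zero_of_lt_order hk
  have hg0 : f⁻¹.coeff f⁻¹.order ≠ 0 := by
    rw [Ne, HahnSeries.coeff_order_eq_zero]; exact inv_ne_zero hne
  have h1 := hf.coeff_mul hg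
  rw [mul_inv_cancel₀ hne, coeff_one'] at h1
  have h2 : a + f⁻¹.order = 0 := by
    by_contra h
    rw [if_neg h] at h1
    exact mul_ne_zero h0 hg0 h1.symm
  exact hg.mono (by omega)

lemma Ord.coeff_inv {f : LS} {a : ℤ} (hf : Ord f a) (h0 : f.coeff a ≠ 0) :
    f⁻¹.coeff (-a) = (f.coeff a)⁻¹ := by
  have h1 := hf.coeff_mul (hf.inv h0)
  rw [mul_inv_cancel₀ (ne_zero_of_coeff h0), coeff_one', if_pos (by ring)] at h1
  exact eq_inv_of_mul_eq_one_right h1.symm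

attribute [local irreducible] HahnSeries.instMul HahnSeries.instAdd

/-! ### The derivative -/

lemma coeff_lD (f : LS) (k : ℤ) : (lD f).coeff k = (k + 1) * f.coeff (k + 1) := by
  rw [lD, LaurentSeries.derivative_apply, LaurentSeries.hasseDeriv_coeff]
  simp

lemma lD_add (f g : LS) : lD (f + g) = lD f + lD g := map_add _ f g

lemma lD_sub (f g : LS) : lD (f - g) = lD f - lD g := map_sub _ f g

lemma lD_zero : lD 0 = 0 := map_zero _

lemma res_lD (f : LS) : res (lD f) = 0 := by
  rw [res, coeff_lD]; simp

lemma Ord.lD {f : LS} {a : ℤ} (hf : Ord f a) : Ord (lD f) (a - 1) := fun k hk => by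
  rw [coeff_lD, hf _ (by omega), mul_zero]

/-- No order is lost here because the derivative has factor k + 1, which vanishes at k = -1. -/
lemma Ord.lD_zero {f : LS} (hf : Ord f 0) : Ord (IsoMon.lD f) 0 := fun k hk => by
  rw [coeff_lD]
  rcases eq_or_ne k (-1) with rfl | h
  · simp
  · rw [hf _ (by omega), mul_zero]

lemma lD_single (a : ℤ) (c : ℂ) :
    lD (HahnSeries.single a c) = HahnSeries.single (a - 1) (a * c) := by
  ext k
  rw [coeff_lD, HahnSeries.coeff_single, HahnSeries.coeff_single]
  by_cases h : k + 1 = a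
  · rw [if_pos h, if_pos (by omega), ← h]; push_cast; ring
  · rw [if_neg h, if_neg (by omega), mul_zero]

lemma lD_sX (a : ℤ) : lD (sX a) = HahnSeries.C (a : ℂ) * sX (a - 1) := by
  ext k
  rw [sX, lD_single, HahnSeries.coeff_single, coeff_C_mul, coeff_sX]
  split_ifs <;> simp

lemma lD_C (c : ℂ) : lD (HahnSeries.C c) = 0 := by
  rw [HahnSeries.C_apply, lD_single]; simp

lemma lD_one : lD 1 = 0 := lD_C 1

lemma lD_lX : lD lX = 1 := by
  rw [lX, lD_single]; simp

lemma lD_mul (f g : LS) : lD (f * g) = lD f * g + f * lD g := by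
  obtain ⟨a, hf⟩ := exists_ord f
  obtain ⟨b, hg⟩ := exists_ord g
  ext k
  rw [coeff_lD, HahnSeries.coeff_add, coeff_mul_eq_sum hf hg, coeff_mul_eq_sum hf.lD hg,
    coeff_mul_eq_sum hf hg.lD]
  have h1 : ∑ i ∈ Finset.Icc (a - 1) (k - b), (lD f).coeff i * g.coeff (k - i)
      = ∑ i ∈ Finset.Icc a (k + 1 - b), i * f.coeff i * g.coeff (k + 1 - i) := by
    refine Finset.sum_nbij' (fun i => i + 1) (fun i => i - 1) ?_ ?_ ?_ ?_ ?_
    · intro i hi; simp only [Finset.mem_Icc] at hi ⊢; omega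
    · intro i hi; simp only [Finset.mem_Icc] at hi ⊢; omega
    · intro i _; simp
    · intro i _; simp
    · intro i _
      rw [coeff_lD, show k + 1 - (i + 1) = k - i by ring]; push_cast; ring
  rw [h1, show k - (b - 1) = k + 1 - b by ring, Finset.mul_sum, ← Finset.sum_add_distrib]
  refine Finset.sum_congr rfl fun i _ => ?_
  rw [coeff_lD, show k - i + 1 = k + 1 - i by ring]
  push_cast; ring

lemma lD_C_mul (c : ℂ) (f : LS) : lD (HahnSeries.C c * f) = HahnSeries.C c * lD f := by
  rw [lD_mul, lD_C, zero_mul, zero_add]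

lemma map_lD_mul (A B : Mat2 LS) : (A * B).map lD = A.map lD * B + A * B.map lD := by
  ext1 a b
  simp only [Matrix.map_apply, Matrix.mul_apply, Matrix.add_apply, Fin.sum_univ_two, lD_add, lD_mul]
  ring

lemma map_lD_one : (1 : Mat2 LS).map lD = 0 := by
  ext1 a b
  by_cases h : a = b
  · subst h; simp [lD_one]
  · simp [h, lD_zero]

section

variable {μ : ℕ} {n : Pole μ → ℕ}

/-! ### Analytic families of Laurent series -/

lemma isOpen_setOf_injective {X ι : Type*} [TopologicalSpace X] [Finite ι] {f : X → ι → ℂ}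
    (hf : ∀ i, Continuous fun x => f x i) : IsOpen {x | Function.Injective (f x)} := by
  have : {x | Function.Injective (f x)} = ⋂ i, ⋂ j, {x | i ≠ j → f x i ≠ f x j} := by
    ext x
    simp only [Set.mem_ofPred_eq, Set.mem_iInter, Function.Injective]
    exact forall_congr' fun i => forall_congr' fun j => not_imp_not.symm
  rw [this]
  refine isOpen_iInter_of_finite fun i => isOpen_iInter_of_finite fun j => ?_
  by_cases h : i = j
  · simp [h]
  · simpa [h] using isOpen_ne_fun (hf i) (hf j)

lemma analyticAt_tOf (k : Fin μ) (m : Param n) : AnalyticAt ℂ (fun m : Param n => tOf m k) m :=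
  (((ContinuousLinearMap.proj k).comp (ContinuousLinearMap.fst ℂ _ _)).comp
    ((ContinuousLinearMap.snd ℂ _ _).comp (ContinuousLinearMap.snd ℂ _ _))
      : Param n →L[ℂ] ℂ).analyticAt m

lemma analyticAt_thetaOf (i : Pole μ) (a : Fin 2) (l : Fin (n i - 1)) (m : Param n) :
    AnalyticAt ℂ (fun m : Param n => thetaOf m i a l) m :=
  ((ContinuousLinearMap.proj l).comp ((ContinuousLinearMap.proj a).comp
    ((ContinuousLinearMap.proj (φ := fun i : Pole μ => Fin 2 → Fin (n i - 1) → ℂ) i).comp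
      ((ContinuousLinearMap.snd ℂ _ _).comp ((ContinuousLinearMap.snd ℂ _ _).comp
        (ContinuousLinearMap.snd ℂ _ _))))) : Param n →L[ℂ] ℂ).analyticAt m

lemma analyticAt_qOf (j : Fin (numApp n)) (m : Param n) :
    AnalyticAt ℂ (fun m : Param n => qOf m j) m :=
  ((ContinuousLinearMap.proj j).comp (ContinuousLinearMap.fst ℂ _ _) : Param n →L[ℂ] ℂ).analyticAt m

lemma analyticAt_pOf (j : Fin (numApp n)) (m : Param n) :
    AnalyticAt ℂ (fun m : Param n => pOf m j) m :=
  ((ContinuousLinearMap.proj j).comp ((ContinuousLinearMap.fst ℂ _ _).comp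
    (ContinuousLinearMap.snd ℂ _ _)) : Param n →L[ℂ] ℂ).analyticAt m

lemma analyticAt_pos (k : Fin (μ + 2)) (m : Param n) :
    AnalyticAt ℂ (fun m : Param n => pos m k) m := by
  unfold pos
  refine Fin.cases ?_ (fun k => Fin.cases ?_ (fun k => ?_) k) k
  · simpa using analyticAt_const
  · simpa using analyticAt_const
  · simpa using analyticAt_tOf k m

lemma analyticAt_polarCoeff (θ₀ : Pole μ → Fin 2 → ℂ) (i : Pole μ) (a : Fin 2) (l : ℕ)
    (m : Param n) : AnalyticAt ℂ (fun m : Param n => polarCoeff θ₀ m i a l) m := by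
  unfold polarCoeff
  split_ifs
  · exact analyticAt_thetaOf _ _ _ _
  · exact analyticAt_const

lemma isOpen_phaseSpace (n : Pole μ → ℕ) : IsOpen (phaseSpace n) := by
  have hq : ∀ j, Continuous fun m : Param n => qOf m j := fun j =>
    continuous_iff_continuousAt.2 fun m => (analyticAt_qOf j m).continuousAt
  have ht : ∀ j, Continuous fun m : Param n => pos m j := fun j =>
    continuous_iff_continuousAt.2 fun m => (analyticAt_pos j m).continuousAt
  have h1 : IsOpen (⋂ j, ⋂ k, {m : Param n | qOf m j ≠ pos m k}) :=
    isOpen_iInter_of_finite fun j => isOpen_iInter_of_finite fun k => isOpen_ne_fun (hq j) (ht k)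
  have h2 : IsOpen (⋂ i, ⋂ h : 0 < n i - 1,
      {m : Param n | thetaOf m i 0 ⟨0, h⟩ ≠ thetaOf m i 1 ⟨0, h⟩}) :=
    isOpen_iInter_of_finite fun i => isOpen_iInter_of_finite fun h =>
      isOpen_ne_fun
        (continuous_iff_continuousAt.2 fun m => (analyticAt_thetaOf i 0 ⟨0, h⟩ m).continuousAt)
        (continuous_iff_continuousAt.2 fun m => (analyticAt_thetaOf i 1 ⟨0, h⟩ m).continuousAt)
  convert (isOpen_setOf_injective ht).inter ((isOpen_setOf_injective hq).inter (h1.inter h2))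
    using 1
  ext m
  simp [phaseSpace]

/-- Functions that are holomorphic on the extended phase space. -/
abbrev Ana (f : Param n → ℂ) : Prop := AnalyticOnNhd ℂ f (phaseSpace n)

lemma Ana.congr {f g : Param n → ℂ} (hf : Ana f) (h : ∀ m ∈ phaseSpace n, f m = g m) : Ana g :=
  AnalyticOnNhd.congr (isOpen_phaseSpace n) hf h

lemma ana_fderiv {f : Param n → ℂ} (hf : Ana f) (v : Param n) : Ana fun m => fderiv ℂ f m v :=
  fun m hm => (ContinuousLinearMap.apply ℂ ℂ v).analyticAt _ |>.comp (hf.fderiv m hm)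

/-- Identities are available only on the phase space; since it is open, they may still be
differentiated there. -/
lemma fderiv_congr_phaseSpace {f g : Param n → ℂ} (h : ∀ m ∈ phaseSpace n, f m = g m)
    {m : Param n} (hm : m ∈ phaseSpace n) : fderiv ℂ f m = fderiv ℂ g m :=
  Filter.EventuallyEq.fderiv_eq
    (Filter.eventuallyEq_of_mem ((isOpen_phaseSpace n).mem_nhds hm) h)

/-- Holomorphic families of Laurent series that are `O(X^a)`. -/
def FamO (a : ℤ) (f : Param n → LS) : Prop :=
  (∀ m ∈ phaseSpace n, Ord (f m) a) ∧ ∀ k, Ana fun m => (f m).coeff k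

/-- Holomorphic families of Laurent series, with uniformly bounded pole order. -/
def Fam (f : Param n → LS) : Prop := ∃ a, FamO a f

variable {f g : Param n → LS}

lemma Fam.ana (hf : Fam f) (k : ℤ) : Ana fun m => (f m).coeff k := hf.choose_spec.2 k

lemma Fam.famO (hf : Fam f) {a : ℤ} (h : ∀ m ∈ phaseSpace n, Ord (f m) a) : FamO a f :=
  ⟨h, hf.ana⟩

lemma Fam.congr (hf : Fam f) (h : ∀ m ∈ phaseSpace n, f m = g m) : Fam g := by
  obtain ⟨a, h1, h2⟩ := hf
  exact ⟨a, fun m hm => h m hm ▸ h1 m hm, fun k => (h2 k).congr fun m hm => by rw [h m hm]⟩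

lemma Fam.add (hf : Fam f) (hg : Fam g) : Fam fun m => f m + g m := by
  obtain ⟨a, h1, h2⟩ := hf
  obtain ⟨b, h3, h4⟩ := hg
  exact ⟨min a b, fun m hm => ((h1 m hm).mono (min_le_left _ _)).add
    ((h3 m hm).mono (min_le_right _ _)), fun k => by
      simp only [HahnSeries.coeff_add]
      exact (h2 k).add (h4 k)⟩

lemma Fam.neg (hf : Fam f) : Fam fun m => -f m := by
  obtain ⟨a, h1, h2⟩ := hf
  exact ⟨a, fun m hm => (h1 m hm).neg, fun k => (h2 k).neg⟩

lemma Fam.sub (hf : Fam f) (hg : Fam g) : Fam fun m => f m - g m := by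
  simpa only [sub_eq_add_neg] using hf.add hg.neg

lemma Fam.mul (hf : Fam f) (hg : Fam g) : Fam fun m => f m * g m := by
  obtain ⟨a, h1, h2⟩ := hf
  obtain ⟨b, h3, h4⟩ := hg
  refine ⟨a + b, fun m hm => (h1 m hm).mul (h3 m hm), fun k => ?_⟩
  have : Ana fun m => ∑ i ∈ Finset.Icc a (k - b), (f m).coeff i * (g m).coeff (k - i) :=
    Finset.analyticOnNhd_fun_sum _ fun i _ => (h2 i).mul (h4 _)
  exact this.congr fun m hm => (coeff_mul_eq_sum (h1 m hm) (h3 m hm) k).symm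

lemma Fam.const (c : LS) : Fam fun _ : Param n => c :=
  let ⟨a, ha⟩ := exists_ord c
  ⟨a, fun _ _ => ha, fun _ => analyticOnNhd_const⟩

lemma Fam.C {c : Param n → ℂ} (hc : Ana c) : Fam fun m => (HahnSeries.C (c m) : LS) := by
  refine ⟨0, fun m _ => Ord.C _, fun k => ?_⟩
  simp only [coeff_C]
  split_ifs
  · exact hc
  · exact analyticOnNhd_const

lemma Fam.single {c : Param n → ℂ} (hc : Ana c) (k : ℤ) :
    Fam fun m => (HahnSeries.single k (c m) : LS) := by
  have := (Fam.C hc).mul (Fam.const (HahnSeries.single k (1 : ℂ)))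
  refine this.congr fun m _ => ?_
  rw [HahnSeries.C_apply, HahnSeries.single_mul_single, zero_add, mul_one]

lemma Fam.sum {ι : Type*} {s : Finset ι} {F : ι → Param n → LS} (h : ∀ i ∈ s, Fam (F i)) :
    Fam fun m => ∑ i ∈ s, F i m := by
  classical
  induction s using Finset.induction_on with
  | empty => simpa using Fam.const 0
  | insert i s hi ih =>
    simp only [Finset.sum_insert hi]
    exact (h i (Finset.mem_insert_self i s)).add
      (ih fun j hj => h j (Finset.mem_insert_of_mem hj))

lemma Fam.prod {ι : Type*} {s : Finset ι} {F : ι → Param n → LS} (h : ∀ i ∈ s, Fam (F i)) :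
    Fam fun m => ∏ i ∈ s, F i m := by
  classical
  induction s using Finset.induction_on with
  | empty => simpa using Fam.const 1
  | insert i s hi ih =>
    simp only [Finset.prod_insert hi]
    exact (h i (Finset.mem_insert_self i s)).mul
      (ih fun j hj => h j (Finset.mem_insert_of_mem hj))

lemma Fam.pow (hf : Fam f) (N : ℕ) : Fam fun m => f m ^ N := by
  simpa using Fam.prod (s := Finset.range N) fun _ _ => hf

lemma Fam.lD (hf : Fam f) : Fam fun m => lD (f m) := by
  obtain ⟨a, h1, h2⟩ := hf
  refine ⟨a - 1, fun m hm => (h1 m hm).lD, fun k => ?_⟩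
  simp only [coeff_lD]
  exact analyticOnNhd_const.mul (h2 _)

lemma Fam.inv (hf : Fam f) {a : ℤ} (ha : ∀ m ∈ phaseSpace n, Ord (f m) a)
    (h0 : ∀ m ∈ phaseSpace n, (f m).coeff a ≠ 0) : Fam fun m => (f m)⁻¹ := by
  refine ⟨-a, fun m hm => (ha m hm).inv (h0 m hm), ?_⟩
  -- Induction on the number of known coefficients: f · f⁻¹ = 1 expresses the next coefficient of
  -- the inverse through the earlier ones, divided by the leading coefficient of f.
  suffices h : ∀ N : ℕ, ∀ j < -a + N, Ana fun m => (f m)⁻¹.coeff j by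
    intro k
    exact h (k + a + 1).toNat k (by omega)
  intro N
  induction N with
  | zero =>
    intro j hj
    exact (analyticOnNhd_const (v := (0 : ℂ))).congr (isOpen_phaseSpace n) fun m hm =>
      ((ha m hm).inv (h0 m hm) j (by simpa using hj)).symm
  | succ N ih =>
    intro j hj
    have hA : Ana fun m => ((f m).coeff a)⁻¹ * ((1 : LS).coeff (j + a)
        - ∑ i ∈ Finset.Ioc a (j + a + a), (f m).coeff i * (f m)⁻¹.coeff (j + a - i)) := by
      refine ((hf.ana a).inv h0).mul (analyticOnNhd_const.sub ?_)
      refine Finset.analyticOnNhd_fun_sum _ fun i hi => (hf.ana i).mul (ih _ ?_)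
      rw [Finset.mem_Ioc] at hi
      push_cast at hj
      omega
    refine hA.congr fun m hm => ?_
    have h1 := coeff_mul_eq_sum (ha m hm) ((ha m hm).inv (h0 m hm)) (j + a)
    rw [mul_inv_cancel₀ (ne_zero_of_coeff (h0 m hm)), sub_neg_eq_add] at h1
    rcases lt_or_ge (j + a + a) a with h | h
    · rw [Finset.Icc_eq_empty (by omega), Finset.sum_empty] at h1
      rw [Finset.Ioc_eq_empty (by omega), Finset.sum_empty, h1,
        (ha m hm).inv (h0 m hm) j (by omega)]
      simp
    · rw [← Finset.Ioc_insert_left h, Finset.sum_insert (by simp),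
        show j + a - a = j by ring] at h1
      rw [h1, add_sub_cancel_right, inv_mul_cancel_left₀ (h0 m hm)]

/-! ### Variations -/

/-- The coefficientwise variation. -/
def cvar (f : Param n → LS) (m v : Param n) : LS :=
  lsMk fun k => fderiv ℂ (fun m' => (f m').coeff k) m v

lemma variation_eq (s : Param n → ℂ) (f : Param n → LS) (m v : Param n) :
    variation s f m v = cvar f m v - HahnSeries.C (fderiv ℂ s m v) * lD (f m) := rfl

variable {m : Param n} (hm : m ∈ phaseSpace n) (v : Param n)
include hm

lemma fderiv_coeff_eq_zero {a : ℤ} (hf : FamO a f) {k : ℤ} (hk : k < a) :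
    fderiv ℂ (fun m' => (f m').coeff k) m v = 0 := by
  rw [fderiv_congr_phaseSpace (g := fun _ => 0) (fun m hm => hf.1 m hm k hk) hm]
  simp

/-- The uniform pole order keeps the support bounded below, so `lsMk` does not take its default
value 0. -/
lemma coeff_cvar (hf : Fam f) (k : ℤ) :
    (cvar f m v).coeff k = fderiv ℂ (fun m' => (f m').coeff k) m v := by
  obtain ⟨a, hf⟩ := hf
  rw [cvar, lsMk, dif_pos]
  · rfl
  · refine ⟨a, fun k hk => ?_⟩
    by_contra h
    exact hk (fderiv_coeff_eq_zero hm v hf (not_le.1 h))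

lemma FamO.cvar {a : ℤ} (hf : FamO a f) : Ord (cvar f m v) a := fun k hk => by
  rw [coeff_cvar hm v ⟨a, hf⟩, fderiv_coeff_eq_zero hm v hf hk]

lemma cvar_congr (h : ∀ m ∈ phaseSpace n, f m = g m) : cvar f m v = cvar g m v := by
  unfold cvar
  congr 1
  ext k
  rw [fderiv_congr_phaseSpace (fun m hm => by rw [h m hm]) hm]

lemma Fam.diff (hf : Fam f) (k : ℤ) : DifferentiableAt ℂ (fun m => (f m).coeff k) m :=
  (hf.ana k m hm).differentiableAt

lemma cvar_add (hf : Fam f) (hg : Fam g) :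
    cvar (fun m => f m + g m) m v = cvar f m v + cvar g m v := by
  ext k
  rw [HahnSeries.coeff_add, coeff_cvar hm v (hf.add hg), coeff_cvar hm v hf, coeff_cvar hm v hg]
  simp only [HahnSeries.coeff_add]
  rw [fderiv_fun_add (hf.diff hm k) (hg.diff hm k)]
  rfl

lemma cvar_mul (hf : Fam f) (hg : Fam g) :
    cvar (fun m => f m * g m) m v = cvar f m v * g m + f m * cvar g m v := by
  obtain ⟨a, ha⟩ := hf
  obtain ⟨b, hb⟩ := hg
  have hf : Fam f := ⟨a, ha⟩
  have hg : Fam g := ⟨b, hb⟩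
  ext k
  rw [HahnSeries.coeff_add, coeff_cvar hm v (hf.mul hg),
    coeff_mul_eq_sum (ha.cvar hm v) (hb.1 m hm), coeff_mul_eq_sum (ha.1 m hm) (hb.cvar hm v),
    fderiv_congr_phaseSpace (fun m hm => coeff_mul_eq_sum (ha.1 m hm) (hb.1 m hm) k) hm,
    fderiv_fun_sum fun i _ => (hf.diff hm i).fun_mul (hg.diff hm _), sum_apply,
    ← Finset.sum_add_distrib]
  refine Finset.sum_congr rfl fun i _ => ?_
  rw [fderiv_fun_mul (hf.diff hm i) (hg.diff hm _), coeff_cvar hm v hf, coeff_cvar hm v hg]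
  simp only [add_apply, smul_apply, smul_eq_mul]
  ring

lemma cvar_const (c : LS) : cvar (fun _ => c) m v = 0 := by
  ext k
  rw [coeff_cvar hm v (Fam.const c)]
  simp

lemma cvar_C {c : Param n → ℂ} (hc : Ana c) :
    cvar (fun m => HahnSeries.C (c m)) m v = HahnSeries.C (fderiv ℂ c m v) := by
  ext k
  rw [coeff_cvar hm v (Fam.C hc)]
  simp only [coeff_C]
  split_ifs <;> simp

lemma cvar_lD (hf : Fam f) : cvar (fun m => lD (f m)) m v = lD (cvar f m v) := by
  ext k
  rw [coeff_cvar hm v hf.lD, coeff_lD, coeff_cvar hm v hf]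
  simp only [coeff_lD]
  rw [fderiv_const_mul (hf.diff hm _)]
  rfl

lemma cvar_add_dir (hf : Fam f) (w : Param n) : cvar f m (v + w) = cvar f m v + cvar f m w := by
  ext k
  rw [HahnSeries.coeff_add, coeff_cvar hm _ hf, coeff_cvar hm _ hf, coeff_cvar hm _ hf, map_add]

lemma cvar_smul_dir (hf : Fam f) (c : ℂ) : cvar f m (c • v) = HahnSeries.C c * cvar f m v := by
  ext k
  rw [coeff_C_mul, coeff_cvar hm _ hf, coeff_cvar hm _ hf, map_smul, smul_eq_mul]

variable (s : Param n → ℂ)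

lemma variation_congr (h : ∀ m ∈ phaseSpace n, f m = g m) :
    variation s f m v = variation s g m v := by
  rw [variation_eq, variation_eq, cvar_congr hm v h, h m hm]

lemma variation_add (hf : Fam f) (hg : Fam g) :
    variation s (fun m => f m + g m) m v = variation s f m v + variation s g m v := by
  simp only [variation_eq, cvar_add hm v hf hg, lD_add]
  ring

/-- The variation at fixed x is the coefficientwise derivative minus δs times d/dX; both are
derivations. -/
lemma variation_mul (hf : Fam f) (hg : Fam g) :
    variation s (fun m => f m * g m) m v = variation s f m v * g m + f m * variation s g m v := by
  simp only [variation_eq, cvar_mul hm v hf hg, lD_mul]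
  ring

lemma variation_lD (hf : Fam f) :
    variation s (fun m => lD (f m)) m v = lD (variation s f m v) := by
  simp only [variation_eq, cvar_lD hm v hf, lD_sub, lD_C_mul]

lemma variation_add_dir (hf : Fam f) (w : Param n) :
    variation s f m (v + w) = variation s f m v + variation s f m w := by
  simp only [variation_eq, cvar_add_dir hm v hf, map_add]
  ring

lemma variation_smul_dir (hf : Fam f) (c : ℂ) :
    variation s f m (c • v) = HahnSeries.C c * variation s f m v := by
  simp only [variation_eq, cvar_smul_dir hm v hf, map_smul, smul_eq_mul, map_mul]
  ring

omit hm
variable {s}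

lemma Fam.cvar (hf : Fam f) : Fam fun m => cvar f m v := by
  obtain ⟨a, hf⟩ := hf
  refine ⟨a, fun m hm => hf.cvar hm v, fun k => ?_⟩
  exact (ana_fderiv (hf.2 k) v).congr fun m hm => (coeff_cvar hm v ⟨a, hf⟩ k).symm

lemma Fam.variation (hs : Ana s) (hf : Fam f) : Fam fun m => variation s f m v := by
  simp only [variation_eq]
  exact (hf.cvar v).sub ((Fam.C (ana_fderiv hs v)).mul hf.lD)

/-! ### Matrices -/

/-- Holomorphic families of matrices of Laurent series. -/
def FamM (A : Param n → Mat2 LS) : Prop := ∀ a b, Fam fun m => A m a b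

variable {A B : Param n → Mat2 LS}

lemma FamM.congr (hA : FamM A) (h : ∀ m ∈ phaseSpace n, A m = B m) : FamM B := fun a b =>
  (hA a b).congr fun m hm => by rw [h m hm]

lemma FamM.mul (hA : FamM A) (hB : FamM B) : FamM fun m => A m * B m := fun a b => by
  simp only [Matrix.mul_apply]
  exact Fam.sum fun c _ => (hA a c).mul (hB c b)

lemma FamM.add (hA : FamM A) (hB : FamM B) : FamM fun m => A m + B m := fun a b =>
  (hA a b).add (hB a b)

lemma FamM.sub (hA : FamM A) (hB : FamM B) : FamM fun m => A m - B m := fun a b =>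
  (hA a b).sub (hB a b)

lemma FamM.map_lD (hA : FamM A) : FamM fun m => (A m).map lD := fun a b => (hA a b).lD

lemma FamM.diagonal {d : Param n → Fin 2 → LS} (h : ∀ a, Fam fun m => d m a) :
    FamM fun m => Matrix.diagonal (d m) := fun a b => by
  by_cases hab : a = b
  · subst hab; simpa using h a
  · simpa [hab] using Fam.const 0

lemma FamM.of {a b c d : Param n → LS} (ha : Fam a) (hb : Fam b) (hc : Fam c) (hd : Fam d) :
    FamM fun m => !![a m, b m; c m, d m] := fun i j => by
  fin_cases i <;> fin_cases j <;> simpa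

lemma FamM.trace (hA : FamM A) : Fam fun m => (A m).trace := by
  simp only [Matrix.trace_fin_two]
  exact (hA 0 0).add (hA 1 1)

lemma FamM.det (hA : FamM A) : Fam fun m => (A m).det := by
  simp only [Matrix.det_fin_two]
  exact ((hA 0 0).mul (hA 1 1)).sub ((hA 0 1).mul (hA 1 0))

lemma FamM.inv (hA : FamM A) {a : ℤ} (ha : ∀ m ∈ phaseSpace n, Ord (A m).det a)
    (h0 : ∀ m ∈ phaseSpace n, (A m).det.coeff a ≠ 0) : FamM fun m => (A m)⁻¹ := by
  have hd := hA.det.inv ha h0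
  simp only [Matrix.inv_def, Ring.inverse_eq_inv', Matrix.adjugate_fin_two]
  intro i j
  simp only [Matrix.smul_apply, smul_eq_mul]
  refine hd.mul ?_
  fin_cases i <;> fin_cases j
  · simpa using hA 1 1
  · simpa using (hA 0 1).neg
  · simpa using (hA 1 0).neg
  · simpa using hA 0 0

lemma FamM.variation (hs : Ana s) (hA : FamM A) : FamM fun m => variationMat s A m v :=
  fun a b => (hA a b).variation v hs

variable (s)
include hm

lemma variationMat_congr (h : ∀ m ∈ phaseSpace n, A m = B m) :
    variationMat s A m v = variationMat s B m v := by
  ext1 a b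
  exact variation_congr hm v s fun m hm => by rw [h m hm]

lemma variationMat_mul (hA : FamM A) (hB : FamM B) :
    variationMat s (fun m => A m * B m) m v =
      variationMat s A m v * B m + A m * variationMat s B m v := by
  ext1 a b
  simp only [variationMat, Matrix.of_apply, Matrix.add_apply, Matrix.mul_apply, Fin.sum_univ_two]
  rw [variation_add hm v s ((hA a 0).mul (hB 0 b)) ((hA a 1).mul (hB 1 b)),
    variation_mul hm v s (hA a 0) (hB 0 b), variation_mul hm v s (hA a 1) (hB 1 b)]
  ring

lemma variationMat_add (hA : FamM A) (hB : FamM B) :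
    variationMat s (fun m => A m + B m) m v = variationMat s A m v + variationMat s B m v := by
  ext1 a b
  exact variation_add hm v s (hA a b) (hB a b)

lemma variationMat_map_lD (hA : FamM A) :
    variationMat s (fun m => (A m).map lD) m v = (variationMat s A m v).map lD := by
  ext1 a b
  exact variation_lD hm v s (hA a b)

lemma variationMat_add_dir (hA : FamM A) (w : Param n) :
    variationMat s A m (v + w) = variationMat s A m v + variationMat s A m w := by
  ext1 a b
  exact variation_add_dir hm v s (hA a b) w

lemma variationMat_smul_dir (hA : FamM A) (c : ℂ) :
    variationMat s A m (c • v) = (HahnSeries.C c : LS) • variationMat s A m v := by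
  ext1 a b
  exact variation_smul_dir hm v s (hA a b) c

end

section

/-! ### Holomorphic gauge transformations -/

/-- Holomorphically invertible matrices. -/
def HolInv (M : Mat2 LS) : Prop := NoPole M ∧ M.det.coeff 0 ≠ 0

lemma NoPole.mul {A B : Mat2 LS} (hA : NoPole A) (hB : NoPole B) : NoPole (A * B) := fun a b => by
  rw [Matrix.mul_apply]
  exact Ord.sum fun c _ => by simpa using Ord.mul (hA a c) (hB c b)

lemma NoPole.neg {A : Mat2 LS} (hA : NoPole A) : NoPole (-A) := fun a b => Ord.neg (hA a b)

lemma NoPole.map_lD {A : Mat2 LS} (hA : NoPole A) : NoPole (A.map lD) :=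
  fun a b => Ord.lD_zero (hA a b)

lemma NoPole.det {A : Mat2 LS} (hA : NoPole A) : Ord A.det 0 := by
  rw [Matrix.det_fin_two]
  simpa using (Ord.mul (hA 0 0) (hA 1 1)).sub (Ord.mul (hA 0 1) (hA 1 0))

lemma NoPole.trace {A : Mat2 LS} (hA : NoPole A) : Ord A.trace 0 := by
  rw [Matrix.trace_fin_two]
  exact Ord.add (hA 0 0) (hA 1 1)

lemma NoPole.of {a b c d : LS} (ha : Ord a 0) (hb : Ord b 0) (hc : Ord c 0) (hd : Ord d 0) :
    NoPole !![a, b; c, d] := fun i j => by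
  fin_cases i <;> fin_cases j
  · exact ha
  · exact hb
  · exact hc
  · exact hd

lemma inv_fin_two (M : Mat2 LS) :
    M⁻¹ = M.det⁻¹ • !![M 1 1, -M 0 1; -M 1 0, M 0 0] := by
  rw [Matrix.inv_def, Ring.inverse_eq_inv', Matrix.adjugate_fin_two]

namespace HolInv

variable {M M' : Mat2 LS}

lemma isUnit_det (h : HolInv M) : IsUnit M.det := isUnit_iff_ne_zero.2 (ne_zero_of_coeff h.2)

lemma mul (h : HolInv M) (h' : HolInv M') : HolInv (M * M') := by
  refine ⟨h.1.mul h'.1, ?_⟩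
  rw [Matrix.det_mul, h.1.det.coeff_mul_of_eq h'.1.det (by ring)]
  exact mul_ne_zero h.2 h'.2

lemma inv (h : HolInv M) : HolInv M⁻¹ := by
  have hd := h.1.det.inv h.2
  constructor
  · rw [inv_fin_two]
    intro a b
    rw [Matrix.smul_apply, smul_eq_mul, ← Ord]
    have := hd.mul (NoPole.of (h.1 1 1) (Ord.neg (h.1 0 1)) (Ord.neg (h.1 1 0)) (h.1 0 0) a b)
    simpa using this
  · rw [Matrix.det_nonsing_inv, Ring.inverse_eq_inv']
    have := h.1.det.coeff_inv h.2
    rw [neg_zero] at this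
    rw [this]
    exact inv_ne_zero h.2

end HolInv

lemma ofPS_map_det (g : Mat2 (PowerSeries ℂ)) : (g.map ofPS).det = ofPS g.det :=
  ((HahnSeries.ofPowerSeries ℤ ℂ).map_det g).symm

lemma holInv_map_ofPS_iff {g : Mat2 (PowerSeries ℂ)} : HolInv (g.map ofPS) ↔ IsUnit g := by
  have h0 := coeff_ofPS g.det 0
  rw [HolInv, ofPS_map_det, Matrix.isUnit_iff_isUnit_det, PowerSeries.isUnit_iff_constantCoeff,
    isUnit_iff_ne_zero, ← PowerSeries.coeff_zero_eq_constantCoeff_apply, ← h0]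
  exact and_iff_right fun a b => Ord.ofPS _

lemma formallyEquiv_iff {A Λ : Mat2 LS} :
    FormallyEquiv A Λ ↔ ∃ M, HolInv M ∧ gauge M A = Λ := by
  constructor
  · rintro ⟨g, hg, h⟩
    exact ⟨_, holInv_map_ofPS_iff.2 hg, h⟩
  · rintro ⟨M, hM, h⟩
    have : (Matrix.of fun a b => PowerSeries.mk fun k : ℕ => (M a b).coeff k).map ofPS = M := by
      ext1 a b
      exact ofPS_mk_of_ord (hM.1 a b)
    exact ⟨_, holInv_map_ofPS_iff.1 (this ▸ hM), by rw [this, h]⟩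

lemma gauge_gauge {g h : Mat2 LS} (A : Mat2 LS) (hg : IsUnit g.det) :
    gauge h (gauge g A) = gauge (g * h) A := by
  simp only [gauge, map_lD_mul, Matrix.mul_inv_rev, mul_add, add_mul, mul_assoc]
  rw [Matrix.nonsing_inv_mul_cancel_left _ _ hg]
  abel

lemma gauge_one (A : Mat2 LS) : gauge 1 A = A := by
  simp [gauge, map_lD_one]

/-- The inverse-free form of a gauge equation is the one that gets solved by series and
differentiated in the parameters. -/
lemma gauge_eq_iff {g A B : Mat2 LS} (hg : IsUnit g.det) :
    gauge g A = B ↔ g.map lD + A * g = g * B := by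
  constructor
  · rintro rfl
    rw [gauge, mul_add, mul_assoc, Matrix.mul_nonsing_inv_cancel_left _ _ hg,
      Matrix.mul_nonsing_inv_cancel_left _ _ hg]
  · intro h
    rw [gauge, mul_assoc, ← mul_add, h, Matrix.nonsing_inv_mul_cancel_left _ _ hg]

lemma formallyEquiv_gauge_iff {H A Λ : Mat2 LS} (hH : HolInv H) :
    FormallyEquiv (gauge H A) Λ ↔ FormallyEquiv A Λ := by
  simp only [formallyEquiv_iff]
  constructor
  · rintro ⟨M, hM, h⟩
    exact ⟨H * M, hH.mul hM, by rw [← gauge_gauge _ hH.isUnit_det, h]⟩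
  · rintro ⟨M, hM, h⟩
    exact ⟨H⁻¹ * M, hH.inv.mul hM, by
      rw [gauge_gauge _ hH.isUnit_det, Matrix.mul_nonsing_inv_cancel_left _ _ hH.isUnit_det, h]⟩

/-- A holomorphic gauge transformation preserves the polar part of the trace, and the part of order
less than the pole order of the determinant. -/
lemma polar_of_gauge {M A : Mat2 LS} {Λ : Fin 2 → LS} {N : ℤ} (hN : 0 ≤ N) (hM : HolInv M)
    (h : gauge M A = Matrix.diagonal Λ) (hΛ : ∀ a, Ord (Λ a) (-N)) :
    Ord (A.trace - (Λ 0 + Λ 1)) 0 ∧ Ord (A.det - Λ 0 * Λ 1) (-N) := by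
  -- A is conjugate to Λ - R with R holomorphic. The trace changes by a holomorphic term, and the
  -- determinant by products of an entry of Λ with an entry of R, of pole order at most N.
  set R := M⁻¹ * M.map lD with hR
  have hRp : NoPole R := hM.inv.1.mul hM.1.map_lD
  have h1 : M⁻¹ * A * M = Matrix.diagonal Λ - R := by rw [← h, gauge]; abel
  have htr : A.trace = (Matrix.diagonal Λ - R).trace := by
    rw [← h1, Matrix.trace_mul_comm, ← mul_assoc, Matrix.mul_nonsing_inv _ hM.isUnit_det, one_mul]
  have hdet : A.det = (Matrix.diagonal Λ - R).det := by
    rw [← h1, Matrix.det_mul, Matrix.det_mul, mul_right_comm, ← Matrix.det_mul,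
      Matrix.nonsing_inv_mul _ hM.isUnit_det, Matrix.det_one, one_mul]
  constructor
  · rw [htr, Matrix.trace_sub]
    simpa [Matrix.trace_fin_two] using hRp.trace.neg
  · rw [hdet, Matrix.det_fin_two]
    simp only [Matrix.sub_apply, Matrix.diagonal_apply_eq, ne_eq, zero_ne_one, not_false_eq_true,
      Matrix.diagonal_apply_ne, one_ne_zero, zero_sub]
    have e : (Λ 0 - R 0 0) * (Λ 1 - R 1 1) - -R 0 1 * -R 1 0 - Λ 0 * Λ 1
        = -(Λ 0 * R 1 1) - R 0 0 * Λ 1 + (R 0 0 * R 1 1 - R 0 1 * R 1 0) := by ring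
    rw [e]
    refine ((Ord.neg ?_).sub ?_).add (Ord.mono (Ord.sub (a := 0) ?_ ?_) (by omega))
    · simpa using (hΛ 0).mul (hRp 1 1)
    · simpa using Ord.mul (hRp 0 0) (hΛ 1)
    · simpa using Ord.mul (hRp 0 0) (hRp 1 1)
    · simpa using Ord.mul (hRp 0 1) (hRp 1 0)

/-- Two pairs of Laurent series with a simple leading term whose sums and products agree up to the
relevant order have the same polar parts. -/
lemma ord_sub_of_vieta {L Λ : Fin 2 → LS} {N : ℤ}
    (hL : ∀ a, Ord (L a) (-N)) (hΛ : ∀ a, Ord (Λ a) (-N))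
    (htr : Ord (L 0 + L 1 - (Λ 0 + Λ 1)) 0) (hdet : Ord (L 0 * L 1 - Λ 0 * Λ 1) (-N))
    (hlead : (L 0).coeff (-N) ≠ (Λ 1).coeff (-N)) : Ord (L 0 - Λ 0) 0 := by
  have h1 : Ord (L 0 - Λ 1) (-N) := (hL 0).sub (hΛ 1)
  have h2 : (L 0 - Λ 1).coeff (-N) ≠ 0 := by
    rw [HahnSeries.coeff_sub]; exact sub_ne_zero.2 hlead
  -- The numerator is (L 0 - Λ 0)(L 0 - Λ 1), the quadratic with roots Λ 0, Λ 1 evaluated at L 0. It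
  -- is O(X^{-N}), and the factor L 0 - Λ 1 has exact order -N.
  have e : L 0 - Λ 0 =
      (L 0 * (L 0 + L 1 - (Λ 0 + Λ 1)) - (L 0 * L 1 - Λ 0 * Λ 1)) * (L 0 - Λ 1)⁻¹ := by
    rw [eq_mul_inv_iff_mul_eq₀ (ne_zero_of_coeff h2)]; ring
  rw [e]
  have h3 : Ord (L 0 * (L 0 + L 1 - (Λ 0 + Λ 1))) (-N) := by simpa using (hL 0).mul htr
  simpa using (h3.sub hdet).mul (h1.inv h2)

/-! ### The formal Riccati equation -/

/-- The power series whose coefficients are those of the solution `U = O(X)` of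
`X^n U' = α U + β U² + γ`. -/
def riccatiCoeff (n : ℕ) (α β γ : LS) (s : ℕ) : ℂ :=
  if s = 0 then 0 else
    let W : LS := ofPS (PowerSeries.mk fun j => if j < s then riccatiCoeff n α β γ j else 0)
    (sX n * lD W - α * W - β * W ^ 2 - γ).coeff s
      / (α.coeff 0 - if n = 1 then (s : ℂ) else 0)
termination_by s

def riccati (n : ℕ) (α β γ : LS) : LS := ofPS (PowerSeries.mk (riccatiCoeff n α β γ))

lemma riccatiCoeff_zero (n : ℕ) (α β γ : LS) : riccatiCoeff n α β γ 0 = 0 := by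
  rw [riccatiCoeff, if_pos rfl]

lemma ord_riccati (n : ℕ) (α β γ : LS) : Ord (riccati n α β γ) 1 :=
  ord_succ (Ord.ofPS _) (by
    have := coeff_ofPS_mk (riccatiCoeff n α β γ) 0
    rwa [riccatiCoeff_zero] at this)

/-- The coefficient of X^s in the equation is linear in the s-th coefficient of U, with factor the
constant term of α, reduced by s when n = 1 because X U' then contributes s times that coefficient.
Everything else involves earlier coefficients, so nonvanishing of these factors makes the recursion
solvable. -/
lemma riccati_spec {n : ℕ} (hn : 1 ≤ n) {α β γ : LS} (hα : Ord α 0) (hβ : Ord β 0) (hγ : Ord γ 1)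
    (hne : ∀ s : ℕ, 1 ≤ s → α.coeff 0 - (if n = 1 then (s : ℂ) else 0) ≠ 0) :
    sX n * lD (riccati n α β γ) =
      α * riccati n α β γ + β * riccati n α β γ ^ 2 + γ := by
  set U := riccati n α β γ with hU
  have hU1 : Ord U 1 := ord_riccati n α β γ
  rw [← sub_eq_zero, ← sub_sub, ← sub_sub]
  ext k
  rw [HahnSeries.coeff_zero]
  rcases lt_or_ge k 1 with hk | hk
  · have h1 : Ord (α * U) 1 := by simpa using hα.mul hU1
    have h2 : Ord (β * U ^ 2) 1 := by
      refine (hβ.mul (hU1.pow 2)).mono (by norm_num)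
    have h3 : Ord (sX n * lD U) 1 := by
      refine ((Ord.sX _).mul hU1.lD).mono (by omega)
    exact ((h3.sub h1).sub h2).sub hγ k hk
  · lift k to ℕ using by omega
    have hk1 : 1 ≤ k := by omega
    set W : LS := ofPS (PowerSeries.mk fun j => if j < k then riccatiCoeff n α β γ j else 0)
      with hW
    have hUk : U.coeff k * (α.coeff 0 - if n = 1 then (k : ℂ) else 0)
        = (sX n * lD W - α * W - β * W ^ 2 - γ).coeff k := by
      rw [hU, riccati, coeff_ofPS_mk, riccatiCoeff, if_neg (by omega)]
      simp only
      rw [div_mul_cancel₀ _ (hne k hk1)]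
    have hVk : Ord (U - W) k := fun j hj => by
      rcases lt_or_ge j 0 with h0 | h0
      · exact ((Ord.ofPS _).sub (Ord.ofPS _)) j h0
      · lift j to ℕ using h0
        rw [HahnSeries.coeff_sub, hU, riccati, hW, coeff_ofPS_mk, coeff_ofPS_mk,
          if_pos (by omega), sub_self]
    have hWk : W.coeff k = 0 := by rw [hW, coeff_ofPS_mk, if_neg (by omega)]
    have hV : (U - W).coeff k = U.coeff k := by rw [HahnSeries.coeff_sub, hWk, sub_zero]
    have hW1 : Ord W 1 := ord_succ (Ord.ofPS _) (by
      have := coeff_ofPS_mk (fun j => if j < k then riccatiCoeff n α β γ j else 0) 0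
      simp only [riccatiCoeff_zero, ite_self] at this
      exact this)
    -- W truncates U below degree k. As U - W = O(X^k) and U + W = O(X), the quadratic term does not
    -- reach degree k and only the linear terms change that coefficient.
    have e : sX n * lD U - α * U - β * U ^ 2 - γ
        = (sX n * lD W - α * W - β * W ^ 2 - γ)
          + sX n * lD (U - W) - α * (U - W)
          - β * ((U - W) * (U + W)) := by
      rw [lD_sub]; ring
    have h1 : (α * (U - W)).coeff k = α.coeff 0 * U.coeff k := by
      rw [hα.coeff_mul_of_eq hVk (by ring), hV]
    have h2 : (β * ((U - W) * (U + W))).coeff k = 0 :=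
      hβ.mul (hVk.mul (hU1.add hW1)) k (by omega)
    have h3 : (sX n * lD (U - W)).coeff k
        = (if n = 1 then (k : ℂ) else 0) * U.coeff k := by
      rw [coeff_sX_mul, coeff_lD]
      split_ifs with h
      · subst h
        rw [Nat.cast_one, sub_add_cancel, hV]
        push_cast; ring
      · rw [hVk _ (by omega)]; ring
    rw [e, HahnSeries.coeff_sub, HahnSeries.coeff_sub, HahnSeries.coeff_add, ← hUk, h1, h2, h3]
    ring

variable {μ : ℕ} {n : Pole μ → ℕ}

lemma Fam.ofPS_mk {c : ℕ → Param n → ℂ} (hc : ∀ k, Ana (c k)) :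
    Fam fun m => ofPS (PowerSeries.mk fun k => c k m) := by
  refine ⟨0, fun m _ => Ord.ofPS _, fun k => ?_⟩
  rcases lt_or_ge k 0 with hk | hk
  · refine (analyticOnNhd_const (v := (0 : ℂ))).congr (isOpen_phaseSpace n) fun m _ => ?_
    exact (Ord.ofPS _ k hk).symm
  · lift k to ℕ using hk
    simp only [coeff_ofPS_mk]
    exact hc k

lemma ana_riccatiCoeff (N : ℕ) {α β γ : Param n → LS} (hα : Fam α) (hβ : Fam β) (hγ : Fam γ)
    (hne : ∀ m ∈ phaseSpace n, ∀ s : ℕ, 1 ≤ s →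
      (α m).coeff 0 - (if N = 1 then (s : ℂ) else 0) ≠ 0) (s : ℕ) :
    Ana fun m => riccatiCoeff N (α m) (β m) (γ m) s := by
  induction s using Nat.strong_induction_on with
  | _ s ih =>
    rcases Nat.eq_zero_or_pos s with rfl | hs
    · simp only [riccatiCoeff_zero]
      exact analyticOnNhd_const
    · have hW : Fam fun m => ofPS (PowerSeries.mk fun j =>
          if j < s then riccatiCoeff N (α m) (β m) (γ m) j else 0) := by
        refine Fam.ofPS_mk (c := fun j m => if j < s then riccatiCoeff N (α m) (β m) (γ m) j else 0)
          fun j => ?_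
        split_ifs with h
        · exact ih j h
        · exact analyticOnNhd_const
      have hnum := (((((Fam.const (sX N)).mul hW.lD).sub
        (hα.mul hW)).sub (hβ.mul (hW.pow 2))).sub hγ).ana s
      refine (hnum.div ((hα.ana 0).sub analyticOnNhd_const) fun m hm => hne m hm s hs).congr
        (isOpen_phaseSpace n) fun m _ => ?_
      conv_rhs => rw [riccatiCoeff, if_neg (by omega)]
      rfl

/-! ### Formal linear differential equations -/

/-- The coefficients of the solution `Y = 1 + O(X)` of `Y' = - a Y`. -/
def odeCoeff {R : Type} [Ring R] [Algebra ℂ R] (a : ℕ → R) : ℕ → R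
  | 0 => 1
  | k + 1 => -(((k : ℂ) + 1)⁻¹ • ∑ i : Fin (k + 1), a (k - i) * odeCoeff a i)

lemma odeCoeff_zero {R : Type} [Ring R] [Algebra ℂ R] (a : ℕ → R) : odeCoeff a 0 = 1 := by
  rw [odeCoeff]

lemma odeCoeff_succ {R : Type} [Ring R] [Algebra ℂ R] (a : ℕ → R) (k : ℕ) :
    ((k : ℂ) + 1) • odeCoeff a (k + 1) = -∑ i : Fin (k + 1), a (k - i) * odeCoeff a i := by
  rw [odeCoeff, smul_neg, smul_inv_smul₀ (Nat.cast_add_one_ne_zero k)]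

lemma coeff_ofPS_mul_ofPS (f g : ℕ → ℂ) (k : ℕ) :
    (ofPS (PowerSeries.mk f) * ofPS (PowerSeries.mk g)).coeff k
      = ∑ i : Fin (k + 1), f (k - i) * g i := by
  have : ofPS (PowerSeries.mk f) * ofPS (PowerSeries.mk g)
      = ofPS (PowerSeries.mk f * PowerSeries.mk g) := (map_mul _ _ _).symm
  rw [this, coeff_ofPS, PowerSeries.coeff_mul, Fin.sum_univ_eq_sum_range (fun i => f (k - i) * g i),
    ← Finset.Nat.sum_antidiagonal_swap, Finset.Nat.sum_antidiagonal_eq_sum_range_succ_mk]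
  simp

lemma coeff_seriesMat (ξ : ℕ → Mat2 ℂ) (a b : Fin 2) (k : ℕ) :
    (seriesMat ξ a b).coeff (k : ℤ) = ξ k a b := coeff_ofPS_mk _ _

lemma ord_seriesMat (ξ : ℕ → Mat2 ℂ) : NoPole (seriesMat ξ) := fun _ _ => Ord.ofPS _

lemma ext_of_nat {f g : LS} (hf : Ord f 0) (hg : Ord g 0)
    (h : ∀ k : ℕ, f.coeff (k : ℤ) = g.coeff (k : ℤ)) : f = g := by
  ext k
  rcases lt_or_ge k 0 with hk | hk
  · rw [hf k hk, hg k hk]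
  · lift k to ℕ using hk
    exact h k

lemma lD_odeCoeff (a : ℕ → ℂ) :
    lD (ofPS (PowerSeries.mk (odeCoeff a)))
      = -(ofPS (PowerSeries.mk a) * ofPS (PowerSeries.mk (odeCoeff a))) := by
  refine ext_of_nat (Ord.ofPS _).lD_zero (by simpa using ((Ord.ofPS _).mul (Ord.ofPS _)).neg)
    fun k => ?_
  rw [coeff_lD, HahnSeries.coeff_neg, coeff_ofPS_mul_ofPS, ← odeCoeff_succ]
  have := coeff_ofPS_mk (odeCoeff a) (k + 1)
  push_cast at this ⊢
  rw [this, smul_eq_mul]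

lemma lD_odeCoeff_mat (a : ℕ → Mat2 ℂ) :
    (seriesMat (odeCoeff a)).map lD = -(seriesMat a * seriesMat (odeCoeff a)) := by
  ext1 i j
  refine ext_of_nat ((ord_seriesMat _).map_lD i j)
    (((ord_seriesMat _).mul (ord_seriesMat _)).neg i j) fun k => ?_
  have h1 := congrFun (congrFun (odeCoeff_succ a k) i) j
  have h2 := coeff_seriesMat (odeCoeff a) i j (k + 1)
  rw [Matrix.smul_apply, smul_eq_mul] at h1
  push_cast at h2
  rw [Matrix.map_apply, coeff_lD, h2]
  push_cast
  rw [h1, Matrix.neg_apply, Matrix.neg_apply, HahnSeries.coeff_neg, Matrix.mul_apply,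
    HahnSeries.coeff_sum, Matrix.sum_apply]
  simp only [Matrix.mul_apply]
  rw [Finset.sum_comm]
  congr 1
  exact Finset.sum_congr rfl fun c _ =>
    (coeff_ofPS_mul_ofPS (fun s => a s i c) (fun s => odeCoeff a s c j) k).symm

lemma ana_odeCoeff {a : ℕ → Param n → Mat2 ℂ} (ha : ∀ k i j, Ana fun m => a k m i j) (k : ℕ)
    (i j : Fin 2) : Ana fun m => odeCoeff (fun k => a k m) k i j := by
  induction k using Nat.strong_induction_on generalizing i j with
  | _ k ih =>
    rcases k with _ | k
    · simp only [odeCoeff_zero]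
      exact analyticOnNhd_const
    · simp only [odeCoeff, Matrix.neg_apply, Matrix.smul_apply, smul_eq_mul, Matrix.sum_apply,
        Matrix.mul_apply]
      refine (analyticOnNhd_const.mul ?_).neg
      refine Finset.analyticOnNhd_fun_sum _ fun l _ => ?_
      exact Finset.analyticOnNhd_fun_sum _ fun c _ => (ha _ _ _).mul (ih l l.2 _ _)

end

section

/-! ### Constant matrices -/

lemma constMat_mul (P Q : Mat2 ℂ) : constMat (P * Q) = constMat P * constMat Q :=
  Matrix.map_mul (f := (HahnSeries.C : ℂ →+* LS))

lemma constMat_one : constMat 1 = 1 :=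
  Matrix.map_one _ (map_zero HahnSeries.C) (map_one HahnSeries.C)

lemma map_lD_constMat (P : Mat2 ℂ) : (constMat P).map lD = 0 := by
  ext1 a b; exact lD_C _

lemma noPole_constMat (P : Mat2 ℂ) : NoPole (constMat P) := fun _ _ => Ord.C _

lemma det_constMat (P : Mat2 ℂ) : (constMat P).det = HahnSeries.C P.det :=
  ((HahnSeries.C : ℂ →+* LS).map_det P).symm

lemma holInv_constMat {P : Mat2 ℂ} (hP : IsUnit P) : HolInv (constMat P) := by
  refine ⟨noPole_constMat P, ?_⟩
  rw [det_constMat, coeff_C, if_pos rfl]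
  exact ((Matrix.isUnit_iff_isUnit_det P).1 hP).ne_zero

lemma constMat_inv {P : Mat2 ℂ} (hP : IsUnit P) : (constMat P)⁻¹ = constMat P⁻¹ := by
  refine Matrix.inv_eq_left_inv ?_
  rw [← constMat_mul, Matrix.nonsing_inv_mul _ ((Matrix.isUnit_iff_isUnit_det P).1 hP),
    constMat_one]

/-- The matrix of the coefficients of `X^k`. -/
def coeffMat (k : ℤ) (A : Mat2 LS) : Mat2 ℂ := A.map fun f => f.coeff k

lemma coeffMat_constMat_mul (k : ℤ) (P : Mat2 ℂ) (A : Mat2 LS) :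
    coeffMat k (constMat P * A) = P * coeffMat k A := by
  ext1 a b
  simp [coeffMat, constMat, Matrix.mul_apply]

lemma coeffMat_mul_constMat (k : ℤ) (P : Mat2 ℂ) (A : Mat2 LS) :
    coeffMat k (A * constMat P) = coeffMat k A * P := by
  ext1 a b
  simp [coeffMat, constMat, Matrix.mul_apply]

lemma holInv_seriesMat {ξ : ℕ → Mat2 ℂ} (h : ξ 0 = 1) : HolInv (seriesMat ξ) := by
  refine ⟨ord_seriesMat ξ, ?_⟩
  have hc : ∀ a b, (seriesMat ξ a b).coeff 0 = (1 : Mat2 ℂ) a b := fun a b => by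
    rw [← h]; exact coeff_seriesMat ξ a b 0
  have ho := ord_seriesMat ξ
  rw [Matrix.det_fin_two, HahnSeries.coeff_sub,
    Ord.coeff_mul_of_eq (ho 0 0) (ho 1 1) (by ring), Ord.coeff_mul_of_eq (ho 0 1) (ho 1 0) (by ring)]
  simp [hc]

lemma holInv_frame {P : Mat2 ℂ} {ξ : ℕ → Mat2 ℂ} (hP : IsUnit P) (h : ξ 0 = 1) :
    HolInv (constMat P * seriesMat ξ) := (holInv_constMat hP).mul (holInv_seriesMat h)

/-! ### Formal diagonalization of a system in companion form -/

/-- The leading coefficient of a system in companion form has eigenvalues `τ 0, τ 1`, without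
resonance. -/
structure LeadingData (N : ℕ) (A : Mat2 LS) (τ : Fin 2 → ℂ) : Prop where
  pos : 1 ≤ N
  zero : A 0 0 = 0
  ord : ∀ a b, Ord (A a b) (-N)
  unit : (A 0 1).coeff (-N) ≠ 0
  tr : (A 1 1).coeff (-N) = τ 0 + τ 1
  det : -((A 0 1).coeff (-N) * (A 1 0).coeff (-N)) = τ 0 * τ 1
  ne : τ 0 ≠ τ 1
  nonres : N = 1 → ∀ k : ℤ, τ 0 - τ 1 ≠ k

/-- The matrix of eigenvectors of the leading coefficient. -/
def eigMat (N : ℕ) (A : Mat2 LS) (τ : Fin 2 → ℂ) : Mat2 ℂ :=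
  !![1, 1; τ 0 / (A 0 1).coeff (-N), τ 1 / (A 0 1).coeff (-N)]

/-- After this conjugation the leading coefficient is the diagonal matrix of eigenvalues
(`coeffMat_conjMat`), so off-diagonal entries start one order later; that is what makes the
inhomogeneous term of the Riccati equations O(X). -/
def conjMat (N : ℕ) (A : Mat2 LS) (τ : Fin 2 → ℂ) : Mat2 LS :=
  (constMat (eigMat N A τ))⁻¹ * A * constMat (eigMat N A τ)

def diagU (N : ℕ) (A : Mat2 LS) (τ : Fin 2 → ℂ) : ℕ → ℂ :=
  riccatiCoeff N (sX N * (conjMat N A τ 1 1 - conjMat N A τ 0 0))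
    (sX N * conjMat N A τ 1 0)
    (-(sX N * conjMat N A τ 0 1))

def diagV (N : ℕ) (A : Mat2 LS) (τ : Fin 2 → ℂ) : ℕ → ℂ :=
  riccatiCoeff N (sX N * (conjMat N A τ 0 0 - conjMat N A τ 1 1))
    (sX N * conjMat N A τ 0 1)
    (-(sX N * conjMat N A τ 1 0))

lemma riccati_diagU (N : ℕ) (A : Mat2 LS) (τ : Fin 2 → ℂ) : ofPS (PowerSeries.mk (diagU N A τ)) =
    riccati N (sX N * (conjMat N A τ 1 1 - conjMat N A τ 0 0)) (sX N * conjMat N A τ 1 0)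
      (-(sX N * conjMat N A τ 0 1)) := by
  rw [diagU, riccati]

lemma riccati_diagV (N : ℕ) (A : Mat2 LS) (τ : Fin 2 → ℂ) : ofPS (PowerSeries.mk (diagV N A τ)) =
    riccati N (sX N * (conjMat N A τ 0 0 - conjMat N A τ 1 1)) (sX N * conjMat N A τ 0 1)
      (-(sX N * conjMat N A τ 1 0)) := by
  rw [diagV, riccati]

def diagXi (N : ℕ) (A : Mat2 LS) (τ : Fin 2 → ℂ) (s : ℕ) : Mat2 ℂ :=
  !![if s = 0 then 1 else 0, diagU N A τ s; diagV N A τ s, if s = 0 then 1 else 0]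

def diagExp (N : ℕ) (A : Mat2 LS) (τ : Fin 2 → ℂ) : Fin 2 → LS :=
  ![conjMat N A τ 0 0 + conjMat N A τ 0 1 * ofPS (PowerSeries.mk (diagV N A τ)),
    conjMat N A τ 1 1 + conjMat N A τ 1 0 * ofPS (PowerSeries.mk (diagU N A τ))]

lemma diagXi_zero (N : ℕ) (A : Mat2 LS) (τ : Fin 2 → ℂ) : diagXi N A τ 0 = 1 := by
  rw [diagXi, diagU, diagV, riccatiCoeff_zero, riccatiCoeff_zero, Matrix.one_fin_two]
  simp

lemma diagXi_diag (N : ℕ) (A : Mat2 LS) (τ : Fin 2 → ℂ) {s : ℕ} (hs : 0 < s) (a : Fin 2) :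
    diagXi N A τ s a a = 0 := by
  fin_cases a <;> simp [diagXi, hs.ne']

lemma seriesMat_diagXi (N : ℕ) (A : Mat2 LS) (τ : Fin 2 → ℂ) :
    seriesMat (diagXi N A τ) = !![1, ofPS (PowerSeries.mk (diagU N A τ));
      ofPS (PowerSeries.mk (diagV N A τ)), 1] := by
  have h1 : ofPS (PowerSeries.mk fun s => if s = 0 then (1 : ℂ) else 0) = 1 := by
    refine ext_of_nat (Ord.ofPS _) Ord.one fun k => ?_
    rw [coeff_ofPS_mk, coeff_one']
    simp
  ext1 a b
  fin_cases a <;> fin_cases b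
  · exact h1
  · rfl
  · rfl
  · exact h1

/-- For a matrix with unit diagonal, the diagonal entries of the gauge equation define the
exponents; substituting them into the off-diagonal entries leaves one Riccati equation for U alone
and one for V alone. -/
lemma map_lD_add_mul_of_riccati {B M : Mat2 LS} {U V x : LS} (hM : M = !![1, U; V, 1])
    (hx : x ≠ 0)
    (hU : x * lD U = x * (B 1 1 - B 0 0) * U + x * B 1 0 * U ^ 2 + -(x * B 0 1))
    (hV : x * lD V = x * (B 0 0 - B 1 1) * V + x * B 0 1 * V ^ 2 + -(x * B 1 0)) :
    M.map lD + B * M = M * Matrix.diagonal ![B 0 0 + B 0 1 * V, B 1 1 + B 1 0 * U] := by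
  have hU' : lD U = (B 1 1 - B 0 0) * U + B 1 0 * U ^ 2 - B 0 1 :=
    mul_left_cancel₀ hx (hU.trans (by ring))
  have hV' : lD V = (B 0 0 - B 1 1) * V + B 0 1 * V ^ 2 - B 1 0 :=
    mul_left_cancel₀ hx (hV.trans (by ring))
  subst hM
  ext1 a b
  rw [Matrix.mul_diagonal]
  fin_cases a <;> fin_cases b
  · simp [Matrix.mul_apply, Fin.sum_univ_two, lD_one]
  · simp [Matrix.mul_apply, Fin.sum_univ_two, hU']; ring
  · simp [Matrix.mul_apply, Fin.sum_univ_two, hV']; ring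
  · simp [Matrix.mul_apply, Fin.sum_univ_two, lD_one]; ring

namespace LeadingData

variable {N : ℕ} {A : Mat2 LS} {τ : Fin 2 → ℂ} (h : LeadingData N A τ)
include h

lemma isUnit_eigMat : IsUnit (eigMat N A τ) := by
  rw [Matrix.isUnit_iff_isUnit_det, isUnit_iff_ne_zero, eigMat, Matrix.det_fin_two_of]
  have : 1 * (τ 1 / (A 0 1).coeff (-N)) - 1 * (τ 0 / (A 0 1).coeff (-N))
      = (τ 1 - τ 0) / (A 0 1).coeff (-N) := by ring
  rw [this]
  exact div_ne_zero (sub_ne_zero.2 h.ne.symm) h.unit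

/-- The columns (1, τ_a/b) are eigenvectors of a companion matrix with upper right entry b; the
second row of the eigenvalue equation is the characteristic equation, supplied by the trace and
determinant conditions. -/
lemma coeffMat_conjMat : coeffMat (-N) (conjMat N A τ) = Matrix.diagonal τ := by
  have hu := (Matrix.isUnit_iff_isUnit_det _).1 h.isUnit_eigMat
  have hA : coeffMat (-N) A = !![0, (A 0 1).coeff (-N); (A 1 0).coeff (-N), τ 0 + τ 1] := by
    ext1 a b
    fin_cases a <;> fin_cases b
    · simp [coeffMat, h.zero]
    · rfl
    · rfl
    · exact h.tr
  have hb := h.unit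
  rw [conjMat, constMat_inv h.isUnit_eigMat, mul_assoc, coeffMat_constMat_mul,
    coeffMat_mul_constMat, hA]
  have : (!![0, (A 0 1).coeff (-N); (A 1 0).coeff (-N), τ 0 + τ 1] : Mat2 ℂ) * eigMat N A τ
      = eigMat N A τ * Matrix.diagonal τ := by
    have hd := h.det
    ext1 a b
    fin_cases a <;> fin_cases b
    · simp [eigMat, Matrix.mul_apply]; field_simp
    · simp [eigMat, Matrix.mul_apply]; field_simp
    · simp [eigMat, Matrix.mul_apply]; field_simp; linear_combination -hd
    · simp [eigMat, Matrix.mul_apply]; field_simp; linear_combination -hd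
  rw [this, Matrix.nonsing_inv_mul_cancel_left _ _ hu]

lemma coeff_conjMat (a b : Fin 2) :
    (conjMat N A τ a b).coeff (-N) = Matrix.diagonal τ a b := by
  rw [← h.coeffMat_conjMat]; rfl

lemma ord_conjMat (a b : Fin 2) : Ord (conjMat N A τ a b) (-N) := by
  have hP := (holInv_constMat h.isUnit_eigMat).inv.1
  have hA := h.ord
  rw [conjMat, Matrix.mul_apply]
  refine Ord.sum fun c _ => ?_
  rw [Matrix.mul_apply]
  have h1 : Ord (∑ d, (constMat (eigMat N A τ))⁻¹ a d * A d c) (-N) :=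
    Ord.sum fun d _ => by simpa using Ord.mul (hP a d) (hA d c)
  simpa using h1.mul (noPole_constMat (eigMat N A τ) c b)

lemma ord_sX_mul_conjMat (a b : Fin 2) :
    Ord (sX N * conjMat N A τ a b) 0 := by
  simpa using (Ord.sX N).mul (h.ord_conjMat a b)

lemma coeff_sX_mul_conjMat (a b : Fin 2) :
    (sX N * conjMat N A τ a b).coeff 0 = Matrix.diagonal τ a b := by
  rw [coeff_sX_mul, zero_sub, h.coeff_conjMat]

lemma nonres_left (s : ℕ) (_ : 1 ≤ s) :
    (sX N * (conjMat N A τ 1 1 - conjMat N A τ 0 0)).coeff 0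
      - (if N = 1 then (s : ℂ) else 0) ≠ 0 := by
  rw [mul_sub, HahnSeries.coeff_sub, h.coeff_sX_mul_conjMat, h.coeff_sX_mul_conjMat]
  simp only [Matrix.diagonal_apply_eq]
  split_ifs with hN
  · intro h0
    refine h.nonres hN (-s) ?_
    push_cast
    linear_combination -h0
  · rw [sub_zero]
    exact sub_ne_zero.2 h.ne.symm

lemma nonres_right (s : ℕ) (_ : 1 ≤ s) :
    (sX N * (conjMat N A τ 0 0 - conjMat N A τ 1 1)).coeff 0
      - (if N = 1 then (s : ℂ) else 0) ≠ 0 := by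
  rw [mul_sub, HahnSeries.coeff_sub, h.coeff_sX_mul_conjMat, h.coeff_sX_mul_conjMat]
  simp only [Matrix.diagonal_apply_eq]
  split_ifs with hN
  · intro h0
    refine h.nonres hN s ?_
    push_cast
    linear_combination h0
  · rw [sub_zero]
    exact sub_ne_zero.2 h.ne

lemma ord_neg_sX_mul_conjMat {a b : Fin 2} (hab : a ≠ b) :
    Ord (-(sX N * conjMat N A τ a b)) 1 :=
  ord_succ (h.ord_sX_mul_conjMat a b).neg (by
    rw [HahnSeries.coeff_neg, h.coeff_sX_mul_conjMat, Matrix.diagonal_apply_ne _ hab, neg_zero])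

lemma ord_sX_mul_conjMat_sub (a b : Fin 2) :
    Ord (sX N * (conjMat N A τ a a - conjMat N A τ b b)) 0 := by
  rw [mul_sub]
  exact (h.ord_sX_mul_conjMat a a).sub (h.ord_sX_mul_conjMat b b)

lemma diagU_spec : sX N * lD (ofPS (PowerSeries.mk (diagU N A τ)))
    = sX N * (conjMat N A τ 1 1 - conjMat N A τ 0 0)
        * ofPS (PowerSeries.mk (diagU N A τ))
      + sX N * conjMat N A τ 1 0
        * ofPS (PowerSeries.mk (diagU N A τ)) ^ 2
      + -(sX N * conjMat N A τ 0 1) := by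
  have key := riccati_spec h.pos (h.ord_sX_mul_conjMat_sub 1 0) (h.ord_sX_mul_conjMat 1 0)
    (h.ord_neg_sX_mul_conjMat (a := 0) (b := 1) (by decide)) h.nonres_left
  rwa [← riccati_diagU] at key

lemma diagV_spec : sX N * lD (ofPS (PowerSeries.mk (diagV N A τ)))
    = sX N * (conjMat N A τ 0 0 - conjMat N A τ 1 1)
        * ofPS (PowerSeries.mk (diagV N A τ))
      + sX N * conjMat N A τ 0 1
        * ofPS (PowerSeries.mk (diagV N A τ)) ^ 2
      + -(sX N * conjMat N A τ 1 0) := by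
  have key := riccati_spec h.pos (h.ord_sX_mul_conjMat_sub 0 1) (h.ord_sX_mul_conjMat 0 1)
    (h.ord_neg_sX_mul_conjMat (a := 1) (b := 0) (by decide)) h.nonres_right
  rwa [← riccati_diagV] at key

lemma gauge_diag : gauge (constMat (eigMat N A τ) * seriesMat (diagXi N A τ)) A
    = Matrix.diagonal (diagExp N A τ) := by
  have hu := (holInv_constMat h.isUnit_eigMat).isUnit_det
  have hB : gauge (constMat (eigMat N A τ)) A = conjMat N A τ := by
    rw [gauge, map_lD_constMat, mul_zero, zero_add, conjMat]
  rw [← gauge_gauge _ hu, hB,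
    gauge_eq_iff (holInv_seriesMat (diagXi_zero N A τ)).isUnit_det]
  exact map_lD_add_mul_of_riccati (B := conjMat N A τ) (seriesMat_diagXi N A τ) (sX_ne_zero N)
    h.diagU_spec h.diagV_spec

lemma ord_diagExp (a : Fin 2) : Ord (diagExp N A τ a) (-N) := by
  fin_cases a
  · exact (h.ord_conjMat 0 0).add (by simpa using (h.ord_conjMat 0 1).mul (Ord.ofPS _))
  · exact (h.ord_conjMat 1 1).add (by simpa using (h.ord_conjMat 1 0).mul (Ord.ofPS _))

lemma coeff_diagExp (a : Fin 2) : (diagExp N A τ a).coeff (-N) = τ a := by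
  fin_cases a
  · change (_ + _ : LS).coeff _ = _
    rw [HahnSeries.coeff_add, (h.ord_conjMat 0 1).coeff_mul_of_eq (Ord.ofPS _) (by ring),
      h.coeff_conjMat, h.coeff_conjMat]
    simp
  · change (_ + _ : LS).coeff _ = _
    rw [HahnSeries.coeff_add, (h.ord_conjMat 1 0).coeff_mul_of_eq (Ord.ofPS _) (by ring),
      h.coeff_conjMat, h.coeff_conjMat]
    simp

/-- The exponents have the polar parts prescribed by trace and determinant. -/
lemma ord_diagExp_sub {Λ : Fin 2 → LS} (hΛ : ∀ a, Ord (Λ a) (-N))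
    (hτ : ∀ a, (Λ a).coeff (-N) = τ a)
    (htr : Ord (A 1 1 - (Λ 0 + Λ 1)) 0) (hdet : Ord (-(A 0 1 * A 1 0) - Λ 0 * Λ 1) (-N))
    (a : Fin 2) : Ord (diagExp N A τ a - Λ a) 0 := by
  obtain ⟨h1, h2⟩ := polar_of_gauge (by omega) (holInv_frame h.isUnit_eigMat (diagXi_zero N A τ))
    h.gauge_diag h.ord_diagExp
  rw [Matrix.trace_fin_two, h.zero, zero_add] at h1
  rw [Matrix.det_fin_two, h.zero, zero_mul, zero_sub] at h2
  have h3 : Ord (diagExp N A τ 0 + diagExp N A τ 1 - (Λ 0 + Λ 1)) 0 := by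
    convert htr.sub h1 using 1; ring
  have h4 : Ord (diagExp N A τ 0 * diagExp N A τ 1 - Λ 0 * Λ 1) (-N) := by
    convert hdet.sub h2 using 1; ring
  have h5 : Ord (diagExp N A τ 0 - Λ 0) 0 := ord_sub_of_vieta h.ord_diagExp hΛ h3 h4 (by
    rw [h.coeff_diagExp, hτ]; exact h.ne)
  fin_cases a
  · exact h5
  · have h6 := h3.sub h5
    change Ord (diagExp N A τ 1 - Λ 1) 0
    convert h6 using 1; ring

/-- The exponents after diagonalization differ from Λ by a holomorphic r, and the diagonal gauge H
with H' = -r H removes this difference. -/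
lemma formallyEquiv {Λ : Fin 2 → LS} (hΛ : ∀ a, Ord (Λ a) (-N))
    (hτ : ∀ a, (Λ a).coeff (-N) = τ a)
    (htr : Ord (A 1 1 - (Λ 0 + Λ 1)) 0) (hdet : Ord (-(A 0 1 * A 1 0) - Λ 0 * Λ 1) (-N)) :
    FormallyEquiv A (Matrix.diagonal Λ) := by
  have hr := h.ord_diagExp_sub hΛ hτ htr hdet
  set r : Fin 2 → ℕ → ℂ := fun a k => (diagExp N A τ a - Λ a).coeff k
  set H : Fin 2 → LS := fun a => ofPS (PowerSeries.mk (odeCoeff (r a))) with hH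
  have hH' : ∀ a, lD (H a) = -((diagExp N A τ a - Λ a) * H a) := fun a => by
    rw [hH, lD_odeCoeff, ofPS_mk_of_ord (hr a)]
  have hHo : ∀ a, Ord (H a) 0 := fun a => Ord.ofPS _
  have hH0 : ∀ a, (H a).coeff 0 = 1 := fun a => by
    have := coeff_ofPS_mk (odeCoeff (r a)) 0
    rwa [odeCoeff_zero] at this
  have hD : HolInv (Matrix.diagonal H) := by
    constructor
    · intro a b
      fin_cases a <;> fin_cases b
      · exact hHo 0
      · exact Ord.zero
      · exact Ord.zero
      · exact hHo 1
    · rw [Matrix.det_diagonal, Fin.prod_univ_two, (hHo 0).coeff_mul_of_eq (hHo 1) (by ring), hH0,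
        hH0]
      simp
  have hF := holInv_frame h.isUnit_eigMat (diagXi_zero N A τ)
  refine formallyEquiv_iff.2 ⟨_, hF.mul hD, ?_⟩
  rw [← gauge_gauge _ hF.isUnit_det, h.gauge_diag, gauge_eq_iff hD.isUnit_det]
  ext1 a b
  fin_cases a <;> fin_cases b
  · simp [hH']; ring
  · simp [lD_zero]
  · simp [lD_zero]
  · simp [hH']; ring

end LeadingData

/-! ### Holomorphic dependence of the formal diagonalization on the parameters. -/

section Families

variable {μ : ℕ} {n : Pole μ → ℕ} {N : ℕ} {A : Param n → Mat2 LS} {τ : Param n → Fin 2 → ℂ}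
  (hA : FamM A) (hτ : ∀ a, Ana fun m => τ m a)
  (h : ∀ m ∈ phaseSpace n, LeadingData N (A m) (τ m))
include hA hτ h

lemma ana_eigMat (a b : Fin 2) : Ana fun m => eigMat N (A m) (τ m) a b := by
  have hb := (hA 0 1).ana (-N)
  have h1 : ∀ c, Ana fun m => τ m c / (A m 0 1).coeff (-N) := fun c =>
    (hτ c).div hb fun m hm => (h m hm).unit
  fin_cases a <;> fin_cases b
  · exact analyticOnNhd_const
  · exact analyticOnNhd_const
  · exact h1 0
  · exact h1 1

omit hA hτ h in
lemma FamM.constMat {P : Param n → Mat2 ℂ} (hP : ∀ a b, Ana fun m => P m a b) :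
    FamM fun m => constMat (P m) := fun a b => Fam.C (hP a b)

omit hA hτ h in
lemma FamM.seriesMat {ξ : Param n → ℕ → Mat2 ℂ} (hξ : ∀ s a b, Ana fun m => ξ m s a b) :
    FamM fun m => seriesMat (ξ m) := fun a b => Fam.ofPS_mk fun k => hξ k a b

omit hA hτ h in
lemma FamM.inv_of_holInv (hA : FamM A) (h : ∀ m ∈ phaseSpace n, HolInv (A m)) :
    FamM fun m => (A m)⁻¹ :=
  hA.inv (a := 0) (fun m hm => (h m hm).1.det) fun m hm => (h m hm).2

lemma famM_conjMat : FamM fun m => conjMat N (A m) (τ m) := by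
  have hE := FamM.constMat (ana_eigMat hA hτ h)
  exact ((hE.inv_of_holInv fun m hm => holInv_constMat (h m hm).isUnit_eigMat).mul hA).mul hE

lemma ana_diagU (s : ℕ) : Ana fun m => diagU N (A m) (τ m) s := by
  have hB := famM_conjMat hA hτ h
  have hX : Fam fun _ : Param n => sX N := Fam.const _
  exact ana_riccatiCoeff N (hX.mul ((hB 1 1).sub (hB 0 0))) (hX.mul (hB 1 0))
    (hX.mul (hB 0 1)).neg (fun m hm => (h m hm).nonres_left) s

lemma ana_diagV (s : ℕ) : Ana fun m => diagV N (A m) (τ m) s := by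
  have hB := famM_conjMat hA hτ h
  have hX : Fam fun _ : Param n => sX N := Fam.const _
  exact ana_riccatiCoeff N (hX.mul ((hB 0 0).sub (hB 1 1))) (hX.mul (hB 0 1))
    (hX.mul (hB 1 0)).neg (fun m hm => (h m hm).nonres_right) s

lemma ana_diagXi (s : ℕ) (a b : Fin 2) : Ana fun m => diagXi N (A m) (τ m) s a b := by
  fin_cases a <;> fin_cases b
  · exact analyticOnNhd_const
  · exact ana_diagU hA hτ h s
  · exact ana_diagV hA hτ h s
  · exact analyticOnNhd_const

lemma fam_diagExp (a : Fin 2) : Fam fun m => diagExp N (A m) (τ m) a := by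
  have hB := famM_conjMat hA hτ h
  fin_cases a
  · exact (hB 0 0).add ((hB 0 1).mul (Fam.ofPS_mk fun k => ana_diagV hA hτ h k))
  · exact (hB 1 1).add ((hB 1 0).mul (Fam.ofPS_mk fun k => ana_diagU hA hτ h k))

end Families

end

section

open Polynomial (aeval)

/-! ### Polynomials evaluated at Laurent series -/

lemma algebraMap_eq_C (c : ℂ) : algebraMap ℂ LS c = HahnSeries.C c :=
  LaurentSeries.algebraMap_apply ℂ c

lemma aeval_C' (z : LS) (c : ℂ) : aeval z (Polynomial.C c) = HahnSeries.C c := by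
  rw [Polynomial.aeval_C, algebraMap_eq_C]

lemma aeval_eq_sum (z : LS) (p : Polynomial ℂ) :
    aeval z p = ∑ i ∈ Finset.range (p.natDegree + 1), HahnSeries.C (p.coeff i) * z ^ i := by
  rw [Polynomial.aeval_eq_sum_range]
  refine Finset.sum_congr rfl fun i _ => ?_
  rw [Algebra.smul_def, algebraMap_eq_C]

lemma sX_pow (e : ℤ) (k : ℕ) : sX e ^ k = sX (e * k) := by
  rw [← lX_zpow, ← lX_zpow, zpow_mul, zpow_natCast]

lemma coeff_aeval_sX {e : ℤ} (he : e ≠ 0) (p : Polynomial ℂ) (k : ℕ) :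
    (aeval (sX e) p).coeff (e * k) = p.coeff k := by
  rw [aeval_eq_sum, HahnSeries.coeff_sum]
  simp only [sX_pow, coeff_C_mul, coeff_sX, mul_eq_mul_left_iff, he, or_false, Nat.cast_inj,
    mul_ite, mul_one, mul_zero]
  rw [Finset.sum_ite_eq]
  split_ifs with h
  · rfl
  · rw [Polynomial.coeff_eq_zero_of_natDegree_lt (by simpa using h)]

lemma ord_aeval_of_nonneg {z : LS} (hz : Ord z 0) (p : Polynomial ℂ) : Ord (aeval z p) 0 := by
  rw [aeval_eq_sum]
  exact Ord.sum fun i _ => by simpa using (Ord.C (p.coeff i)).mul (hz.pow i)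

lemma coeff_zero_aeval {z : LS} (hz : Ord z 0) (p : Polynomial ℂ) :
    (aeval z p).coeff 0 = p.eval (z.coeff 0) := by
  have hpow : ∀ i : ℕ, Ord (z ^ i) 0 ∧ (z ^ i).coeff 0 = z.coeff 0 ^ i := fun i => by
    induction i with
    | zero => simpa using Ord.one
    | succ i ih =>
      rw [pow_succ, pow_succ]
      refine ⟨by simpa using ih.1.mul hz, ?_⟩
      rw [ih.1.coeff_mul_of_eq hz (by ring), ih.2]
  rw [aeval_eq_sum, HahnSeries.coeff_sum, Polynomial.eval_eq_sum_range]
  exact Finset.sum_congr rfl fun i _ => by rw [coeff_C_mul, (hpow i).2]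

lemma ord_aeval_neg {p : Polynomial ℂ} {d : ℕ} (hp : p.degree < d) :
    Ord (aeval (sX (-1)) p) (1 - d) := by
  rw [aeval_eq_sum]
  refine Ord.sum fun i _ => ?_
  rcases lt_or_ge i d with hi | hi
  · rw [sX_pow]
    simpa using (((Ord.C (p.coeff i)).mul (Ord.sX _)).mono (by omega))
  · rw [Polynomial.coeff_eq_zero_of_degree_lt (lt_of_lt_of_le hp (by exact_mod_cast hi)), map_zero,
      zero_mul]
    exact Ord.zero

lemma aeval_C_add_X (t : ℂ) (p : Polynomial ℂ) :
    aeval (HahnSeries.C t + lX) p = aeval lX (Polynomial.taylor t p) := by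
  rw [Polynomial.taylor_apply, Polynomial.aeval_comp, map_add, Polynomial.aeval_X, aeval_C', add_comm]

lemma coeff_aeval_C_add_X (t : ℂ) (p : Polynomial ℂ) (k : ℕ) :
    (aeval (HahnSeries.C t + lX) p).coeff k = (Polynomial.taylor t p).coeff k := by
  rw [aeval_C_add_X]
  have := coeff_aeval_sX one_ne_zero (Polynomial.taylor t p) k
  rwa [one_mul] at this

lemma ord_C_add_X (t : ℂ) : Ord (HahnSeries.C t + lX) 0 := (Ord.C t).add (Ord.X.mono (by norm_num))

lemma coeff_C_add_X (t : ℂ) : (HahnSeries.C t + lX : LS).coeff 0 = t := by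
  rw [HahnSeries.coeff_add, coeff_C, coeff_lX]; simp

/-! ### Powers and products -/

/-- `f = O(X^a)` with invertible leading coefficient. -/
def Lead (f : LS) (a : ℤ) : Prop := Ord f a ∧ f.coeff a ≠ 0

namespace Lead

variable {f g : LS} {a b : ℤ}

lemma mul (hf : Lead f a) (hg : Lead g b) : Lead (f * g) (a + b) :=
  ⟨hf.1.mul hg.1, by rw [hf.1.coeff_mul hg.1]; exact mul_ne_zero hf.2 hg.2⟩

lemma inv (hf : Lead f a) : Lead f⁻¹ (-a) :=
  ⟨hf.1.inv hf.2, by rw [hf.1.coeff_inv hf.2]; exact inv_ne_zero hf.2⟩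

lemma one : Lead 1 0 := ⟨Ord.one, by simp⟩

lemma sX (a : ℤ) : Lead (sX a) a := ⟨Ord.sX a, by simp [coeff_sX]⟩

lemma neg (hf : Lead f a) : Lead (-f) a :=
  ⟨hf.1.neg, by rw [HahnSeries.coeff_neg]; exact neg_ne_zero.2 hf.2⟩

lemma pow (hf : Lead f a) (N : ℕ) : Lead (f ^ N) (N * a) := by
  induction N with
  | zero => simpa using one
  | succ N ih =>
    rw [pow_succ]
    convert ih.mul hf using 1
    push_cast; ring

lemma prod {ι : Type*} {s : Finset ι} {F : ι → LS} {d : ι → ℤ} (h : ∀ i ∈ s, Lead (F i) (d i)) :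
    Lead (∏ i ∈ s, F i) (∑ i ∈ s, d i) := by
  classical
  induction s using Finset.induction_on with
  | empty => simpa using one
  | insert i s hi ih =>
    rw [Finset.prod_insert hi, Finset.sum_insert hi]
    exact (h i (Finset.mem_insert_self i s)).mul
      (ih fun j hj => h j (Finset.mem_insert_of_mem hj))

lemma ne_zero (hf : Lead f a) : f ≠ 0 := ne_zero_of_coeff hf.2

lemma congr (hf : Lead f a) (h : a = b) : Lead f b := h ▸ hf

end Lead

lemma lead_C_add_X_sub {t a : ℂ} (h : t ≠ a) : Lead (HahnSeries.C t + lX - HahnSeries.C a) 0 := by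
  refine ⟨(ord_C_add_X t).sub (Ord.C a), ?_⟩
  rw [HahnSeries.coeff_sub, coeff_C_add_X, coeff_C, if_pos rfl]
  exact sub_ne_zero.2 h

lemma C_add_X_sub_self (t : ℂ) : HahnSeries.C t + lX - HahnSeries.C t = sX 1 :=
  add_sub_cancel_left _ _

lemma lead_inv_X_sub (a : ℂ) : Lead (lX⁻¹ - HahnSeries.C a) (-1) := by
  rw [lX_inv]
  refine ⟨(Ord.sX _).sub ((Ord.C a).mono (by norm_num)), ?_⟩
  rw [HahnSeries.coeff_sub, coeff_sX, coeff_C]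
  simp

lemma coeff_inv_X_sub_pow (a : ℂ) (N : ℕ) : ((lX⁻¹ - HahnSeries.C a) ^ N).coeff (-N) = 1 := by
  induction N with
  | zero => simp
  | succ N ih =>
    have h1 := ((lead_inv_X_sub a).pow N).1
    rw [pow_succ, h1.coeff_mul_of_eq (lead_inv_X_sub a).1 (by push_cast; ring),
      mul_neg_one, ih, lX_inv, HahnSeries.coeff_sub, coeff_sX, coeff_C]
    simp

/-! ### The normal form near the poles and the apparent singularities -/

variable {μ : ℕ} {n : Pole μ → ℕ}

lemma degD_eq (n : Pole μ → ℕ) : degD n = n none + ∑ k, n (some k) := Fintype.sum_option _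

lemma three_le_degD (hn : ∀ i, 1 ≤ n i) : 3 ≤ degD n := by
  have h : ∑ _i : Pole μ, 1 ≤ degD n := Finset.sum_le_sum fun i _ => hn i
  simp only [Finset.sum_const, Finset.card_univ, Fintype.card_option, Fintype.card_fin,
    smul_eq_mul, mul_one] at h
  omega

lemma numApp_cast (hn : ∀ i, 1 ≤ n i) : (numApp n : ℤ) = degD n - 3 := by
  have := three_le_degD hn
  rw [numApp]; omega

/-- The entry `(1, 2)` of the connection matrix near the pole `i`. -/
def entB (m : Param n) : Pole μ → LS
  | some k => (Pz m (xAt m (some k)))⁻¹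
  | none => -(sX (-(degD n : ℤ)) * (Pz m lX⁻¹)⁻¹)

/-- The entry `(2, 1)` of the connection matrix near the pole `i`. -/
def entC (m : Param n) (F : NFData μ) : Pole μ → LS
  | some k => c0 m F (xAt m (some k))
  | none => -(sX ((degD n : ℤ) - 4) * c0 m F lX⁻¹)

/-- The entry `(2, 2)` of the connection matrix near the pole `i`. -/
def entD (m : Param n) (F : NFData μ) : Pole μ → LS
  | some k => d0 m F (xAt m (some k))
  | none => -(sX (-2) * d0 m F lX⁻¹) - HahnSeries.C ((degD n : ℂ) - 2) * sX (-1)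

lemma lD_xAt_some (m : Param n) (k : Fin (μ + 2)) : lD (xAt m (some k)) = 1 := by
  rw [xAt, lD_add, lD_C, lD_lX, zero_add]

lemma smul_companion (x b c d : LS) :
    x • (!![0, b; c, d] : Mat2 LS) = !![0, x * b; x * c, x * d] := by
  simp [Matrix.smul_of]

lemma gauge_diagonal_companion {g b c d : LS} (hg : g ≠ 0) :
    gauge (Matrix.diagonal ![1, g]) !![0, b; c, d] = !![0, b * g; g⁻¹ * c, d + g⁻¹ * lD g] := by
  have hu : IsUnit (Matrix.diagonal ![1, g] : Mat2 LS).det := by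
    rw [Matrix.det_diagonal, Fin.prod_univ_two, isUnit_iff_ne_zero]
    exact mul_ne_zero one_ne_zero hg
  rw [gauge_eq_iff hu]
  ext1 i j
  rw [Matrix.add_apply, Matrix.map_apply, Matrix.mul_diagonal, Matrix.diagonal_mul]
  fin_cases i <;> fin_cases j
  · simp [lD_one]
  · simp [lD_zero]
  · simp [lD_zero, hg]
  · simp only [Fin.mk_one, Matrix.diagonal_apply_eq, Matrix.cons_val_one, Matrix.cons_val_fin_one,
      Matrix.of_apply, mul_add, mul_inv_cancel_left₀ hg]
    ring

/-- At infinity dx = -X⁻² dX, while conjugation by diag(1, X^{-(n-2)}) multiplies the (1,2) entry by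
X^{-(n-2)} and the (2,1) entry by X^{n-2}; its logarithmic derivative adds -(n-2)/X to the (2,2)
entry. -/
lemma omegaAt_eq (hn : ∀ i, 1 ≤ n i) (m : Param n) (F : NFData μ) (i : Pole μ) :
    omegaAt m F i = !![0, entB m i; entC m F i, entD m F i] := by
  have h3 := three_le_degD hn
  match i with
  | some k =>
    rw [omegaAt, triv, gauge_one, connAt, lD_xAt_some, one_smul, connMat, entB, entC, entD, one_div]
  | none =>
    have hg : triv m (degD n - 2) none = Matrix.diagonal ![1, sX (-((degD n : ℤ) - 2))] := by
      rw [triv, xAt, lX_inv, sX_pow]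
      congr 4
      omega
    rw [omegaAt, hg, connAt, xAt, connMat, smul_companion,
      gauge_diagonal_companion (sX_ne_zero _), entB, entC, entD, lX_inv, one_div, lD_sX, lD_sX,
      ← sX_neg, neg_neg]
    have e1 : sX (-(degD n : ℤ)) = sX (-1 - 1) * sX (-((degD n : ℤ) - 2)) := by
      rw [sX_mul_sX]; congr 1; ring
    have e2 : sX ((degD n : ℤ) - 4) = sX (-1 - 1) * sX ((degD n : ℤ) - 2) := by
      rw [sX_mul_sX]; congr 1; ring
    have e3 : sX ((degD n : ℤ) - 2) * sX (-((degD n : ℤ) - 2) - 1) = sX (-1) := by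
      rw [sX_mul_sX]; congr 1; ring
    rw [e1, e2, mul_left_comm (sX ((degD n : ℤ) - 2)) (HahnSeries.C _), e3, show (-2 : ℤ) = -1 - 1 by rfl]
    push_cast
    simp only [map_neg, map_one, map_sub]
    congr 1
    ring_nf

end

/-! ### Orders and polar coefficients of the connection entries at finite poles and at infinity. -/

section

open Polynomial (aeval)

variable {μ : ℕ} {n : Pole μ → ℕ}

lemma Ord.div {f g : LS} {a b c : ℤ} (hf : Ord f a) (hg : Lead g b) (hc : c = a - b) :
    Ord (f / g) c := by
  rw [div_eq_mul_inv, hc, sub_eq_add_neg]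
  exact hf.mul hg.inv.1

lemma Ord.coeff_mul_inv {f g : LS} {a b : ℤ} (hf : Ord f a) (hg : Lead g b) {k : ℤ}
    (hk : k = a - b) : (f / g).coeff k = f.coeff a * (g.coeff b)⁻¹ := by
  rw [div_eq_mul_inv, hf.coeff_mul_of_eq hg.inv.1 (by omega), hg.1.coeff_inv hg.2]

/-- The local coordinate expansion of `x` at the apparent singularity `q_j`. -/
def xApp (m : Param n) (j : Fin (numApp n)) : LS := HahnSeries.C (qOf m j) + lX

lemma xAt_some (m : Param n) (k : Fin (μ + 2)) :
    xAt m (some k) = HahnSeries.C (pos m k) + lX := rfl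

lemma xAt_none (m : Param n) : xAt m none = lX⁻¹ := rfl

section Lead

variable {m : Param n} (hm : m ∈ phaseSpace n)
include hm

lemma lead_xAt_some_sub (k i : Fin (μ + 2)) :
    Lead (xAt m (some k) - HahnSeries.C (pos m i)) (if i = k then 1 else 0) := by
  rw [xAt_some]
  split_ifs with h
  · rw [h, C_add_X_sub_self]
    exact Lead.sX 1
  · exact lead_C_add_X_sub fun h' => h (hm.1 h').symm

lemma lead_xAt_some_sub_q (k : Fin (μ + 2)) (j : Fin (numApp n)) :
    Lead (xAt m (some k) - HahnSeries.C (qOf m j)) 0 :=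
  lead_C_add_X_sub (hm.2.2.1 j k).symm

lemma lead_xApp_sub (j : Fin (numApp n)) (k : Fin (μ + 2)) :
    Lead (xApp m j - HahnSeries.C (pos m k)) 0 :=
  lead_C_add_X_sub (hm.2.2.1 j k)

lemma lead_xApp_sub_q (j l : Fin (numApp n)) :
    Lead (xApp m j - HahnSeries.C (qOf m l)) (if l = j then 1 else 0) := by
  rw [xApp]
  split_ifs with h
  · rw [h, C_add_X_sub_self]
    exact Lead.sX 1
  · exact lead_C_add_X_sub fun h' => h (hm.2.1 h').symm

lemma lead_Pz_some (k : Fin (μ + 2)) : Lead (Pz m (xAt m (some k))) (n (some k)) := by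
  refine (Lead.prod fun i _ => (lead_xAt_some_sub hm k i).pow (n (some i))).congr ?_
  simp

lemma lead_Pz_xApp (j : Fin (numApp n)) : Lead (Pz m (xApp m j)) 0 := by
  refine (Lead.prod fun i _ => (lead_xApp_sub hm j i).pow (n (some i))).congr ?_
  simp

omit hm in
lemma lead_Pz_none : Lead (Pz m lX⁻¹) (-∑ k, (n (some k) : ℤ)) := by
  refine (Lead.prod fun i _ => (lead_inv_X_sub (pos m i)).pow (n (some i))).congr ?_
  simp

/-- At infinity P has exact order -(n - n_∞), so the prefactor X^{-n} leaves exact order -n_∞.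
Exactness is what later allows division by this entry. -/
lemma lead_entB (i : Pole μ) : Lead (entB m i) (-(n i : ℤ)) := by
  match i with
  | some k => exact (lead_Pz_some hm k).inv
  | none =>
    refine ((Lead.sX _).mul lead_Pz_none.inv).neg.congr ?_
    rw [degD_eq]
    push_cast
    ring

end Lead

/-- The degree conditions on the polynomials in the normal form. -/
structure DegBounds (n : Pole μ → ℕ) (F : NFData μ) : Prop where
  degC : ∀ i, (F.C i).degree < n i
  degD : ∀ k, (F.D (some k)).degree < n (some k)
  degDinf : (F.D none).degree < (n none - 1 : ℕ)
  degCt : F.Ct.degree < numApp n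

lemma IsNormalForm.degBounds {θ₀ : Pole μ → Fin 2 → ℂ} {m : Param n} {F : NFData μ}
    (h : IsNormalForm n θ₀ m F) : DegBounds n F := ⟨h.degC, h.degD, h.degDinf, h.degCt⟩

section Finite

variable {m : Param n} (hm : m ∈ phaseSpace n) (F : NFData μ) (k : Fin (μ + 2))
include hm

lemma ord_sum_div_sub (G : Pole μ → Polynomial ℂ) :
    Ord (∑ i, aeval (xAt m (some k)) (G (some i)) /
        (xAt m (some k) - HahnSeries.C (pos m i)) ^ n (some i)
      - sX (-(n (some k) : ℤ)) * aeval (xAt m (some k)) (G (some k))) 0 := by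
  have hz := ord_C_add_X (pos m k)
  rw [← xAt_some] at hz
  rw [← Finset.add_sum_erase _ _ (Finset.mem_univ k)]
  have e : aeval (xAt m (some k)) (G (some k)) /
      (xAt m (some k) - HahnSeries.C (pos m k)) ^ n (some k)
      = sX (-(n (some k) : ℤ)) * aeval (xAt m (some k)) (G (some k)) := by
    rw [show xAt m (some k) - HahnSeries.C (pos m k) = sX 1 from C_add_X_sub_self _, sX_pow,
      one_mul, sX_neg, div_eq_inv_mul]
  rw [e, add_sub_cancel_left]
  refine Ord.sum fun i hi => ?_
  refine (ord_aeval_of_nonneg hz _).div ((lead_xAt_some_sub hm k i).pow _) ?_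
  rw [if_neg (Finset.ne_of_mem_erase hi)]
  simp

lemma ord_entC_some_sub :
    Ord (entC m F (some k) - sX (-(n (some k) : ℤ)) * aeval (xAt m (some k)) (F.C (some k))) 0 := by
  have hz := ord_C_add_X (pos m k)
  rw [← xAt_some] at hz
  have h1 := ord_sum_div_sub hm k F.C
  have h2 : Ord (∑ j, HahnSeries.C (pOf m j) / (xAt m (some k) - HahnSeries.C (qOf m j))) 0 :=
    Ord.sum fun j _ => (Ord.C _).div (lead_xAt_some_sub_q hm k j) (by simp)
  have h3 := ord_aeval_of_nonneg hz F.Ct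
  have h4 : Ord (xAt m (some k) ^ numApp n * aeval (xAt m (some k)) (F.C none)) 0 := by
    simpa using (hz.pow (numApp n)).mul (ord_aeval_of_nonneg hz (F.C none))
  rw [entC, c0]
  convert ((h1.add h2).add h3).add h4 using 1
  ring

lemma ord_entD_some_sub :
    Ord (entD m F (some k) - sX (-(n (some k) : ℤ)) * aeval (xAt m (some k)) (F.D (some k))) 0 := by
  have hz := ord_C_add_X (pos m k)
  rw [← xAt_some] at hz
  have h1 := ord_sum_div_sub hm k F.D
  have h2 : Ord (∑ j, (-1) / (xAt m (some k) - HahnSeries.C (qOf m j))) 0 :=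
    Ord.sum fun j _ => Ord.one.neg.div (lead_xAt_some_sub_q hm k j) (by simp)
  have h3 := ord_aeval_of_nonneg hz (F.D none)
  rw [entD, d0]
  convert (h1.add h2).add h3 using 1
  ring

lemma ord_entC_some : Ord (entC m F (some k)) (-(n (some k) : ℤ)) := by
  have h1 := ord_entC_some_sub hm F k
  have h2 : Ord (sX (-(n (some k) : ℤ)) * aeval (xAt m (some k)) (F.C (some k)))
      (-(n (some k) : ℤ)) := by
    have hz := ord_C_add_X (pos m k)
    rw [← xAt_some] at hz
    have := (Ord.sX (-(n (some k) : ℤ))).mul (ord_aeval_of_nonneg hz (F.C (some k)))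
    rwa [add_zero] at this
  have := (h1.mono (by omega)).add h2
  rwa [sub_add_cancel] at this

lemma ord_entD_some : Ord (entD m F (some k)) (-(n (some k) : ℤ)) := by
  have h1 := ord_entD_some_sub hm F k
  have h2 : Ord (sX (-(n (some k) : ℤ)) * aeval (xAt m (some k)) (F.D (some k)))
      (-(n (some k) : ℤ)) := by
    have hz := ord_C_add_X (pos m k)
    rw [← xAt_some] at hz
    have := (Ord.sX (-(n (some k) : ℤ))).mul (ord_aeval_of_nonneg hz (F.D (some k)))
    rwa [add_zero] at this
  have := (h1.mono (by omega)).add h2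
  rwa [sub_add_cancel] at this

lemma coeff_entC_some {l : ℕ} (hl : l < n (some k)) :
    (entC m F (some k)).coeff (l - n (some k))
      = (Polynomial.taylor (pos m k) (F.C (some k))).coeff l := by
  have h1 := ord_entC_some_sub hm F k (l - n (some k)) (by omega)
  rw [HahnSeries.coeff_sub, coeff_sX_mul, sub_neg_eq_add, sub_add_cancel, xAt_some,
    coeff_aeval_C_add_X, sub_eq_zero] at h1
  exact h1

lemma coeff_entD_some {l : ℕ} (hl : l < n (some k)) :
    (entD m F (some k)).coeff (l - n (some k))
      = (Polynomial.taylor (pos m k) (F.D (some k))).coeff l := by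
  have h1 := ord_entD_some_sub hm F k (l - n (some k)) (by omega)
  rw [HahnSeries.coeff_sub, coeff_sX_mul, sub_neg_eq_add, sub_add_cancel, xAt_some,
    coeff_aeval_C_add_X, sub_eq_zero] at h1
  exact h1

end Finite

section Infinity

variable (hn : ∀ i, 1 ≤ n i) (m : Param n) {F : NFData μ} (hF : DegBounds n F)
include hn

omit hn in
lemma ord_aeval_div_none {p : Polynomial ℂ} {a : ℂ} {d : ℕ} (hp : p.degree < d) :
    Ord (aeval lX⁻¹ p / (lX⁻¹ - HahnSeries.C a) ^ d) 1 := by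
  refine Ord.div (a := 1 - d) ?_ ((lead_inv_X_sub a).pow d) (by ring)
  rw [lX_inv]
  exact ord_aeval_neg hp

omit hn in
lemma coeff_aeval_div_none {p : Polynomial ℂ} {a : ℂ} {d : ℕ} (hd : 1 ≤ d) (hp : p.degree < d) :
    (aeval lX⁻¹ p / (lX⁻¹ - HahnSeries.C a) ^ d).coeff 1 = p.coeff (d - 1) := by
  have h1 := ord_aeval_neg hp
  have h2 := coeff_aeval_sX (e := -1) (by norm_num) p (d - 1)
  rw [show (-1 : ℤ) * ((d - 1 : ℕ) : ℤ) = 1 - d by omega] at h2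
  rw [← lX_inv] at h1 h2
  rw [h1.coeff_mul_inv ((lead_inv_X_sub a).pow d) (by ring), h2, mul_neg_one,
    coeff_inv_X_sub_pow, inv_one, mul_one]

omit hn in
lemma ord_const_div_none (c a : ℂ) : Ord (HahnSeries.C c / (lX⁻¹ - HahnSeries.C a)) 1 :=
  (Ord.C c).div (lead_inv_X_sub a) (by ring)

omit hn in
lemma coeff_const_div_none (c a : ℂ) :
    (HahnSeries.C c / (lX⁻¹ - HahnSeries.C a)).coeff 1 = c := by
  have h := coeff_inv_X_sub_pow a 1
  rw [pow_one] at h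
  rw [(Ord.C c).coeff_mul_inv (lead_inv_X_sub a) (by ring), coeff_C, if_pos rfl]
  have : ((1 : ℕ) : ℤ) = 1 := rfl
  rw [this] at h
  rw [h, inv_one, mul_one]

include hF

omit hn in
lemma ord_c0_none_sub : Ord (c0 m F lX⁻¹ - sX (-(numApp n : ℤ)) * aeval (sX (-1)) (F.C none))
    (1 - numApp n) := by
  have h1 : Ord (∑ k, aeval lX⁻¹ (F.C (some k)) / (lX⁻¹ - HahnSeries.C (pos m k)) ^ n (some k))
      (1 - numApp n) :=
    Ord.sum fun k _ => (ord_aeval_div_none (hF.degC (some k))).mono (by omega)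
  have h2 : Ord (∑ j, HahnSeries.C (pOf m j) / (lX⁻¹ - HahnSeries.C (qOf m j)))
      (1 - numApp n) := Ord.sum fun j _ => (ord_const_div_none _ _).mono (by omega)
  have h3 := ord_aeval_neg hF.degCt
  rw [← lX_inv] at h3
  rw [c0, show lX⁻¹ ^ numApp n = sX (-(numApp n : ℤ)) by rw [lX_inv, sX_pow]; congr 1; ring]
  rw [← lX_inv]
  convert (h1.add h2).add h3 using 1
  ring

/-- Only x^N C_∞ reaches the polar part: the other terms of c_0 are O(X^{1-N}), and the prefactor
X^{n-4} = X^{N-1} makes them holomorphic. -/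
lemma coeff_entC_none (j : ℕ) : (entC m F none).coeff (-1 - j) = -(F.C none).coeff j := by
  have h1 := ord_c0_none_sub m hF (-numApp n - j) (by omega)
  have h2 := coeff_aeval_sX (e := -1) (by norm_num) (F.C none) j
  rw [HahnSeries.coeff_sub, coeff_sX_mul, sub_eq_zero,
    show (-(numApp n : ℤ) - j - -(numApp n : ℤ)) = -1 * j by ring, h2] at h1
  rw [entC, HahnSeries.coeff_neg, coeff_sX_mul, ← h1]
  congr 2
  have := numApp_cast hn
  omega

lemma ord_entC_none : Ord (entC m F none) (-(n none : ℤ)) := fun k hk => by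
  obtain ⟨j, rfl⟩ : ∃ j : ℕ, k = -1 - j := ⟨(-1 - k).toNat, by omega⟩
  rw [coeff_entC_none hn m hF,
    Polynomial.coeff_eq_zero_of_degree_lt (lt_of_lt_of_le (hF.degC none) (by
      norm_cast; omega)), neg_zero]

omit hn in
lemma ord_d0_none_sub : Ord (d0 m F lX⁻¹ - aeval (sX (-1)) (F.D none)) 1 := by
  have h1 : Ord (∑ k, aeval lX⁻¹ (F.D (some k)) / (lX⁻¹ - HahnSeries.C (pos m k)) ^ n (some k)) 1 :=
    Ord.sum fun k _ => ord_aeval_div_none (hF.degD k)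
  have h2 : Ord (∑ j, (-1) / (lX⁻¹ - HahnSeries.C (qOf m j))) 1 :=
    Ord.sum fun j _ => by simpa using ord_const_div_none (-1) (qOf m j)
  rw [← lX_inv, d0]
  convert h1.add h2 using 1
  ring

lemma coeff_d0_none_sub : (d0 m F lX⁻¹ - aeval (sX (-1)) (F.D none)).coeff 1
    = ∑ k, (F.D (some k)).coeff (n (some k) - 1) - numApp n := by
  rw [← lX_inv, d0, add_sub_cancel_right, HahnSeries.coeff_add, HahnSeries.coeff_sum,
    HahnSeries.coeff_sum, Finset.sum_congr rfl fun k _ =>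
      coeff_aeval_div_none (hn (some k)) (hF.degD k)]
  have h2 : ∀ j, ((-1) / (lX⁻¹ - HahnSeries.C (qOf m j)) : LS).coeff 1 = -1 := fun j => by
    simpa using coeff_const_div_none (-1) (qOf m j)
  simp only [h2]
  simp [sub_eq_add_neg]

omit hn in
lemma coeff_entD_none (j : ℕ) : (entD m F none).coeff (-2 - j) = -(F.D none).coeff j := by
  have h1 := ord_d0_none_sub m hF (-j) (by omega)
  have h2 := coeff_aeval_sX (e := -1) (by norm_num) (F.D none) j
  rw [HahnSeries.coeff_sub, show (-(j : ℤ)) = -1 * j by ring, h2, sub_eq_zero] at h1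
  rw [entD, HahnSeries.coeff_sub, HahnSeries.coeff_neg, coeff_sX_mul, coeff_C_mul, coeff_sX,
    if_neg (by omega), mul_zero, sub_zero, ← h1]
  congr 2
  ring

/-- D_∞ has no influence on this residue. The N apparent singularities and the twist of the bundle
contribute N - (n-2) = -1, which is the source of the -1 in the Fuchs relation. -/
lemma coeff_entD_none_residue : (entD m F none).coeff (-1)
    = -1 - ∑ k, (F.D (some k)).coeff (n (some k) - 1) := by
  have h1 := coeff_d0_none_sub hn m hF
  have h2 : (aeval (sX (-1)) (F.D none)).coeff 1 = 0 := by
    rw [aeval_eq_sum, HahnSeries.coeff_sum]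
    refine Finset.sum_eq_zero fun i _ => ?_
    rw [sX_pow, coeff_C_mul, coeff_sX, if_neg (by omega), mul_zero]
  have h3 : (numApp n : ℂ) = (degD n : ℂ) - 3 := by
    have := numApp_cast hn
    exact_mod_cast this
  rw [HahnSeries.coeff_sub, h2, sub_zero, h3] at h1
  rw [entD, HahnSeries.coeff_sub, HahnSeries.coeff_neg, coeff_sX_mul, coeff_C_mul, coeff_sX,
    if_pos rfl, show (-1 : ℤ) - -2 = 1 by norm_num, h1]
  ring

lemma ord_entD_none : Ord (entD m F none) (-(n none : ℤ)) := fun k hk => by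
  have := hn none
  obtain ⟨j, rfl⟩ : ∃ j : ℕ, k = -2 - j := ⟨(-2 - k).toNat, by omega⟩
  rw [coeff_entD_none m hF,
    Polynomial.coeff_eq_zero_of_degree_lt (lt_of_lt_of_le hF.degDinf (by
      norm_cast; omega)), neg_zero]

end Infinity

lemma ord_entC (hn : ∀ i, 1 ≤ n i) {m : Param n} (hm : m ∈ phaseSpace n) {F : NFData μ}
    (hF : DegBounds n F) (i : Pole μ) : Ord (entC m F i) (-(n i : ℤ)) :=
  match i with
  | some k => ord_entC_some hm F k
  | none => ord_entC_none hn m hF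

lemma ord_entD (hn : ∀ i, 1 ≤ n i) {m : Param n} (hm : m ∈ phaseSpace n) {F : NFData μ}
    (hF : DegBounds n F) (i : Pole μ) : Ord (entD m F i) (-(n i : ℤ)) :=
  match i with
  | some k => ord_entD_some hm F k
  | none => ord_entD_none hn m hF

end

section

open Polynomial (aeval)

variable {μ : ℕ} {n : Pole μ → ℕ}

/-! ### The apparent singularities -/

/-- The entry `(1, 2)` of the connection matrix at `q_j`. -/
def appB (m : Param n) (j : Fin (numApp n)) : LS := (Pz m (xApp m j))⁻¹

/-- The entry `(2, 1)` of the connection matrix at `q_j`. -/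
def appC (m : Param n) (F : NFData μ) (j : Fin (numApp n)) : LS := c0 m F (xApp m j)

/-- The entry `(2, 2)` of the connection matrix at `q_j`. -/
def appD (m : Param n) (F : NFData μ) (j : Fin (numApp n)) : LS := d0 m F (xApp m j)

lemma omegaApp_eq (m : Param n) (F : NFData μ) (j : Fin (numApp n)) :
    omegaApp m F j = !![0, appB m j; appC m F j, appD m F j] := by
  rw [omegaApp, connMat, one_div]
  rfl

lemma gauge_apparent (p : ℂ) (b c d : LS) :
    gauge !![1, 0; HahnSeries.C p, lX] !![0, b; c, d] =
      !![HahnSeries.C p * b, b * lX;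
        (c + HahnSeries.C p * d - HahnSeries.C (p ^ 2) * b) * sX (-1),
        d - HahnSeries.C p * b + sX (-1)] := by
  have hX : lX ≠ 0 := sX_ne_zero 1
  have hXX : lX * sX (-1) = 1 := sX_mul_sX 1 (-1)
  have hu : IsUnit (!![1, 0; HahnSeries.C p, lX] : Mat2 LS).det := by
    rw [Matrix.det_fin_two_of, isUnit_iff_ne_zero]
    simpa using hX
  have hp : (HahnSeries.C (p ^ 2) : LS) = HahnSeries.C p * HahnSeries.C p := by
    rw [← map_mul, sq]
  rw [gauge_eq_iff hu, hp]
  have e1 : lD (1 : LS) = 0 := lD_one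
  have e2 : lD (0 : LS) = 0 := lD_zero
  have e3 : lD (HahnSeries.C p) = 0 := lD_C p
  have e4 := lD_lX
  generalize (HahnSeries.C p : LS) = P at *
  generalize sX (-1) = Y at *
  ext1 i k
  fin_cases i <;> fin_cases k <;>
    simp [Matrix.mul_apply, Fin.sum_univ_two, e1, e2, e3, e4]
  · ring
  · linear_combination (-(c + P * d - P * P * b)) * hXX
  · linear_combination (-1 : LS) * hXX

/-- Since d + 1/X is holomorphic, the diagonal has no pole. The (2,1) entry is (c + pd - p²b)/X,
where the poles of c and pd already cancel, so the only obstruction is a constant term. -/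
lemma noPole_gauge_apparent_iff {p : ℂ} {b c d : LS} (hb : Ord b 0)
    (hc : Ord (c - HahnSeries.C p * sX (-1)) 0) (hd : Ord (d + sX (-1)) 0) :
    NoPole (gauge !![1, 0; HahnSeries.C p, lX] !![0, b; c, d]) ↔
      c.coeff 0 + p * d.coeff 0 - p ^ 2 * b.coeff 0 = 0 := by
  have hpb : Ord (HahnSeries.C p * b) 0 := by simpa using (Ord.C p).mul hb
  have hE : Ord (c + HahnSeries.C p * d - HahnSeries.C (p ^ 2) * b) 0 := by
    have h1 : Ord (HahnSeries.C p * (d + sX (-1))) 0 := by simpa using (Ord.C p).mul hd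
    have h2 : Ord (HahnSeries.C (p ^ 2) * b) 0 := by simpa using (Ord.C (p ^ 2)).mul hb
    convert (hc.add h1).sub h2 using 1
    ring
  have hE0 : (c + HahnSeries.C p * d - HahnSeries.C (p ^ 2) * b).coeff 0
      = c.coeff 0 + p * d.coeff 0 - p ^ 2 * b.coeff 0 := by
    rw [HahnSeries.coeff_sub, HahnSeries.coeff_add, coeff_C_mul, coeff_C_mul]
  rw [gauge_apparent, ← hE0]
  generalize c + HahnSeries.C p * d - HahnSeries.C (p ^ 2) * b = E at *
  have hco : (E * sX (-1)).coeff (-1) = E.coeff 0 := by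
    rw [mul_comm, coeff_sX_mul]; rfl
  constructor
  · intro h
    rw [← hco]
    exact h 1 0 (-1) (by norm_num)
  · intro h
    refine NoPole.of hpb ?_ ?_ ?_
    · simpa using (hb.mul Ord.X).mono (by norm_num)
    · simpa using (ord_succ hE h).mul (Ord.sX (-1))
    · convert hd.sub hpb using 1
      ring

section Apparent

variable {m : Param n} (hm : m ∈ phaseSpace n) (F : NFData μ) (j : Fin (numApp n))
include hm

lemma ord_sum_div_xApp (G : Pole μ → Polynomial ℂ) :
    Ord (∑ i, aeval (xApp m j) (G (some i)) /
        (xApp m j - HahnSeries.C (pos m i)) ^ n (some i)) 0 :=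
  Ord.sum fun i _ => (ord_aeval_of_nonneg (ord_C_add_X _) _).div ((lead_xApp_sub hm j i).pow _)
    (by simp)

lemma ord_sum_const_div_xApp (p : Fin (numApp n) → ℂ) :
    Ord (∑ l, HahnSeries.C (p l) / (xApp m j - HahnSeries.C (qOf m l))
      - HahnSeries.C (p j) * sX (-1)) 0 := by
  rw [← Finset.add_sum_erase _ _ (Finset.mem_univ j)]
  have e : HahnSeries.C (p j) / (xApp m j - HahnSeries.C (qOf m j))
      = HahnSeries.C (p j) * sX (-1) := by
    rw [show xApp m j - HahnSeries.C (qOf m j) = sX 1 from C_add_X_sub_self _, sX_neg,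
      div_eq_mul_inv]
  rw [e, add_sub_cancel_left]
  refine Ord.sum fun l hl => (Ord.C _).div (lead_xApp_sub_q hm j l) ?_
  rw [if_neg (Finset.ne_of_mem_erase hl)]
  simp

lemma ord_appB : Ord (appB m j) 0 := (lead_Pz_xApp hm j).inv.1

lemma ord_appC_sub : Ord (appC m F j - HahnSeries.C (pOf m j) * sX (-1)) 0 := by
  have hz : Ord (xApp m j) 0 := ord_C_add_X _
  have h1 := ord_sum_div_xApp hm j F.C
  have h2 := ord_sum_const_div_xApp hm j (pOf m)
  have h3 := ord_aeval_of_nonneg hz F.Ct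
  have h4 : Ord (xApp m j ^ numApp n * aeval (xApp m j) (F.C none)) 0 := by
    simpa using (hz.pow (numApp n)).mul (ord_aeval_of_nonneg hz (F.C none))
  rw [appC, c0]
  convert ((h1.add h2).add h3).add h4 using 1
  ring

lemma ord_appD_add : Ord (appD m F j + sX (-1)) 0 := by
  have hz : Ord (xApp m j) 0 := ord_C_add_X _
  have h1 := ord_sum_div_xApp hm j F.D
  have h2 := ord_sum_const_div_xApp hm j fun _ => -1
  have h3 := ord_aeval_of_nonneg hz (F.D none)
  rw [map_neg, map_one] at h2
  rw [appD, d0]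
  convert (h1.add h2).add h3 using 1
  ring

lemma apparent_iff :
    NoPole (gauge !![1, 0; HahnSeries.C (pOf m j), lX] (omegaApp m F j)) ↔
      (appC m F j).coeff 0 + pOf m j * (appD m F j).coeff 0
        - pOf m j ^ 2 * (appB m j).coeff 0 = 0 := by
  rw [omegaApp_eq]
  exact noPole_gauge_apparent_iff (ord_appB hm j) (ord_appC_sub hm F j) (ord_appD_add hm F j)

omit hm in
-- C̃ enters the apparent-singularity condition only through its value at q_j, so these conditions
-- form an interpolation problem for C̃.
lemma coeff_appC : (appC m F j).coeff 0
    = (appC m ⟨F.C, F.D, 0⟩ j).coeff 0 + F.Ct.eval (qOf m j) := by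
  have e : appC m F j = appC m ⟨F.C, F.D, 0⟩ j + aeval (xApp m j) F.Ct := by
    rw [appC, appC, c0, c0, map_zero]
    ring
  rw [e, HahnSeries.coeff_add, xApp, coeff_zero_aeval (ord_C_add_X _), coeff_C_add_X]

end Apparent

/-! ### The transformation to the bundle of degree one -/

/-- `G_{n-2}⁻¹ G̃ G_1` near the pole `i`. -/
def holTrans (m : Param n) : Pole μ → Mat2 LS
  | some k => !![1, 0; aeval (xAt m (some k)) (Q2 m), aeval (xAt m (some k)) (Q1 m)]
  | none => !![1, 0; sX ((degD n : ℤ) - 2) * aeval lX⁻¹ (Q2 m),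
      sX ((degD n : ℤ) - 3) * aeval lX⁻¹ (Q1 m)]

lemma aeval_Q1 (m : Param n) (z : LS) :
    aeval z (Q1 m) = ∏ j, (z - HahnSeries.C (qOf m j)) := by
  rw [Q1, map_prod]
  refine Finset.prod_congr rfl fun j _ => ?_
  rw [map_sub, Polynomial.aeval_X, aeval_C']

lemma lead_Q1_none (m : Param n) : Lead (aeval lX⁻¹ (Q1 m)) (-(numApp n : ℤ)) := by
  rw [aeval_Q1]
  refine (Lead.prod fun j _ => lead_inv_X_sub (qOf m j)).congr ?_
  simp

lemma lead_Q1_some {m : Param n} (hm : m ∈ phaseSpace n) (k : Fin (μ + 2)) :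
    Lead (aeval (xAt m (some k)) (Q1 m)) 0 := by
  rw [aeval_Q1]
  refine (Lead.prod fun j _ => lead_xAt_some_sub_q hm k j).congr ?_
  simp

lemma degree_Q2_lt {m : Param n} (hm : m ∈ phaseSpace n) : (Q2 m).degree < numApp n := by
  have := Lagrange.degree_interpolate_lt (pOf m) (s := Finset.univ) hm.2.1.injOn
  rwa [Finset.card_univ, Fintype.card_fin] at this

lemma holInv_lower {u w : LS} (hu : Ord u 0) (hw : Lead w 0) :
    HolInv (!![1, 0; u, w] : Mat2 LS) := by
  refine ⟨NoPole.of Ord.one Ord.zero hu hw.1, ?_⟩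
  rw [Matrix.det_fin_two_of, one_mul, zero_mul, sub_zero]
  exact hw.2

/-- At a finite pole the determinant is Q_1, nonzero there because no q_j is a pole. At infinity the
exponents n-2 and n-3 match deg Q_2 ≤ n-4 and the degree n-3 of the monic Q_1. -/
lemma holInv_holTrans (hn : ∀ i, 1 ≤ n i) {m : Param n} (hm : m ∈ phaseSpace n) (i : Pole μ) :
    HolInv (holTrans m i) := by
  match i with
  | some k =>
    refine holInv_lower (ord_aeval_of_nonneg ?_ _) (lead_Q1_some hm k)
    rw [xAt_some]
    exact ord_C_add_X _
  | none =>
    have := numApp_cast hn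
    refine holInv_lower ?_ (((Lead.sX _).mul (lead_Q1_none m)).congr (by omega))
    have h := ord_aeval_neg (degree_Q2_lt hm)
    rw [← lX_inv] at h
    exact ((Ord.sX _).mul h).mono (by omega)

lemma isUnit_det_triv (m : Param n) (k : ℕ) (i : Pole μ) : IsUnit (triv m k i).det := by
  match i with
  | some _ => rw [triv, Matrix.det_one]; exact isUnit_one
  | none =>
    rw [triv, Matrix.det_diagonal, Fin.prod_univ_two, isUnit_iff_ne_zero]
    refine mul_ne_zero one_ne_zero (pow_ne_zero _ ?_)
    rw [xAt_none]
    exact inv_ne_zero (sX_ne_zero 1)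

lemma triv_mul_holTrans (hn : ∀ i, 1 ≤ n i) (m : Param n) (i : Pole μ) :
    triv m (degD n - 2) i * holTrans m i = Gtilde m (xAt m i) * triv m 1 i := by
  match i with
  | some k =>
    rw [triv, triv, one_mul, mul_one]
    rfl
  | none =>
    have h3 := three_le_degD hn
    have e1 : (lX⁻¹ : LS) ^ (degD n - 2) * sX ((degD n : ℤ) - 2) = 1 := by
      rw [lX_inv, sX_pow, sX_mul_sX, ← sX_zero]
      congr 1
      omega
    have e2 : (lX⁻¹ : LS) ^ (degD n - 2) * sX ((degD n : ℤ) - 3) = lX⁻¹ := by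
      rw [lX_inv, sX_pow, sX_mul_sX]
      congr 1
      omega
    rw [triv, triv, holTrans, Gtilde, xAt_none]
    ext1 i k
    rw [Matrix.mul_diagonal, Matrix.diagonal_mul]
    fin_cases i <;> fin_cases k
    · simp
    · simp
    · simp only [Fin.mk_one, Fin.zero_eta, Matrix.cons_val_one, Matrix.cons_val_zero,
        Matrix.of_apply, ← mul_assoc, e1, one_mul, mul_one]
    · change lX⁻¹ ^ (degD n - 2) * (sX ((degD n : ℤ) - 3) * _) = _ * lX⁻¹ ^ 1
      rw [← mul_assoc, e2, pow_one, mul_comm]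
      rfl

lemma omegaOneAt_eq_gauge (hn : ∀ i, 1 ≤ n i) {m : Param n} (hm : m ∈ phaseSpace n)
    (F : NFData μ) (i : Pole μ) :
    omegaOneAt m F i = gauge (holTrans m i) (omegaAt m F i) := by
  have hG : IsUnit (Gtilde m (xAt m i)).det := by
    have h := congrArg Matrix.det (triv_mul_holTrans hn m i)
    rw [Matrix.det_mul, Matrix.det_mul] at h
    have := (isUnit_det_triv m (degD n - 2) i).mul (holInv_holTrans hn hm i).isUnit_det
    rw [h] at this
    exact isUnit_of_mul_isUnit_left this
  rw [omegaOneAt, omegaAt, gauge_gauge _ hG, gauge_gauge _ (isUnit_det_triv m _ i),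
    triv_mul_holTrans hn]

/-- The transformation between the two bundles is holomorphically invertible at every pole, so the
condition imposed on the bundle of degree one can be tested directly on the companion form. -/
lemma formallyEquiv_omegaOneAt_iff (hn : ∀ i, 1 ≤ n i) {m : Param n} (hm : m ∈ phaseSpace n)
    (F : NFData μ) (i : Pole μ) (Λ : Mat2 LS) :
    FormallyEquiv (omegaOneAt m F i) Λ ↔ FormallyEquiv (omegaAt m F i) Λ := by
  rw [omegaOneAt_eq_gauge hn hm, formallyEquiv_gauge_iff (holInv_holTrans hn hm i)]

/-! ### The polar parts -/

/-- The diagonal entries of the polar part. -/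
def polarSeries (θ₀ : Pole μ → Fin 2 → ℂ) (m : Param n) (i : Pole μ) (a : Fin 2) : LS :=
  ∑ l ∈ Finset.range (n i), HahnSeries.single ((l : ℤ) - (n i : ℤ)) (polarCoeff θ₀ m i a l)

variable (θ₀ : Pole μ → Fin 2 → ℂ)

lemma ord_polarSeries (m : Param n) (i : Pole μ) (a : Fin 2) :
    Ord (polarSeries θ₀ m i a) (-(n i : ℤ)) :=
  Ord.sum fun _ _ => (Ord.single _).mono (by omega)

lemma coeff_polarSeries (m : Param n) (i : Pole μ) (a : Fin 2) {l : ℕ} (hl : l < n i) :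
    (polarSeries θ₀ m i a).coeff (l - n i) = polarCoeff θ₀ m i a l := by
  rw [polarSeries, HahnSeries.coeff_sum, Finset.sum_eq_single l]
  · exact HahnSeries.coeff_single_same _ _
  · intro k _ hk
    exact HahnSeries.coeff_single_of_ne (by omega)
  · intro h
    exact absurd (Finset.mem_range.2 hl) h

/-- The sum of the formal exponents. -/
def polarTrace (m : Param n) (i : Pole μ) : LS := polarSeries θ₀ m i 0 + polarSeries θ₀ m i 1

/-- The entry `(2, 1)` for which the determinant is the product of the formal exponents. -/
def polarLower (m : Param n) (i : Pole μ) : LS :=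
  -(polarSeries θ₀ m i 0 * polarSeries θ₀ m i 1) / entB m i

lemma ord_polarTrace (m : Param n) (i : Pole μ) : Ord (polarTrace θ₀ m i) (-(n i : ℤ)) :=
  (ord_polarSeries θ₀ m i 0).add (ord_polarSeries θ₀ m i 1)

lemma ord_polarLower {m : Param n} (hm : m ∈ phaseSpace n) (i : Pole μ) :
    Ord (polarLower θ₀ m i) (-(n i : ℤ)) :=
  Ord.div ((ord_polarSeries θ₀ m i 0).mul (ord_polarSeries θ₀ m i 1)).neg (lead_entB hm i)
    (by ring)

lemma coeff_polarTrace_residue (hn : ∀ i, 1 ≤ n i) (m : Param n) (i : Pole μ) :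
    (polarTrace θ₀ m i).coeff (-1) = θ₀ i 0 + θ₀ i 1 := by
  have h := hn i
  have e : (-1 : ℤ) = ((n i - 1 : ℕ) : ℤ) - n i := by omega
  rw [polarTrace, HahnSeries.coeff_add, e, coeff_polarSeries _ _ _ _ (by omega),
    coeff_polarSeries _ _ _ _ (by omega), polarCoeff, polarCoeff, dif_neg (lt_irrefl _),
    dif_neg (lt_irrefl _)]

/-- In companion form the trace is the (2,2) entry and the determinant is minus the product of the
off-diagonal entries. The determinant is known modulo O(X^{-n_i}), and dividing by the (1,2) entry,
of exact order -n_i, gives the (2,1) entry modulo holomorphic terms. -/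
lemma polar_of_formallyEquiv (hn : ∀ i, 1 ≤ n i) {m : Param n} (hm : m ∈ phaseSpace n)
    {F : NFData μ} {i : Pole μ} (h : FormallyEquiv (omegaAt m F i) (polarDiag θ₀ m i)) :
    Ord (entD m F i - polarTrace θ₀ m i) 0 ∧ Ord (entC m F i - polarLower θ₀ m i) 0 := by
  obtain ⟨M, hM, hg⟩ := formallyEquiv_iff.1 h
  obtain ⟨h1, h2⟩ := polar_of_gauge (Int.natCast_nonneg (n i)) hM hg (ord_polarSeries θ₀ m i)
  have hb := lead_entB hm i
  rw [omegaAt_eq hn, Matrix.trace_fin_two_of, zero_add] at h1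
  rw [omegaAt_eq hn, Matrix.det_fin_two_of, zero_mul, zero_sub] at h2
  refine ⟨h1, ?_⟩
  have e : entC m F i - polarLower θ₀ m i
      = -((entB m i)⁻¹ * (-(entB m i * entC m F i)
        - polarSeries θ₀ m i 0 * polarSeries θ₀ m i 1)) := by
    rw [polarLower]
    field_simp [hb.ne_zero]
    ring
  rw [e]
  exact ((hb.inv.1.mul h2).mono (by omega)).neg

lemma polarCoeff_ne (hn : ∀ i, 1 ≤ n i)
    (hreg : ∀ i, n i = 1 → ∀ k : ℤ, θ₀ i 0 - θ₀ i 1 ≠ (k : ℂ)) {m : Param n}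
    (hm : m ∈ phaseSpace n) (i : Pole μ) : polarCoeff θ₀ m i 0 0 ≠ polarCoeff θ₀ m i 1 0 := by
  have hi := hn i
  rw [polarCoeff, polarCoeff]
  split_ifs with h
  · exact hm.2.2.2 i h
  · have := hreg i (by omega) 0
    rw [Int.cast_zero] at this
    exact sub_ne_zero.1 this

lemma leadingData_omegaAt (hn : ∀ i, 1 ≤ n i)
    (hreg : ∀ i, n i = 1 → ∀ k : ℤ, θ₀ i 0 - θ₀ i 1 ≠ (k : ℂ)) {m : Param n}
    (hm : m ∈ phaseSpace n) {F : NFData μ} (hF : DegBounds n F) {i : Pole μ}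
    (hd : Ord (entD m F i - polarTrace θ₀ m i) 0) (hc : Ord (entC m F i - polarLower θ₀ m i) 0) :
    LeadingData (n i) (omegaAt m F i) (fun a => polarCoeff θ₀ m i a 0) := by
  have hb := lead_entB hm i
  have hi := hn i
  have hlead : ∀ a, (polarSeries θ₀ m i a).coeff (-(n i : ℤ)) = polarCoeff θ₀ m i a 0 := fun a => by
    rw [← coeff_polarSeries θ₀ m i a hi]
    congr 1
    simp
  rw [omegaAt_eq hn]
  refine ⟨hn i, rfl, ?_, hb.2, ?_, ?_, polarCoeff_ne θ₀ hn hreg hm i, fun h k => ?_⟩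
  · intro a b
    fin_cases a <;> fin_cases b
    · exact Ord.zero
    · exact hb.1
    · exact ord_entC hn hm hF i
    · exact ord_entD hn hm hF i
  · have h := hd (-(n i)) (by omega)
    rw [HahnSeries.coeff_sub, sub_eq_zero, polarTrace, HahnSeries.coeff_add, hlead, hlead] at h
    exact h
  · have h := hc (-(n i)) (by omega)
    rw [HahnSeries.coeff_sub, sub_eq_zero, polarLower,
      (((ord_polarSeries θ₀ m i 0).mul (ord_polarSeries θ₀ m i 1)).neg).coeff_mul_inv hb (by ring),
      HahnSeries.coeff_neg, (ord_polarSeries θ₀ m i 0).coeff_mul (ord_polarSeries θ₀ m i 1),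
      hlead, hlead, eq_mul_inv_iff_mul_eq₀ hb.2] at h
    change -((entB m i).coeff (-(n i : ℤ)) * (entC m F i).coeff (-(n i : ℤ))) = _
    rw [mul_comm, h, neg_neg]
  · have h1 : ∀ a, polarCoeff θ₀ m i a 0 = θ₀ i a := fun a => by
      rw [polarCoeff, dif_neg (by omega)]
    rw [h1, h1]
    exact hreg i h k

/-- Converse of `polar_of_formallyEquiv`: the polar parts also supply the leading eigenvalues needed
for formal diagonalization. -/
lemma formallyEquiv_of_polar (hn : ∀ i, 1 ≤ n i)
    (hreg : ∀ i, n i = 1 → ∀ k : ℤ, θ₀ i 0 - θ₀ i 1 ≠ (k : ℂ)) {m : Param n}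
    (hm : m ∈ phaseSpace n) {F : NFData μ} (hF : DegBounds n F) {i : Pole μ}
    (hd : Ord (entD m F i - polarTrace θ₀ m i) 0) (hc : Ord (entC m F i - polarLower θ₀ m i) 0) :
    Ord (-(entB m i * entC m F i) - polarSeries θ₀ m i 0 * polarSeries θ₀ m i 1) (-(n i : ℤ)) ∧
    FormallyEquiv (omegaAt m F i) (polarDiag θ₀ m i) := by
  have hb := lead_entB hm i
  have h2 : Ord (-(entB m i * entC m F i) - polarSeries θ₀ m i 0 * polarSeries θ₀ m i 1)
      (-(n i : ℤ)) := by
    have e : -(entB m i * entC m F i) - polarSeries θ₀ m i 0 * polarSeries θ₀ m i 1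
        = -(entB m i * (entC m F i - polarLower θ₀ m i)) := by
      rw [polarLower]
      field_simp [hb.ne_zero]
      ring
    rw [e]
    exact ((hb.1.mul hc).mono (by omega)).neg
  have hL := leadingData_omegaAt θ₀ hn hreg hm hF hd hc
  refine ⟨h2, hL.formallyEquiv (ord_polarSeries θ₀ m i) (fun a => ?_) ?_ ?_⟩
  · rw [← coeff_polarSeries θ₀ m i a (hn i)]
    congr 1
    simp
  · rw [omegaAt_eq hn]
    exact hd
  · rw [omegaAt_eq hn]
    exact h2

/-! ### The normal form -/

/-- The polynomial `∑_{l<N} a_l (x - t)^l`. -/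
def shiftedPoly (t : ℂ) (N : ℕ) (a : ℕ → ℂ) : Polynomial ℂ :=
  Polynomial.taylor (-t) (∑ l ∈ Finset.range N, Polynomial.monomial l (a l))

lemma degree_shiftedPoly_lt (t : ℂ) (N : ℕ) (a : ℕ → ℂ) : (shiftedPoly t N a).degree < N := by
  rw [shiftedPoly, Polynomial.degree_taylor]
  rw [← Polynomial.mem_degreeLT]
  refine Submodule.sum_mem _ fun l hl => Polynomial.mem_degreeLT.2 ?_
  exact (Polynomial.degree_monomial_le _ _).trans_lt (by exact_mod_cast Finset.mem_range.1 hl)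

lemma taylor_shiftedPoly (t : ℂ) (N : ℕ) (a : ℕ → ℂ) : Polynomial.taylor t (shiftedPoly t N a)
    = ∑ l ∈ Finset.range N, Polynomial.monomial l (a l) := by
  rw [shiftedPoly, Polynomial.taylor_taylor, add_neg_cancel, Polynomial.taylor_zero]

lemma coeff_taylor_shiftedPoly (t : ℂ) (N : ℕ) (a : ℕ → ℂ) {l : ℕ} (hl : l < N) :
    (Polynomial.taylor t (shiftedPoly t N a)).coeff l = a l := by
  rw [taylor_shiftedPoly, Polynomial.finsetSum_coeff]
  simp [Polynomial.coeff_monomial, hl]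

lemma eq_shiftedPoly {t : ℂ} {N : ℕ} {a : ℕ → ℂ} {p : Polynomial ℂ} (hp : p.degree < N)
    (h : ∀ l < N, (Polynomial.taylor t p).coeff l = a l) : p = shiftedPoly t N a := by
  apply Polynomial.taylor_injective t
  ext l
  rcases lt_or_ge l N with hl | hl
  · rw [h l hl, coeff_taylor_shiftedPoly t N a hl]
  · have hN : (N : WithBot ℕ) ≤ l := by exact_mod_cast hl
    rw [Polynomial.coeff_eq_zero_of_degree_lt, Polynomial.coeff_eq_zero_of_degree_lt]
    · rw [Polynomial.degree_taylor]
      exact (degree_shiftedPoly_lt t N a).trans_le hN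
    · rw [Polynomial.degree_taylor]
      exact hp.trans_le hN

/-- A translation does not change the top coefficient, so the residue at a finite pole is a
coefficient of D_i independent of t_i. This is how the finite residues enter the one at infinity. -/
lemma coeff_shiftedPoly_last (t : ℂ) {N : ℕ} (hN : 1 ≤ N) (a : ℕ → ℂ) :
    (shiftedPoly t N a).coeff (N - 1) = a (N - 1) := by
  rw [shiftedPoly]
  have h : (∑ l ∈ Finset.range N, Polynomial.monomial l (a l)) =
      (∑ l ∈ Finset.range (N - 1), Polynomial.monomial l (a l))
        + Polynomial.C (a (N - 1)) * Polynomial.X ^ (N - 1) := by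
    obtain ⟨M, rfl⟩ : ∃ M, N = M + 1 := ⟨N - 1, by omega⟩
    rw [Finset.sum_range_succ, Polynomial.C_mul_X_pow_eq_monomial, Nat.add_sub_cancel]
  rw [h, map_add, Polynomial.coeff_add, Polynomial.coeff_eq_zero_of_degree_lt, zero_add]
  · rw [Polynomial.taylor_mul, Polynomial.taylor_C, Polynomial.coeff_C_mul, Polynomial.taylor_pow,
      Polynomial.taylor_X, Polynomial.coeff_X_add_C_pow]
    simp
  · exact degree_shiftedPoly_lt t (N - 1) a

/-- The polynomials `C_i` of the normal form. -/
def nfC (m : Param n) : Pole μ → Polynomial ℂ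
  | some k => shiftedPoly (pos m k) (n (some k)) fun l =>
      (polarLower θ₀ m (some k)).coeff (l - n (some k))
  | none => shiftedPoly 0 (n none) fun j => -(polarLower θ₀ m none).coeff (-1 - j)

/-- The polynomials `D_i` of the normal form. -/
def nfD (m : Param n) : Pole μ → Polynomial ℂ
  | some k => shiftedPoly (pos m k) (n (some k)) fun l =>
      (polarTrace θ₀ m (some k)).coeff (l - n (some k))
  | none => shiftedPoly 0 (n none - 1) fun j => -(polarTrace θ₀ m none).coeff (-2 - j)

/-- The value of `C̃` at `q_j`. -/
def nfCtVal (m : Param n) (j : Fin (numApp n)) : ℂ :=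
  pOf m j ^ 2 * (appB m j).coeff 0
    - pOf m j * (appD m ⟨nfC θ₀ m, nfD θ₀ m, 0⟩ j).coeff 0
    - (appC m ⟨nfC θ₀ m, nfD θ₀ m, 0⟩ j).coeff 0

/-- The normal form, explicitly. -/
def nf (m : Param n) : NFData μ where
  C := nfC θ₀ m
  D := nfD θ₀ m
  Ct := Lagrange.interpolate Finset.univ (qOf m) (nfCtVal θ₀ m)

lemma degBounds_nf {m : Param n} (hm : m ∈ phaseSpace n) : DegBounds n (nf θ₀ m) where
  degC i := match i with
    | some _ => degree_shiftedPoly_lt _ _ _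
    | none => degree_shiftedPoly_lt _ _ _
  degD _ := degree_shiftedPoly_lt _ _ _
  degDinf := degree_shiftedPoly_lt _ _ _
  degCt := by
    have := Lagrange.degree_interpolate_lt (nfCtVal θ₀ m) (s := Finset.univ) hm.2.1.injOn
    rwa [Finset.card_univ, Fintype.card_fin] at this

lemma ord_sub_of_coeff {f g : LS} {N : ℕ} (hf : Ord f (-N)) (hg : Ord g (-N))
    (h : ∀ l < N, f.coeff (l - N) = g.coeff (l - N)) : Ord (f - g) 0 := fun k hk => by
  rcases lt_or_ge k (-N) with h1 | h1
  · rw [HahnSeries.coeff_sub, hf k h1, hg k h1, sub_zero]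
  · obtain ⟨l, rfl⟩ : ∃ l : ℕ, k = l - N := ⟨(k + N).toNat, by omega⟩
    rw [HahnSeries.coeff_sub, h l (by omega), sub_self]

lemma ord_entC_nf_sub (hn : ∀ i, 1 ≤ n i) {m : Param n} (hm : m ∈ phaseSpace n) (i : Pole μ) :
    Ord (entC m (nf θ₀ m) i - polarLower θ₀ m i) 0 := by
  have hF := degBounds_nf θ₀ hm
  refine ord_sub_of_coeff (ord_entC hn hm hF i) (ord_polarLower θ₀ hm i) fun l hl => ?_
  match i with
  | some k =>
    rw [coeff_entC_some hm _ k hl]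
    exact coeff_taylor_shiftedPoly _ _ _ hl
  | none =>
    obtain ⟨j, hj⟩ : ∃ j : ℕ, ((l : ℤ) - n none) = -1 - j := ⟨n none - 1 - l, by omega⟩
    have h := coeff_taylor_shiftedPoly 0 (n none)
      (fun j => -(polarLower θ₀ m none).coeff (-1 - j)) (l := j) (by omega)
    rw [Polynomial.taylor_zero] at h
    rw [hj, coeff_entC_none hn m hF]
    change -(shiftedPoly _ _ _).coeff j = _
    rw [h, neg_neg]

lemma ord_entD_nf_sub (hn : ∀ i, 1 ≤ n i) (hFuchs : ∑ i, (θ₀ i 0 + θ₀ i 1) = -1) {m : Param n}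
    (hm : m ∈ phaseSpace n) (i : Pole μ) : Ord (entD m (nf θ₀ m) i - polarTrace θ₀ m i) 0 := by
  have hF := degBounds_nf θ₀ hm
  refine ord_sub_of_coeff (ord_entD hn hm hF i) (ord_polarTrace θ₀ m i) fun l hl => ?_
  match i with
  | some k =>
    rw [coeff_entD_some hm _ k hl]
    exact coeff_taylor_shiftedPoly _ _ _ hl
  | none =>
    -- All polar coefficients agree by construction except the residue at infinity, which no
    -- coefficient of D_∞ controls; there the Fuchs relation is used.
    rcases eq_or_ne (l + 1) (n none) with hl' | hl'
    · rw [show ((l : ℤ) - n none) = -1 by omega, coeff_entD_none_residue hn m hF,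
        coeff_polarTrace_residue θ₀ hn]
      have h : ∀ k, ((nf θ₀ m).D (some k)).coeff (n (some k) - 1)
          = θ₀ (some k) 0 + θ₀ (some k) 1 := fun k => by
        change (shiftedPoly _ _ _).coeff _ = _
        rw [coeff_shiftedPoly_last _ (hn (some k)), ← coeff_polarTrace_residue θ₀ hn m]
        have := hn (some k)
        congr 1
        omega
      simp only [h]
      rw [Fintype.sum_option] at hFuchs
      linear_combination -hFuchs
    · obtain ⟨j, hj⟩ : ∃ j : ℕ, ((l : ℤ) - n none) = -2 - j := ⟨n none - 2 - l, by omega⟩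
      have h := coeff_taylor_shiftedPoly 0 (n none - 1)
        (fun j => -(polarTrace θ₀ m none).coeff (-2 - j)) (l := j) (by omega)
      rw [Polynomial.taylor_zero] at h
      rw [hj, coeff_entD_none m hF]
      change -(shiftedPoly _ _ _).coeff j = _
      rw [h, neg_neg]

lemma apparent_nf {m : Param n} (hm : m ∈ phaseSpace n) (j : Fin (numApp n)) :
    (appC m (nf θ₀ m) j).coeff 0 + pOf m j * (appD m (nf θ₀ m) j).coeff 0
        - pOf m j ^ 2 * (appB m j).coeff 0 = 0 := by
  have h : (nf θ₀ m).Ct.eval (qOf m j) = nfCtVal θ₀ m j :=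
    Lagrange.eval_interpolate_at_node _ hm.2.1.injOn (Finset.mem_univ j)
  rw [coeff_appC, h, nfCtVal]
  change _ + pOf m j * (appD m ⟨nfC θ₀ m, nfD θ₀ m, 0⟩ j).coeff 0 - _ = 0
  change (appC m ⟨nfC θ₀ m, nfD θ₀ m, 0⟩ j).coeff 0 + _ + _ - _ = _
  ring

lemma isNormalForm_nf (hn : ∀ i, 1 ≤ n i) (hFuchs : ∑ i, (θ₀ i 0 + θ₀ i 1) = -1)
    (hreg : ∀ i, n i = 1 → ∀ k : ℤ, θ₀ i 0 - θ₀ i 1 ≠ (k : ℂ)) {m : Param n}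
    (hm : m ∈ phaseSpace n) : IsNormalForm n θ₀ m (nf θ₀ m) := by
  have hF := degBounds_nf θ₀ hm
  refine ⟨hF.degC, hF.degD, hF.degDinf, hF.degCt, fun j => ?_, fun i => ?_⟩
  · rw [apparent_iff hm]
    exact apparent_nf θ₀ hm j
  · rw [formallyEquiv_omegaOneAt_iff hn hm]
    exact (formallyEquiv_of_polar θ₀ hn hreg hm hF (ord_entD_nf_sub θ₀ hn hFuchs hm i)
      (ord_entC_nf_sub θ₀ hn hm i)).2

lemma coeff_eq_of_ord_sub {f g : LS} (h : Ord (f - g) 0) {k : ℤ} (hk : k < 0) :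
    f.coeff k = g.coeff k := by
  have := h k hk
  rwa [HahnSeries.coeff_sub, sub_eq_zero] at this

/-- The prescribed polar parts fix all coefficients of C_i and D_i, after which the apparent
conditions fix C̃ at N distinct points, enough since deg C̃ < N. -/
lemma IsNormalForm.eq_nf (hn : ∀ i, 1 ≤ n i) {m : Param n} (hm : m ∈ phaseSpace n)
    {F : NFData μ} (h : IsNormalForm n θ₀ m F) : F = nf θ₀ m := by
  have hF := h.degBounds
  have hpol := fun i => polar_of_formallyEquiv θ₀ hn hm
    ((formallyEquiv_omegaOneAt_iff hn hm F i _).1 (h.formal i))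
  have hC : F.C = nfC θ₀ m := by
    funext i
    match i with
    | some k =>
      refine eq_shiftedPoly (hF.degC (some k)) fun l hl => ?_
      rw [← coeff_entC_some hm F k hl]
      exact coeff_eq_of_ord_sub (hpol (some k)).2 (by omega)
    | none =>
      refine eq_shiftedPoly (hF.degC none) fun j hj => ?_
      rw [Polynomial.taylor_zero, ← coeff_eq_of_ord_sub (hpol none).2 (by omega),
        coeff_entC_none hn m hF, neg_neg]
  have hD : F.D = nfD θ₀ m := by
    funext i
    match i with
    | some k =>
      refine eq_shiftedPoly (hF.degD k) fun l hl => ?_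
      rw [← coeff_entD_some hm F k hl]
      exact coeff_eq_of_ord_sub (hpol (some k)).1 (by omega)
    | none =>
      refine eq_shiftedPoly hF.degDinf fun j hj => ?_
      rw [Polynomial.taylor_zero, ← coeff_eq_of_ord_sub (hpol none).1 (by omega),
        coeff_entD_none m hF, neg_neg]
  have hCt : F.Ct = Lagrange.interpolate Finset.univ (qOf m) (nfCtVal θ₀ m) := by
    refine Lagrange.eq_interpolate_of_eval_eq _ hm.2.1.injOn ?_ fun j _ => ?_
    · rw [Finset.card_univ, Fintype.card_fin]
      exact hF.degCt
    · have h1 := (apparent_iff hm F j).1 (h.apparent j)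
      rw [coeff_appC, hC, hD] at h1
      have e : (appD m F j).coeff 0 = (appD m ⟨nfC θ₀ m, nfD θ₀ m, 0⟩ j).coeff 0 := by
        rw [appD, appD, d0, d0, hD]
      rw [e] at h1
      rw [nfCtVal]
      linear_combination h1
  obtain ⟨C, D, Ct⟩ := F
  simp only at hC hD hCt
  rw [nf, hC, hD, hCt]

/-- Uniqueness identifies the arbitrary choice behind `normalForm` with the explicit `nf`, for which
holomorphy can be proved. -/
lemma normalForm_eq (hn : ∀ i, 1 ≤ n i) (hFuchs : ∑ i, (θ₀ i 0 + θ₀ i 1) = -1)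
    (hreg : ∀ i, n i = 1 → ∀ k : ℤ, θ₀ i 0 - θ₀ i 1 ≠ (k : ℂ)) {m : Param n}
    (hm : m ∈ phaseSpace n) : normalForm n θ₀ m = nf θ₀ m :=
  (Classical.epsilon_spec (p := IsNormalForm n θ₀ m)
    ⟨_, isNormalForm_nf θ₀ hn hFuchs hreg hm⟩).eq_nf θ₀ hn hm

lemma existsUnique_isNormalForm (hn : ∀ i, 1 ≤ n i) (hFuchs : ∑ i, (θ₀ i 0 + θ₀ i 1) = -1)
    (hreg : ∀ i, n i = 1 → ∀ k : ℤ, θ₀ i 0 - θ₀ i 1 ≠ (k : ℂ)) {m : Param n}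
    (hm : m ∈ phaseSpace n) : ∃! F : NFData μ, IsNormalForm n θ₀ m F :=
  ⟨nf θ₀ m, isNormalForm_nf θ₀ hn hFuchs hreg hm, fun _ h => h.eq_nf θ₀ hn hm⟩

end

section

open Polynomial (aeval)

variable {μ : ℕ} {n : Pole μ → ℕ}

/-! ### Holomorphic dependence of the normal form on the parameters -/

/-- A family of local expansions of the global coordinate. -/
structure Chart (z : Param n → LS) : Prop where
  fam : Fam z
  inv_pos : ∀ k, Fam fun m => (z m - HahnSeries.C (pos m k))⁻¹
  inv_q : ∀ j, Fam fun m => (z m - HahnSeries.C (qOf m j))⁻¹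

lemma ana_pos (k : Fin (μ + 2)) : Ana fun m : Param n => pos m k := fun m _ => analyticAt_pos k m

lemma ana_qOf (j : Fin (numApp n)) : Ana fun m : Param n => qOf m j := fun m _ => analyticAt_qOf j m

lemma ana_pOf (j : Fin (numApp n)) : Ana fun m : Param n => pOf m j := fun m _ => analyticAt_pOf j m

lemma ana_polarCoeff (θ₀ : Pole μ → Fin 2 → ℂ) (i : Pole μ) (a : Fin 2) (l : ℕ) :
    Ana fun m : Param n => polarCoeff θ₀ m i a l := fun m _ => analyticAt_polarCoeff θ₀ i a l m

lemma Fam.inv_of_lead {f : Param n → LS} (hf : Fam f) {a : ℤ}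
    (h : ∀ m ∈ phaseSpace n, Lead (f m) a) : Fam fun m => (f m)⁻¹ :=
  hf.inv (fun m hm => (h m hm).1) fun m hm => (h m hm).2

lemma Chart.of {z : Param n → LS} (hz : Fam z) {a : Fin (μ + 2) → ℤ} {b : Fin (numApp n) → ℤ}
    (ha : ∀ k, ∀ m ∈ phaseSpace n, Lead (z m - HahnSeries.C (pos m k)) (a k))
    (hb : ∀ j, ∀ m ∈ phaseSpace n, Lead (z m - HahnSeries.C (qOf m j)) (b j)) : Chart z where
  fam := hz
  inv_pos k := (hz.sub (Fam.C (ana_pos k))).inv_of_lead (ha k)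
  inv_q j := (hz.sub (Fam.C (ana_qOf j))).inv_of_lead (hb j)

lemma chart_xAt (i : Pole μ) : Chart fun m : Param n => xAt m i := by
  match i with
  | some k =>
    exact Chart.of ((Fam.C (ana_pos k)).add (Fam.const lX))
      (fun i _ hm => lead_xAt_some_sub hm k i) fun j _ hm => lead_xAt_some_sub_q hm k j
  | none =>
    exact Chart.of (Fam.const lX⁻¹) (fun _ _ _ => lead_inv_X_sub _) fun _ _ _ => lead_inv_X_sub _

lemma chart_xApp (j : Fin (numApp n)) : Chart fun m : Param n => xApp m j :=
  Chart.of ((Fam.C (ana_qOf j)).add (Fam.const lX))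
    (fun i _ hm => lead_xApp_sub hm j i) fun l _ hm => lead_xApp_sub_q hm j l

lemma aeval_shiftedPoly (z : LS) (t : ℂ) (N : ℕ) (a : ℕ → ℂ) : aeval z (shiftedPoly t N a)
    = ∑ l ∈ Finset.range N, HahnSeries.C (a l) * (z - HahnSeries.C t) ^ l := by
  rw [shiftedPoly, Polynomial.taylor_apply, Polynomial.aeval_comp, map_sum]
  refine Finset.sum_congr rfl fun l _ => ?_
  rw [Polynomial.aeval_monomial, algebraMap_eq_C, map_add, Polynomial.aeval_X, aeval_C', map_neg,
    sub_eq_add_neg]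

lemma Fam.aeval_shiftedPoly {z : Param n → LS} (hz : Fam z) {t : Param n → ℂ} (ht : Ana t) (N : ℕ)
    {a : Param n → ℕ → ℂ} (ha : ∀ l, Ana fun m => a m l) :
    Fam fun m => aeval (z m) (shiftedPoly (t m) N (a m)) := by
  simp only [IsoMon.aeval_shiftedPoly]
  exact Fam.sum fun l _ => (Fam.C (ha l)).mul ((hz.sub (Fam.C ht)).pow l)

lemma Ana.sub {f g : Param n → ℂ} (hf : Ana f) (hg : Ana g) : Ana fun m => f m - g m :=
  AnalyticOnNhd.sub hf hg

lemma Ana.inv {f : Param n → ℂ} (hf : Ana f) (h : ∀ m ∈ phaseSpace n, f m ≠ 0) :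
    Ana fun m => (f m)⁻¹ := AnalyticOnNhd.inv hf h

lemma Fam.aeval_interpolate {z : Param n → LS} (hz : Fam z) {r : Param n → Fin (numApp n) → ℂ}
    (hr : ∀ j, Ana fun m => r m j) :
    Fam fun m => aeval (z m) (Lagrange.interpolate Finset.univ (qOf m) (r m)) := by
  simp only [Lagrange.interpolate_apply, Lagrange.basis, Lagrange.basisDivisor, map_sum, map_mul,
    map_prod, aeval_C', map_sub, Polynomial.aeval_X]
  refine Fam.sum fun j _ => (Fam.C (hr j)).mul (Fam.prod fun l hl => Fam.mul ?_
    (hz.sub (Fam.C (ana_qOf l))))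
  have h := Ana.inv ((ana_qOf j).sub (ana_qOf l)) fun m hm h0 => Finset.ne_of_mem_erase hl
    (hm.2.1 (sub_eq_zero.1 h0)).symm
  exact Fam.C h

section

variable (θ₀ : Pole μ → Fin 2 → ℂ)

lemma Chart.fam_inv_Pz {z : Param n → LS} (hz : Chart z) : Fam fun m => (Pz m (z m))⁻¹ := by
  simp only [Pz, ← Finset.prod_inv_distrib, ← inv_pow]
  exact Fam.prod fun k _ => (hz.inv_pos k).pow _

lemma fam_entB (i : Pole μ) : Fam fun m : Param n => entB m i := by
  have h := (chart_xAt (n := n) i).fam_inv_Pz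
  match i with
  | some k => exact h
  | none => exact ((Fam.const _).mul h).neg

lemma fam_appB (j : Fin (numApp n)) : Fam fun m : Param n => appB m j := (chart_xApp j).fam_inv_Pz

lemma fam_polarSeries (i : Pole μ) (a : Fin 2) : Fam fun m : Param n => polarSeries θ₀ m i a :=
  Fam.sum fun l _ => Fam.single (ana_polarCoeff θ₀ i a l) _

lemma fam_polarTrace (i : Pole μ) : Fam fun m : Param n => polarTrace θ₀ m i :=
  (fam_polarSeries θ₀ i 0).add (fam_polarSeries θ₀ i 1)

lemma fam_polarLower (i : Pole μ) : Fam fun m : Param n => polarLower θ₀ m i := by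
  simp only [polarLower, div_eq_mul_inv]
  exact ((fam_polarSeries θ₀ i 0).mul (fam_polarSeries θ₀ i 1)).neg.mul
    ((fam_entB i).inv_of_lead fun m hm => lead_entB hm i)

lemma Fam.aeval_nfC {z : Param n → LS} (hz : Fam z) (i : Pole μ) :
    Fam fun m => aeval (z m) (nfC θ₀ m i) := by
  match i with
  | some k => exact hz.aeval_shiftedPoly (ana_pos k) _ fun l => (fam_polarLower θ₀ (some k)).ana _
  | none =>
    exact hz.aeval_shiftedPoly (t := fun _ => 0) (fun _ _ => analyticAt_const) _
      fun l => (fam_polarLower θ₀ none).neg.ana _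

lemma Fam.aeval_nfD {z : Param n → LS} (hz : Fam z) (i : Pole μ) :
    Fam fun m => aeval (z m) (nfD θ₀ m i) := by
  match i with
  | some k => exact hz.aeval_shiftedPoly (ana_pos k) _ fun l => (fam_polarTrace θ₀ (some k)).ana _
  | none =>
    exact hz.aeval_shiftedPoly (t := fun _ => 0) (fun _ _ => analyticAt_const) _
      fun l => (fam_polarTrace θ₀ none).neg.ana _

lemma Chart.fam_c0 {z : Param n → LS} (hz : Chart z) {G : Param n → Polynomial ℂ}
    (hG : Fam fun m => aeval (z m) (G m)) :
    Fam fun m => c0 m ⟨nfC θ₀ m, nfD θ₀ m, G m⟩ (z m) := by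
  simp only [c0, div_eq_mul_inv, ← inv_pow]
  exact (((Fam.sum fun k _ => (hz.fam.aeval_nfC θ₀ (some k)).mul ((hz.inv_pos k).pow _)).add
    (Fam.sum fun j _ => (Fam.C (ana_pOf j)).mul (hz.inv_q j))).add hG).add
    ((hz.fam.pow _).mul (hz.fam.aeval_nfC θ₀ none))

lemma Chart.fam_d0 {z : Param n → LS} (hz : Chart z) (G : Param n → Polynomial ℂ) :
    Fam fun m => d0 m ⟨nfC θ₀ m, nfD θ₀ m, G m⟩ (z m) := by
  simp only [d0, div_eq_mul_inv, ← inv_pow]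
  exact ((Fam.sum fun k _ => (hz.fam.aeval_nfD θ₀ (some k)).mul ((hz.inv_pos k).pow _)).add
    (Fam.sum fun j _ => (Fam.const _).mul (hz.inv_q j))).add (hz.fam.aeval_nfD θ₀ none)

lemma Ana.mul {f g : Param n → ℂ} (hf : Ana f) (hg : Ana g) : Ana fun m => f m * g m :=
  AnalyticOnNhd.mul hf hg

lemma ana_nfCtVal (j : Fin (numApp n)) : Ana fun m : Param n => nfCtVal θ₀ m j := by
  have hz := chart_xApp j
  have h0 : Fam fun m : Param n => aeval (xApp m j) (0 : Polynomial ℂ) := by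
    simp only [map_zero]
    exact Fam.const 0
  exact (((AnalyticOnNhd.pow (ana_pOf j) 2).mul ((fam_appB j).ana 0)).sub
    ((ana_pOf j).mul ((hz.fam_d0 θ₀ fun _ => 0).ana 0))).sub ((hz.fam_c0 θ₀ h0).ana 0)

lemma Chart.fam_c0_nf {z : Param n → LS} (hz : Chart z) : Fam fun m => c0 m (nf θ₀ m) (z m) :=
  hz.fam_c0 θ₀ (hz.fam.aeval_interpolate (ana_nfCtVal θ₀))

lemma Chart.fam_d0_nf {z : Param n → LS} (hz : Chart z) : Fam fun m => d0 m (nf θ₀ m) (z m) :=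
  hz.fam_d0 θ₀ _

lemma fam_entC (i : Pole μ) : Fam fun m : Param n => entC m (nf θ₀ m) i := by
  have h := (chart_xAt (n := n) i).fam_c0_nf θ₀
  match i with
  | some k => exact h
  | none => exact ((Fam.const _).mul h).neg

lemma fam_entD (i : Pole μ) : Fam fun m : Param n => entD m (nf θ₀ m) i := by
  have h := (chart_xAt (n := n) i).fam_d0_nf θ₀
  match i with
  | some k => exact h
  | none => exact ((Fam.const _).mul h).neg.sub (Fam.const _)

lemma fam_appC (j : Fin (numApp n)) : Fam fun m : Param n => appC m (nf θ₀ m) j :=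
  (chart_xApp j).fam_c0_nf θ₀

lemma fam_appD (j : Fin (numApp n)) : Fam fun m : Param n => appD m (nf θ₀ m) j :=
  (chart_xApp j).fam_d0_nf θ₀

lemma famM_omegaAt (hn : ∀ i, 1 ≤ n i) (i : Pole μ) :
    FamM fun m : Param n => omegaAt m (nf θ₀ m) i := by
  simp only [omegaAt_eq hn]
  exact FamM.of (Fam.const 0) (fam_entB i) (fam_entC θ₀ i) (fam_entD θ₀ i)

lemma famM_omegaApp (j : Fin (numApp n)) : FamM fun m : Param n => omegaApp m (nf θ₀ m) j := by
  simp only [omegaApp_eq]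
  exact FamM.of (Fam.const 0) (fam_appB j) (fam_appC θ₀ j) (fam_appD θ₀ j)

end

/-! ### Solutions at the apparent singularities -/

/-- The frame `!![1, 0; p, X]`. -/
def appFrame (p : ℂ) : Mat2 LS := !![1, 0; HahnSeries.C p, lX]

lemma isUnit_det_appFrame (p : ℂ) : IsUnit (appFrame p).det := by
  rw [appFrame, Matrix.det_fin_two_of, isUnit_iff_ne_zero, one_mul, zero_mul, sub_zero]
  exact sX_ne_zero 1

lemma appFrame_eq (p : ℂ) : appFrame p = constMat !![1, 0; p, 1] * Matrix.diagonal ![1, lX] := by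
  ext1 i j
  rw [Matrix.mul_diagonal, constMat, Matrix.map_apply]
  fin_cases i <;> fin_cases j <;> simp [appFrame]

lemma lX_mul_ofPS_mk (f : ℕ → ℂ) : lX * ofPS (PowerSeries.mk f)
    = ofPS (PowerSeries.mk fun s => if s = 0 then 0 else f (s - 1)) := by
  refine ext_of_nat ?_ (Ord.ofPS _) fun k => ?_
  · exact (Ord.X.mul (Ord.ofPS _)).mono (by norm_num)
  · rw [show lX = sX 1 from rfl, coeff_sX_mul, coeff_ofPS_mk]
    rcases k with _ | k
    · rw [if_pos rfl]
      exact Ord.ofPS _ _ (by simp)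
    · rw [show (((k + 1 : ℕ) : ℤ) - 1) = (k : ℤ) by push_cast; ring, coeff_ofPS_mk]
      simp

/-- The conjugate of `∑ Y_s X^s` by `diag(1, X)`. -/
def conjShift (Y : ℕ → Mat2 ℂ) (s : ℕ) : Mat2 ℂ :=
  !![Y s 0 0, Y (s + 1) 0 1; if s = 0 then 0 else Y (s - 1) 1 0, Y s 1 1]

/-- Conjugation by diag(1, X) divides the (1,2) entry by X, which is possible only when its constant
term vanishes. -/
lemma seriesMat_conjShift {Y : ℕ → Mat2 ℂ} (h : Y 0 0 1 = 0) :
    seriesMat (conjShift Y) * Matrix.diagonal ![1, lX]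
      = Matrix.diagonal ![1, lX] * seriesMat Y := by
  ext1 i j
  rw [Matrix.mul_diagonal, Matrix.diagonal_mul]
  fin_cases i <;> fin_cases j
  · simp [seriesMat, conjShift]
  · have h' := lX_mul_ofPS_mk fun s => Y (s + 1) 0 1
    have e : (fun s => if s = 0 then 0 else Y (s - 1 + 1) 0 1) = fun s => Y s 0 1 := by
      funext s
      rcases s with _ | s
      · rw [if_pos rfl, h]
      · simp
    rw [e] at h'
    simp only [seriesMat, conjShift, Matrix.of_apply, Matrix.cons_val_zero, Matrix.cons_val_one,
      Fin.mk_one, Fin.zero_eta, one_mul, mul_comm _ lX]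
    exact h'
  · have h' := lX_mul_ofPS_mk fun s => Y s 1 0
    simp only [seriesMat, conjShift, Matrix.of_apply, Matrix.cons_val_zero, Matrix.cons_val_one,
      Fin.mk_one, Fin.zero_eta, mul_one]
    exact h'.symm
  · simp [seriesMat, conjShift, mul_comm]

lemma seriesMat_coeffMat {A : Mat2 LS} (hA : NoPole A) :
    seriesMat (fun k => coeffMat k A) = A := by
  ext1 i j
  exact ofPS_mk_of_ord (hA i j)

/-- The coefficients of the solution at an apparent singularity. -/
def appXi (p : ℂ) (A : Mat2 LS) : ℕ → Mat2 ℂ :=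
  conjShift (odeCoeff fun k => coeffMat k (gauge (appFrame p) A))

/-- The frame `appFrame p` removes the pole, so the transformed system has a holomorphic solution Y
with Y(0) = 1. Moving the factor diag(1, X) of the frame past Y brings the solution into the
required shape. -/
lemma appXi_spec {p : ℂ} {A : Mat2 LS} (hA : NoPole (gauge (appFrame p) A)) :
    (constMat !![1, 0; p, 1] * seriesMat (appXi p A) * Matrix.diagonal ![1, lX]).map lD
      + A * (constMat !![1, 0; p, 1] * seriesMat (appXi p A) * Matrix.diagonal ![1, lX]) = 0 := by
  have h1 := lD_odeCoeff_mat fun k => coeffMat k (gauge (appFrame p) A)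
  rw [seriesMat_coeffMat hA] at h1
  have h0 : odeCoeff (fun k => coeffMat k (gauge (appFrame p) A)) 0 0 1 = 0 := by
    rw [odeCoeff_zero]; rfl
  rw [appXi, Matrix.mul_assoc, seriesMat_conjShift h0, ← Matrix.mul_assoc, ← appFrame_eq,
    map_lD_mul, h1, ← Matrix.mul_assoc]
  have h2 := (gauge_eq_iff (isUnit_det_appFrame p)).1 (rfl : gauge (appFrame p) A = _)
  rw [eq_sub_of_add_eq h2]
  simp only [Matrix.sub_mul, Matrix.mul_neg, Matrix.mul_assoc]
  abel

/-- The shift moves the first-order coefficient of Y into the constant term at position (1,2); by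
the equation for Y it is minus the value at 0 of that entry of the transformed connection. -/
lemma appXi_zero {p : ℂ} {A : Mat2 LS} (h : (gauge (appFrame p) A 0 1).coeff 0 = 0) :
    appXi p A 0 = 1 := by
  have h1 : odeCoeff (fun k => coeffMat k (gauge (appFrame p) A)) 1 0 1 = 0 := by
    have h2 := odeCoeff_succ (fun k => coeffMat k (gauge (appFrame p) A)) 0
    change _ = -∑ i : Fin 1, _ at h2
    rw [Fin.sum_univ_one, Fin.val_zero, odeCoeff_zero, mul_one, Nat.cast_zero, zero_add,
      one_smul] at h2
    rw [h2, Matrix.neg_apply]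
    change -(gauge (appFrame p) A 0 1).coeff 0 = 0
    rw [h, neg_zero]
  rw [appXi, conjShift, odeCoeff_zero, zero_add, h1]
  ext i j
  fin_cases i <;> fin_cases j <;> simp

lemma ana_appXi {p : Param n → ℂ} (hp : Ana p) {A : Param n → Mat2 LS}
    (hA : FamM A) (s : ℕ) (a b : Fin 2) : Ana fun m => appXi (p m) (A m) s a b := by
  have hg : FamM fun m => appFrame (p m) :=
    FamM.of (Fam.const 1) (Fam.const 0) (Fam.C hp) (Fam.const lX)
  have hgi : FamM fun m => (appFrame (p m))⁻¹ := by
    refine hg.inv (a := 1) (fun m _ => ?_) fun m _ => ?_ <;>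
    rw [appFrame, Matrix.det_fin_two_of, one_mul, zero_mul, sub_zero]
    · exact Ord.X
    · rw [coeff_lX]; simp
  have hG : FamM fun m => gauge (appFrame (p m)) (A m) :=
    (hgi.mul hg.map_lD).add ((hgi.mul hA).mul hg)
  have hY := fun k => ana_odeCoeff (a := fun k m => coeffMat k (gauge (appFrame (p m)) (A m)))
    (fun k i j => (hG i j).ana k) k
  fin_cases a <;> fin_cases b
  · exact hY s 0 0
  · exact hY (s + 1) 0 1
  · rcases s with _ | s
    · exact fun _ _ => analyticAt_const
    · exact hY s 1 0
  · exact hY s 1 1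

/-! ### Existence of local solutions -/

lemma eq_sX_mul_ofPS {f : LS} {N : ℕ} (hf : Ord f (-N)) :
    sX (-(N : ℤ)) * ofPS (PowerSeries.mk fun k : ℕ => f.coeff (k - N)) = f := by
  have h : Ord (sX N * f) 0 := ((Ord.sX N).mul hf).mono (by omega)
  have h1 := ofPS_mk_of_ord h
  simp only [coeff_sX_mul] at h1
  rw [h1, ← mul_assoc, sX_mul_sX, neg_add_cancel, sX_zero, one_mul]

section

variable (θ₀ : Pole μ → Fin 2 → ℂ) (hn : ∀ i, 1 ≤ n i) (hFuchs : ∑ i, (θ₀ i 0 + θ₀ i 1) = -1)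
    (hreg : ∀ i, n i = 1 → ∀ k : ℤ, θ₀ i 0 - θ₀ i 1 ≠ (k : ℂ))
include hn hFuchs hreg

lemma leadingData_nf {m : Param n} (hm : m ∈ phaseSpace n) (i : Pole μ) :
    LeadingData (n i) (omegaAt m (nf θ₀ m) i) (fun a => polarCoeff θ₀ m i a 0) :=
  leadingData_omegaAt θ₀ hn hreg hm (degBounds_nf θ₀ hm) (ord_entD_nf_sub θ₀ hn hFuchs hm i)
    (ord_entC_nf_sub θ₀ hn hm i)

lemma ord_diagExp_nf_sub {m : Param n} (hm : m ∈ phaseSpace n) (i : Pole μ) (a : Fin 2) :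
    Ord (diagExp (n i) (omegaAt m (nf θ₀ m) i) (fun a => polarCoeff θ₀ m i a 0) a
      - polarSeries θ₀ m i a) 0 := by
  have hd := ord_entD_nf_sub θ₀ hn hFuchs hm i
  have h2 := (formallyEquiv_of_polar θ₀ hn hreg hm (degBounds_nf θ₀ hm) hd
    (ord_entC_nf_sub θ₀ hn hm i)).1
  refine (leadingData_nf θ₀ hn hFuchs hreg hm i).ord_diagExp_sub (ord_polarSeries θ₀ m i)
    (fun a => ?_) ?_ ?_ a
  · rw [← coeff_polarSeries θ₀ m i a (hn i)]
    congr 1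
    simp
  · rw [omegaAt_eq hn]
    exact hd
  · rw [omegaAt_eq hn]
    exact h2

lemma noPole_gauge_appFrame {m : Param n} (hm : m ∈ phaseSpace n) (j : Fin (numApp n)) :
    NoPole (gauge (appFrame (pOf m j)) (omegaApp m (nf θ₀ m) j)) :=
  (isNormalForm_nf θ₀ hn hFuchs hreg hm).apparent j

theorem nonempty_localSolutions : Nonempty (LocalSolutions n θ₀) := by
  have hL := fun i m hm => leadingData_nf θ₀ hn hFuchs hreg (m := m) hm i
  have hA := fun i => famM_omegaAt (n := n) θ₀ hn i
  have hτ := fun i a => ana_polarCoeff (n := n) θ₀ i a 0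
  have hnf := fun m hm => normalForm_eq θ₀ hn hFuchs hreg (m := m) hm
  exact ⟨{
    Φ := fun i m => eigMat (n i) (omegaAt m (nf θ₀ m) i) (fun a => polarCoeff θ₀ m i a 0)
    Ξ := fun i m => diagXi (n i) (omegaAt m (nf θ₀ m) i) (fun a => polarCoeff θ₀ m i a 0)
    θ := fun i a k m => (diagExp (n i) (omegaAt m (nf θ₀ m) i)
      (fun a => polarCoeff θ₀ m i a 0) a).coeff (k - n i)
    Ξq := fun j m => appXi (pOf m j) (omegaApp m (nf θ₀ m) j)
    analytic_Φ := fun i a b => ana_eigMat (hA i) (hτ i) (hL i) a b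
    analytic_Ξ := fun i s a b => ana_diagXi (hA i) (hτ i) (hL i) s a b
    analytic_θ := fun i a k => (fam_diagExp (hA i) (hτ i) (hL i) a).ana _
    analytic_Ξq := fun j s a b => ana_appXi (ana_pOf j) (famM_omegaApp θ₀ j) s a b
    isUnit_Φ := fun i m hm => (hL i m hm).isUnit_eigMat
    Ξ_zero := fun i m hm => diagXi_zero _ _ _
    Ξ_diag := fun i m hm s hs a => diagXi_diag _ _ _ hs a
    θ_polar := fun i a k hk m hm => by
      rw [coeff_eq_of_ord_sub (ord_diagExp_nf_sub θ₀ hn hFuchs hreg hm i a) (by omega),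
        coeff_polarSeries θ₀ m i a hk]
    solution := fun i m hm => by
      rw [hnf m hm, (hL i m hm).gauge_diag]
      refine congrArg Matrix.diagonal (funext fun a => ?_)
      exact (eq_sX_mul_ofPS ((hL i m hm).ord_diagExp a)).symm
    Ξq_zero := fun j m hm => by
      refine appXi_zero ?_
      have h := (ord_appB hm j).mul Ord.X 0 (by norm_num)
      rw [omegaApp_eq, appFrame, gauge_apparent]
      exact h
    solutionq := fun j m hm => by
      rw [hnf m hm]
      exact appXi_spec (noPole_gauge_appFrame θ₀ hn hFuchs hreg hm j) }⟩

end

end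

section

variable {μ : ℕ} {n : Pole μ → ℕ}

/-! ### Variations of solutions -/

/-- This is the variation of ψ' = -Aψ for ψ = F exp(-Λ). The exponential is never formed: it enters
only through `lam`, the variation of Λ, which commutes with the diagonal L and has derivative δL. -/
lemma variation_connection {F A L dF dA dL lam a : Mat2 LS} (hF : IsUnit F.det)
    (h : F.map lD + A * F = F * L) (hv : dF.map lD + (dA * F + A * dF) = dF * L + F * dL)
    (hlam : lam.map lD = dL) (hcomm : L * lam = lam * L)
    (ha : a = dF * F⁻¹ - F * lam * F⁻¹) : dA = -a.map lD - (A * a - a * A) := by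
  have h1 : a * F = dF - F * lam := by
    rw [ha, Matrix.sub_mul, Matrix.nonsing_inv_mul_cancel_right _ _ hF,
      Matrix.nonsing_inv_mul_cancel_right _ _ hF]
  have h2 : (a * F).map lD = dF.map lD - (F.map lD * lam + F * dL) := by
    rw [h1, ← hlam, ← map_lD_mul]
    ext1 i j
    exact lD_sub _ _
  rw [map_lD_mul] at h2
  have h3 : (a.map lD + dA + A * a - a * A) * F = 0 := by
    have e : (a.map lD + dA + A * a - a * A) * F
        = (a.map lD * F + a * F.map lD) + dA * F + A * (a * F) - a * (F.map lD + A * F) := by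
      simp only [Matrix.sub_mul, Matrix.add_mul, Matrix.mul_add, Matrix.mul_assoc]
      abel
    rw [e, h2, h, ← Matrix.mul_assoc a F L, h1, eq_sub_of_add_eq h, eq_sub_of_add_eq hv]
    simp only [Matrix.sub_mul, Matrix.mul_sub, Matrix.mul_assoc, hcomm]
    abel
  have h4 : a.map lD + dA + A * a - a * A = 0 := by
    rw [← Matrix.mul_nonsing_inv_cancel_right F (a.map lD + dA + A * a - a * A) hF, h3,
      Matrix.zero_mul]
  rw [← sub_eq_zero, ← h4]
  abel

/-- By cyclicity of the trace, -Tr(a D') equals Tr(D a') plus the derivative of Tr(a a'), and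
derivatives have no residue. -/
lemma res_trace_sub {A D D' a a' : Mat2 LS} (h : D = -a.map lD - (A * a - a * A))
    (h' : D' = -a'.map lD - (A * a' - a' * A)) :
    (1 / 2) * res (Matrix.trace (D * a' - a * D')) = res (Matrix.trace (D * a')) := by
  have e : Matrix.trace (D * a' - a * D')
      = Matrix.trace (D * a') + Matrix.trace (D * a') + lD (Matrix.trace (a * a')) := by
    rw [h, h']
    simp only [Matrix.trace_fin_two, Matrix.mul_apply, Fin.sum_univ_two, Matrix.sub_apply,
      Matrix.neg_apply, Matrix.map_apply, lD_add, lD_mul]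
    ring
  have e2 := res_lD (Matrix.trace (a * a'))
  rw [res] at e2 ⊢
  rw [e, HahnSeries.coeff_add, HahnSeries.coeff_add, e2, res]
  ring

section

variable {m : Param n} (hm : m ∈ phaseSpace n) (v : Param n)
include hm

lemma variationMat_gauge (s : Param n → ℂ) {F A L : Param n → Mat2 LS} (hF : FamM F)
    (hA : FamM A) (hL : FamM L)
    (h : ∀ m ∈ phaseSpace n, (F m).map lD + A m * F m = F m * L m) :
    (variationMat s F m v).map lD + (variationMat s A m v * F m + A m * variationMat s F m v)
      = variationMat s F m v * L m + F m * variationMat s L m v := by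
  rw [← variationMat_mul hm v s hF hL, ← variationMat_congr hm v s h,
    variationMat_add hm v s hF.map_lD (hA.mul hF), variationMat_map_lD hm v s hF,
    variationMat_mul hm v s hA hF]

lemma variationMat_diagonal (s : Param n → ℂ) (d : Param n → Fin 2 → LS) :
    variationMat s (fun m => Matrix.diagonal (d m)) m v
      = Matrix.diagonal fun a => variation s (fun m => d m a) m v := by
  ext1 i j
  rw [variationMat, Matrix.of_apply]
  rcases eq_or_ne i j with rfl | hij
  · simp only [Matrix.diagonal_apply_eq]
  · simp only [Matrix.diagonal_apply_ne _ hij]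
    rw [variation_eq, cvar_const hm, lD_zero, mul_zero, sub_zero]

end

lemma ana_center (i : Pole μ) : Ana fun m : Param n => center i m := by
  match i with
  | some k => exact ana_pos k
  | none => exact fun _ _ => analyticAt_const

namespace LocalSolutions

variable {θ₀ : Pole μ → Fin 2 → ℂ} (S : LocalSolutions n θ₀)

/-- The diagonal entries of the diagonalized connection. -/
def expo (i : Pole μ) (m : Param n) (a : Fin 2) : LS :=
  sX (-(n i : ℤ)) * ofPS (PowerSeries.mk fun k => S.θ i a k m)

lemma coeff_expo (i : Pole μ) (m : Param n) (a : Fin 2) (k : ℕ) :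
    (S.expo i m a).coeff (k - n i) = S.θ i a k m := by
  rw [expo, coeff_sX_mul, sub_neg_eq_add, sub_add_cancel, coeff_ofPS_mk]

lemma ord_expo (i : Pole μ) (m : Param n) (a : Fin 2) : Ord (S.expo i m a) (-(n i : ℤ)) :=
  ((Ord.sX _).mul (Ord.ofPS _)).mono (by omega)

lemma fam_expo (i : Pole μ) (a : Fin 2) : Fam fun m => S.expo i m a :=
  (Fam.const _).mul (Fam.ofPS_mk fun k => S.analytic_θ i a k)

lemma famM_frame (i : Pole μ) : FamM (S.frame i) :=
  (FamM.constMat (S.analytic_Φ i)).mul (FamM.seriesMat (S.analytic_Ξ i))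

lemma famM_psiq (j : Fin (numApp n)) : FamM (S.psiq j) := by
  refine ((FamM.constMat ?_).mul (FamM.seriesMat (S.analytic_Ξq j))).mul
    (FamM.diagonal fun a => Fam.const _)
  intro a b
  fin_cases a <;> fin_cases b
  · exact fun _ _ => analyticAt_const
  · exact fun _ _ => analyticAt_const
  · exact ana_pOf j
  · exact fun _ _ => analyticAt_const

lemma varLambda_eq (i : Pole μ) (a : Fin 2) (m v : Param n) : S.varLambda i a m v =
    sX (1 - (n i : ℤ)) * ofPS (PowerSeries.mk fun k =>
      if k + 1 = n i then 0 else fderiv ℂ (S.θ i a k) m v / ((k : ℂ) + 1 - (n i : ℂ)))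
    - HahnSeries.C (fderiv ℂ (center i) m v) * S.expo i m a := rfl

section

variable {m : Param n} (hm : m ∈ phaseSpace n)
include hm

lemma holInv_frame (i : Pole μ) : HolInv (S.frame i m) :=
  IsoMon.holInv_frame (S.isUnit_Φ i m hm) (S.Ξ_zero i m hm)

lemma frame_eq (i : Pole μ) :
    (S.frame i m).map lD + omegaAt m (normalForm n θ₀ m) i * S.frame i m
      = S.frame i m * Matrix.diagonal (S.expo i m) :=
  (gauge_eq_iff (S.holInv_frame hm i).isUnit_det).1 (S.solution i m hm)

lemma fderiv_θ_residue (i : Pole μ) (a : Fin 2) {k : ℕ} (hk : k + 1 = n i) (v : Param n) :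
    fderiv ℂ (S.θ i a k) m v = 0 := by
  rw [fderiv_congr_phaseSpace (g := fun _ => θ₀ i a) (fun m' hm' => ?_) hm]
  · simp
  · rw [S.θ_polar i a k (by omega) m' hm', polarCoeff, dif_neg (by omega)]

/-- The integrated series has no logarithmic term because the residue exponent is constant; so
omitting k = n_i - 1 loses nothing. -/
lemma lD_varLambda (i : Pole μ) (a : Fin 2) (v : Param n) :
    lD (S.varLambda i a m v) = variation (center i) (fun m' => S.expo i m' a) m v := by
  rw [varLambda_eq, variation_eq, lD_sub, lD_C_mul]
  congr 1
  ext1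
  funext k
  rw [coeff_cvar hm v (S.fam_expo i a), coeff_lD, coeff_sX_mul]
  rcases lt_or_ge k (-(n i)) with hk | hk
  · rw [fderiv_coeff_eq_zero hm v ((S.fam_expo i a).famO fun m' _ => S.ord_expo i m' a) hk,
      Ord.ofPS _ _ (by omega), mul_zero]
  · obtain ⟨l, rfl⟩ : ∃ l : ℕ, k = l - n i := ⟨(k + n i).toNat, by omega⟩
    simp only [S.coeff_expo]
    rw [show ((l : ℤ) - n i + 1 - (1 - n i)) = l by ring, coeff_ofPS_mk]
    split_ifs with h
    · rw [mul_zero]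
      exact (S.fderiv_θ_residue hm i a h v).symm
    · have h' : ((l : ℂ) + 1 - n i) ≠ 0 := by
        rw [sub_ne_zero]
        exact_mod_cast h
      push_cast
      rw [show ((l : ℂ) - n i + 1) = (l : ℂ) + 1 - n i by ring, mul_div_cancel₀ _ h']

lemma isUnit_det_psiq (j : Fin (numApp n)) : IsUnit (S.psiq j m).det := by
  have h1 : HolInv (constMat !![1, 0; pOf m j, 1] * seriesMat (S.Ξq j m)) := by
    refine IsoMon.holInv_frame ?_ (S.Ξq_zero j m hm)
    rw [Matrix.isUnit_iff_isUnit_det, Matrix.det_fin_two_of]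
    simp
  rw [psiq, Matrix.det_mul]
  refine h1.isUnit_det.mul ?_
  rw [Matrix.det_diagonal, Fin.prod_univ_two, isUnit_iff_ne_zero]
  exact mul_ne_zero one_ne_zero (sX_ne_zero 1)

end

section

variable (hn : ∀ i, 1 ≤ n i) (hFuchs : ∑ i, (θ₀ i 0 + θ₀ i 1) = -1)
    (hreg : ∀ i, n i = 1 → ∀ k : ℤ, θ₀ i 0 - θ₀ i 1 ≠ (k : ℂ))
include hn hFuchs hreg

lemma _root_.IsoMon.famM_omegaAt_normalForm (i : Pole μ) :
    FamM fun m : Param n => omegaAt m (normalForm n θ₀ m) i :=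
  (famM_omegaAt θ₀ hn i).congr fun m hm => by rw [normalForm_eq θ₀ hn hFuchs hreg hm]

lemma _root_.IsoMon.famM_omegaApp_normalForm (j : Fin (numApp n)) :
    FamM fun m : Param n => omegaApp m (normalForm n θ₀ m) j :=
  (famM_omegaApp θ₀ j).congr fun m hm => by rw [normalForm_eq θ₀ hn hFuchs hreg hm]

variable {m : Param n} (hm : m ∈ phaseSpace n)
include hm

lemma variation_frame_eq (i : Pole μ) (v : Param n) :
    (variationMat (center i) (S.frame i) m v).map lD
      + (S.varOmega i m v * S.frame i m + omegaAt m (normalForm n θ₀ m) i *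
        variationMat (center i) (S.frame i) m v)
    = variationMat (center i) (S.frame i) m v * Matrix.diagonal (S.expo i m)
      + S.frame i m * (Matrix.diagonal fun a => S.varLambda i a m v).map lD := by
  have h := variationMat_gauge hm v (center i) (S.famM_frame i)
    (famM_omegaAt_normalForm hn hFuchs hreg i) (FamM.diagonal fun a => S.fam_expo i a)
    fun m hm => S.frame_eq hm i
  rw [variationMat_diagonal hm] at h
  rw [varOmega, h, Matrix.diagonal_map lD_zero]
  congr 3
  funext a
  exact (S.lD_varLambda hm i a v).symm

lemma varOmega_eq (i : Pole μ) (v : Param n) : S.varOmega i m v = -(S.logVar i m v).map lD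
    - (omegaAt m (normalForm n θ₀ m) i * S.logVar i m v
      - S.logVar i m v * omegaAt m (normalForm n θ₀ m) i) :=
  variation_connection (S.holInv_frame hm i).isUnit_det (S.frame_eq hm i)
    (S.variation_frame_eq hn hFuchs hreg hm i v) rfl
    (by rw [Matrix.diagonal_mul_diagonal, Matrix.diagonal_mul_diagonal]
        simp only [mul_comm]) rfl

lemma varOmegaq_eq (j : Fin (numApp n)) (v : Param n) :
    S.varOmegaq j m v = -(S.logVarq j m v).map lD
    - (omegaApp m (normalForm n θ₀ m) j * S.logVarq j m v
      - S.logVarq j m v * omegaApp m (normalForm n θ₀ m) j) := by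
  have h0 : FamM fun _ : Param n => (0 : Mat2 LS) := fun _ _ => Fam.const 0
  have h : ∀ m ∈ phaseSpace n, (S.psiq j m).map lD
      + omegaApp m (normalForm n θ₀ m) j * S.psiq j m = S.psiq j m * 0 := fun m hm => by
    rw [Matrix.mul_zero]
    exact S.solutionq j m hm
  have h1 := variationMat_gauge hm v (fun m' => qOf m' j) (S.famM_psiq j)
    (famM_omegaApp_normalForm hn hFuchs hreg j) h0 h
  refine variation_connection (lam := 0) (S.isUnit_det_psiq hm j) (h m hm) h1 ?_ ?_ ?_
  · have : variationMat (fun m' => qOf m' j) (fun _ : Param n => (0 : Mat2 LS)) m v = 0 := by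
      ext1 a b
      rw [variationMat, Matrix.of_apply, variation_eq]
      simp only [Matrix.zero_apply]
      rw [cvar_const hm, lD_zero, mul_zero, sub_zero]
    rw [this]
    ext1 a b
    exact lD_zero
  · rw [Matrix.zero_mul]
  · rw [Matrix.mul_zero, Matrix.zero_mul, sub_zero, logVarq]

lemma omegaHat_eq (v w : Param n) : S.omegaHat m v w
    = ∑ i, res (Matrix.trace (S.varOmega i m v * S.logVar i m w))
      + ∑ j, res (Matrix.trace (S.varOmegaq j m v * S.logVarq j m w)) := by
  rw [omegaHat, Finset.mul_sum, Finset.mul_sum]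
  congr 1
  · exact Finset.sum_congr rfl fun i _ => res_trace_sub (S.varOmega_eq hn hFuchs hreg hm i v)
      (S.varOmega_eq hn hFuchs hreg hm i w)
  · exact Finset.sum_congr rfl fun j _ => res_trace_sub (S.varOmegaq_eq hn hFuchs hreg hm j v)
      (S.varOmegaq_eq hn hFuchs hreg hm j w)

end

end LocalSolutions

end

section

variable {μ : ℕ} {n : Pole μ → ℕ}

/-! ### Vertical directions -/

lemma fderiv_of_vertical {f : Param n → ℂ} (hf : ∀ m m', proj m = proj m' → f m = f m')
    {v : Param n} (hv : proj v = 0) (m : Param n) : fderiv ℂ f m v = 0 := by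
  -- No regularity is needed: a nondifferentiable function has `fderiv` zero by convention, and a
  -- differentiable one is constant along the vertical line.
  by_cases hd : DifferentiableAt ℂ f m
  · rw [← hd.lineDeriv_eq_fderiv, lineDeriv]
    have : (fun t : ℂ => f (m + t • v)) = fun _ => f m := by
      funext t
      refine hf _ _ ?_
      change proj m + t • proj v = proj m
      rw [hv, smul_zero, add_zero]
    rw [this, deriv_const]
  · rw [fderiv_zero_of_not_differentiableAt hd]
    rfl

lemma pos_of_proj {m m' : Param n} (h : proj m = proj m') : pos m = pos m' := by
  rw [pos, pos, tOf, tOf]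
  exact congrArg (fun b : Base n => (Fin.cons 0 (Fin.cons 1 b.1) : Fin (μ + 2) → ℂ)) h

lemma center_of_proj {m m' : Param n} (h : proj m = proj m') (i : Pole μ) :
    center i m = center i m' := by
  match i with
  | some k => exact congrFun (pos_of_proj h) k
  | none => rfl

lemma polarCoeff_of_proj (θ₀ : Pole μ → Fin 2 → ℂ) {m m' : Param n} (h : proj m = proj m')
    (i : Pole μ) (a : Fin 2) (l : ℕ) : polarCoeff θ₀ m i a l = polarCoeff θ₀ m' i a l := by
  rw [polarCoeff, polarCoeff]
  split_ifs with hl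
  · exact congrArg (fun b : Base n => b.2 i a ⟨l, hl⟩) h
  · rfl

lemma entB_of_proj {m m' : Param n} (h : proj m = proj m') (i : Pole μ) :
    entB m i = entB m' i := by
  match i with
  | some k => rw [entB, entB, xAt_some, xAt_some, Pz, Pz, pos_of_proj h]
  | none => rw [entB, entB, Pz, Pz, pos_of_proj h]

lemma polarSeries_of_proj (θ₀ : Pole μ → Fin 2 → ℂ) {m m' : Param n} (h : proj m = proj m')
    (i : Pole μ) (a : Fin 2) : polarSeries θ₀ m i a = polarSeries θ₀ m' i a := by
  simp only [polarSeries, polarCoeff_of_proj θ₀ h]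

lemma polarTrace_of_proj (θ₀ : Pole μ → Fin 2 → ℂ) {m m' : Param n} (h : proj m = proj m')
    (i : Pole μ) : polarTrace θ₀ m i = polarTrace θ₀ m' i := by
  simp only [polarTrace, polarSeries_of_proj θ₀ h]

lemma polarLower_of_proj (θ₀ : Pole μ → Fin 2 → ℂ) {m m' : Param n} (h : proj m = proj m')
    (i : Pole μ) : polarLower θ₀ m i = polarLower θ₀ m' i := by
  simp only [polarLower, polarSeries_of_proj θ₀ h, entB_of_proj h]

/-- The polar part of f is that of g, which is pulled back from the base, so its vertical derivative
vanishes. -/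
lemma ord_cvar_of_vertical {f g : Param n → LS} (hf : Fam f)
    (hfg : ∀ m ∈ phaseSpace n, Ord (f m - g m) 0) (hg : ∀ m m', proj m = proj m' → g m = g m')
    {m : Param n} (hm : m ∈ phaseSpace n) {v : Param n} (hv : proj v = 0) :
    Ord (cvar f m v) 0 := fun k hk => by
  rw [coeff_cvar hm v hf, fderiv_congr_phaseSpace
    (fun m' hm' => coeff_eq_of_ord_sub (hfg m' hm') hk) hm]
  exact fderiv_of_vertical (fun m m' h => by rw [hg m m' h]) hv m

lemma variation_of_vertical (i : Pole μ) (f : Param n → LS) {m v : Param n} (hv : proj v = 0) :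
    variation (center i) f m v = cvar f m v := by
  rw [variation_eq, fderiv_of_vertical (fun m m' h => center_of_proj h i) hv, map_zero, zero_mul,
    sub_zero]

/-! ### Diagonalization -/

lemma conj_variation {F A L dF dA dL G : Mat2 LS} (hF : IsUnit F.det)
    (h : F.map lD + A * F = F * L) (hv : dF.map lD + (dA * F + A * dF) = dF * L + F * dL)
    (hG : dF = F * G) : F⁻¹ * (dA * F) = dL + (G * L - L * G) - G.map lD := by
  have h1 : dA * F = F * (dL + (G * L - L * G) - G.map lD) := by
    rw [hG, map_lD_mul, eq_sub_of_add_eq h] at hv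
    have e : dA * F = ((F * L - A * F) * G + F * G.map lD + (dA * F + A * (F * G)))
        - (F * L * G + F * G.map lD) := by
      simp only [Matrix.sub_mul, Matrix.mul_assoc]
      abel
    rw [e, hv]
    simp only [Matrix.mul_sub, Matrix.mul_add, Matrix.mul_assoc]
    abel
  rw [h1, Matrix.nonsing_inv_mul_cancel_left _ _ hF]

/-- If g = O(X^s) with s < N, the coefficient of X^{s-N} in g l is the s-th coefficient of g times
the leading one of l. The derivative does not interfere: for N > 1 it involves a coefficient of g
below s, and for N = 1, s = 0 its factor vanishes. So g gains an order at each step. -/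
lemma ord_of_mul_sub_lD {g l : LS} {N : ℕ} (hN : 1 ≤ N) (hg : Ord g 0) (hl : Lead l (-N))
    (h : Ord (g * l - lD g) 0) : Ord g N := by
  have key : ∀ s : ℕ, s ≤ N → Ord g s := fun s => by
    induction s with
    | zero => exact fun _ => hg
    | succ s ih =>
      intro hs
      have hgs := ih (by omega)
      have h1 := h (s - N) (by omega)
      rw [HahnSeries.coeff_sub, hgs.coeff_mul_of_eq hl.1 (by ring), coeff_lD] at h1
      have h2 : (((s : ℤ) - N : ℤ) + 1 : ℂ) * g.coeff (s - N + 1) = 0 := by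
        rcases Nat.eq_or_lt_of_le hN with h3 | h3
        · rw [← h3] at hs
          obtain rfl : s = 0 := by omega
          rw [← h3]
          simp
        · rw [hgs _ (by omega), mul_zero]
      rw [h2, sub_zero] at h1
      rw [Nat.cast_succ]
      exact ord_succ hgs ((mul_eq_zero.1 h1).resolve_right hl.2)
  exact key N le_rfl

/-- Because X has unit diagonal, the diagonal entry of the relation reads G_aa = k_aa + k_ab X_ba -
X_ab G_ba. Once k_ab = 0, G_aa is a constant plus O(X^{N+1}). -/
lemma ord_lD_diag {X G dX : Mat2 LS} {k : Mat2 ℂ} {N : ℕ} (hN : 1 ≤ N) (hX : ∀ a, X a a = 1)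
    (hXo : ∀ a b, a ≠ b → Ord (X a b) 1) (hdX : ∀ a, dX a a = 0)
    (hdXo : ∀ a b, a ≠ b → Ord (dX a b) 1) (hG : NoPole G)
    (hGo : ∀ a b, a ≠ b → Ord (G a b) N) (h : X * G = constMat k * X + dX) (a : Fin 2) :
    Ord (lD (G a a)) N := by
  obtain ⟨b, hab, hsum⟩ : ∃ b, a ≠ b ∧ ∀ f : Fin 2 → LS, ∑ c, f c = f a + f b := by
    fin_cases a
    · exact ⟨1, by decide, fun f => Fin.sum_univ_two f⟩
    · exact ⟨0, by decide, fun f => by rw [Fin.sum_univ_two, add_comm]; rfl⟩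
  have e1 := congrFun (congrFun h a) a
  have e2 := congrFun (congrFun h a) b
  rw [Matrix.add_apply, Matrix.mul_apply, Matrix.mul_apply, hsum, hsum, hX, hdX] at e1
  rw [Matrix.add_apply, Matrix.mul_apply, Matrix.mul_apply, hsum, hsum, hX, hX] at e2
  change _ = HahnSeries.C (k a a) * 1 + HahnSeries.C (k a b) * X b a + 0 at e1
  change _ = HahnSeries.C (k a a) * X a b + HahnSeries.C (k a b) * 1 + dX a b at e2
  -- Constant term of the off-diagonal relation: every other term vanishes at X = 0, where N ≥ 1 is
  -- used for G_ab.
  have hk : k a b = 0 := by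
    have h1 : Ord (HahnSeries.C (k a b) : LS) 1 := by
      have h2 : Ord (X a b * G b b) 1 := (hXo a b hab).mul (hG b b)
      have h3 : Ord (HahnSeries.C (k a a) * X a b) 1 := (Ord.C _).mul (hXo a b hab)
      have h4 := (((hGo a b hab).mono (by omega : (1 : ℤ) ≤ N)).add h2).sub (h3.add (hdXo a b hab))
      convert h4 using 1
      linear_combination -e2
    simpa [coeff_C] using h1 0 (by norm_num)
  rw [hk, map_zero, zero_mul, add_zero, add_zero, mul_one, one_mul] at e1
  have h5 : Ord (X a b * G b a) (1 + N) := (hXo a b hab).mul (hGo b a hab.symm)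
  rw [eq_sub_of_add_eq e1, lD_sub, lD_C, zero_sub]
  exact (h5.lD.mono (by omega)).neg

lemma NoPole.variationMat {A : Param n → Mat2 LS} (hA : FamM A)
    (h : ∀ m ∈ phaseSpace n, NoPole (A m)) (s : Param n → ℂ) {m : Param n}
    (hm : m ∈ phaseSpace n) (v : Param n) : NoPole (variationMat s A m v) := fun a b => by
  have h1 := FamO.cvar hm v ((hA a b).famO fun m hm => h m hm a b)
  have h2 : Ord (HahnSeries.C (fderiv ℂ s m v) * lD (A m a b)) 0 := by
    simpa using (Ord.C _).mul (Ord.lD_zero (h m hm a b))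
  exact h1.sub h2

end

section

variable {μ : ℕ} {n : Pole μ → ℕ}

namespace LocalSolutions

variable {θ₀ : Pole μ → Fin 2 → ℂ} (S : LocalSolutions n θ₀)

/-! ### The residues at the poles -/

lemma ord_varLambda (i : Pole μ) (a : Fin 2) (m v : Param n) :
    Ord (S.varLambda i a m v) (-(n i : ℤ)) := by
  rw [varLambda_eq]
  refine Ord.sub ?_ ?_
  · exact ((Ord.sX _).mul (Ord.ofPS _)).mono (by omega)
  · exact ((Ord.C _).mul (S.ord_expo i m a)).mono (by omega)

lemma coeff_varLambda (i : Pole μ) (a : Fin 2) (m v : Param n) {j : ℕ} (hj : j < n i) :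
    (S.varLambda i a m v).coeff (-1 - j)
      = (if j + 1 = n i then 0
          else -(fderiv ℂ (S.θ i a (n i - 2 - j)) m v / ((j : ℂ) + 1)))
        - fderiv ℂ (center i) m v * S.θ i a (n i - 1 - j) m := by
  rw [varLambda_eq, HahnSeries.coeff_sub, coeff_C_mul, coeff_sX_mul]
  congr 1
  · split_ifs with h
    · exact Ord.ofPS _ _ (by omega)
    · rw [show (-1 - j - (1 - n i) : ℤ) = ((n i - 2 - j : ℕ) : ℤ) by omega, coeff_ofPS_mk,
        if_neg (by omega)]
      have e : ((n i - 2 - j : ℕ) : ℂ) + 1 - n i = -((j : ℂ) + 1) := by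
        rw [Nat.cast_sub (by omega), Nat.cast_sub (by omega)]
        push_cast
        ring
      rw [e, div_neg]
  · rw [show (-1 - j : ℤ) = ((n i - 1 - j : ℕ) : ℤ) - n i by omega, S.coeff_expo]

section

variable (hn : ∀ i, 1 ≤ n i) {m : Param n} (hm : m ∈ phaseSpace n)
include hm

lemma fderiv_θ_of_vertical (i : Pole μ) (a : Fin 2) {k : ℕ} (hk : k < n i) {v : Param n}
    (hv : proj v = 0) : fderiv ℂ (S.θ i a k) m v = 0 := by
  rw [fderiv_congr_phaseSpace (fun m' hm' => S.θ_polar i a k hk m' hm') hm]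
  exact fderiv_of_vertical (fun m m' h => polarCoeff_of_proj θ₀ h i a k) hv m

lemma ord_variation_expo (i : Pole μ) (a : Fin 2) {v : Param n} (hv : proj v = 0) :
    Ord (variation (center i) (fun m' => S.expo i m' a) m v) 0 := by
  rw [variation_of_vertical i _ hv]
  refine ord_cvar_of_vertical (g := fun m => polarSeries θ₀ m i a) (S.fam_expo i a)
    (fun m' hm' => ?_) (fun m m' h => polarSeries_of_proj θ₀ h i a) hm hv
  refine ord_sub_of_coeff (S.ord_expo i m' a) (ord_polarSeries θ₀ m' i a) fun l hl => ?_
  rw [S.coeff_expo, coeff_polarSeries θ₀ m' i a hl, S.θ_polar i a l hl m' hm']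

lemma coeff_variation_expo (i : Pole μ) (a : Fin 2) {v : Param n} (hv : proj v = 0) (j : ℕ) :
    (variation (center i) (fun m' => S.expo i m' a) m v).coeff j
      = fderiv ℂ (S.θ i a (n i + j)) m v := by
  rw [variation_of_vertical i _ hv, coeff_cvar hm v (S.fam_expo i a)]
  congr 2
  funext m'
  rw [← S.coeff_expo i m' a (n i + j)]
  congr 1
  push_cast
  ring

lemma fderiv_hamTheta (i : Pole μ) (a : Fin 2) (l : Fin (n i - 1)) (v : Param n) :
    fderiv ℂ (S.hamTheta i a l) m v
      = fderiv ℂ (S.θ i a (2 * n i - l - 2)) m v / ((n i : ℂ) - l - 1) := by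
  have h := (S.analytic_θ i a (2 * n i - l - 2) m hm).differentiableAt
  have e : S.hamTheta i a l
      = fun m => S.θ i a (2 * n i - (l : ℕ) - 2) m * ((n i : ℂ) - (l : ℕ) - 1)⁻¹ := by
    funext m'
    rw [hamTheta, div_eq_mul_inv]
  rw [e, fderiv_mul_const h]
  simp [div_eq_mul_inv, mul_comm]

lemma fderiv_hamT_of_vertical (i : Pole μ) {v : Param n} (hv : proj v = 0) :
    fderiv ℂ (S.hamT i) m v
      = ∑ a, ∑ l ∈ Finset.range (n i),
          S.θ i a l m * fderiv ℂ (S.θ i a (2 * n i - l - 1)) m v := by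
  have hd := fun a k => (S.analytic_θ i a k m hm).differentiableAt
  have e : S.hamT i = fun m => ∑ a, ∑ l ∈ Finset.range (n i),
    S.θ i a l m * S.θ i a (2 * n i - l - 1) m := rfl
  rw [e, fderiv_fun_sum fun a _ => DifferentiableAt.fun_sum fun l _ => (hd a _).fun_mul (hd a _),
    sum_apply]
  refine Finset.sum_congr rfl fun a _ => ?_
  rw [fderiv_fun_sum fun l _ => (hd a _).fun_mul (hd a _), sum_apply]
  refine Finset.sum_congr rfl fun l hl => ?_
  rw [fderiv_fun_mul (hd a _) (hd a _)]
  simp [S.fderiv_θ_of_vertical hm i a (Finset.mem_range.1 hl) hv]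

lemma fderiv_θ_of_lt (i : Pole μ) (a : Fin 2) (l : Fin (n i - 1)) (w : Param n) :
    fderiv ℂ (S.θ i a l) m w = fderiv ℂ (fun m' => thetaOf m' i a l) m w := by
  rw [fderiv_congr_phaseSpace (fun m' hm' => ?_) hm]
  rw [S.θ_polar i a l (by omega) m' hm', polarCoeff, dif_pos l.2]

include hn

/-- δ_vL has coefficients δθ_{n_i+j}, j ≥ 0, and they pair with the coefficients of X^{-1-j} in
δ_wΛ. Reversing the sum by l = n_i-2-j in the θ-part and by l = n_i-1-j in the t-part makes n_i+j
equal to 2n_i-l-2 and 2n_i-l-1, and the divisor j+1 equal to n_i-l-1. The index j = n_i-1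
contributes nothing to the θ-part. -/
lemma res_variation_expo_mul (i : Pole μ) (a : Fin 2) {v : Param n} (hv : proj v = 0)
    (w : Param n) :
    -res (variation (center i) (fun m' => S.expo i m' a) m v * S.varLambda i a m w)
      = ∑ l : Fin (n i - 1), fderiv ℂ (S.hamTheta i a l) m v
          * fderiv ℂ (fun m' => thetaOf m' i a l) m w
        + (∑ l ∈ Finset.range (n i), S.θ i a l m * fderiv ℂ (S.θ i a (2 * n i - l - 1)) m v)
          * fderiv ℂ (center i) m w := by
  have hi := hn i
  have h1 : res (variation (center i) (fun m' => S.expo i m' a) m v * S.varLambda i a m w)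
      = ∑ j ∈ Finset.range (n i), fderiv ℂ (S.θ i a (n i + j)) m v
          * (S.varLambda i a m w).coeff (-1 - j) := by
    rw [res, coeff_mul_eq_sum (S.ord_variation_expo hm i a hv) (S.ord_varLambda i a m w)]
    have : Finset.Icc (0 : ℤ) (-1 - -(n i : ℤ)) = (Finset.range (n i)).image fun j : ℕ => (j : ℤ) := by
      ext k
      simp only [Finset.mem_Icc, Finset.mem_image, Finset.mem_range]
      constructor
      · intro hk
        exact ⟨k.toNat, by omega, by omega⟩
      · rintro ⟨j, hj, rfl⟩
        omega
    rw [this, Finset.sum_image fun _ _ _ _ h => Int.natCast_inj.1 h]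
    exact Finset.sum_congr rfl fun j _ => by rw [S.coeff_variation_expo hm i a hv]
  rw [h1, Finset.sum_congr rfl fun j hj => by
    rw [S.coeff_varLambda i a m w (Finset.mem_range.1 hj), mul_sub], Finset.sum_sub_distrib, neg_sub,
    sub_eq_neg_add]
  congr 1
  · obtain ⟨N, hN⟩ : ∃ N, n i = N + 1 := ⟨n i - 1, by omega⟩
    have hN' : n i - 1 = N := by omega
    have e : ∑ l : Fin (n i - 1), fderiv ℂ (S.hamTheta i a l) m v
          * fderiv ℂ (fun m' => thetaOf m' i a l) m w
        = ∑ l ∈ Finset.range (n i - 1), fderiv ℂ (S.θ i a (2 * n i - l - 2)) m v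
          / ((n i : ℂ) - l - 1) * fderiv ℂ (S.θ i a l) m w := by
      rw [← Fin.sum_univ_eq_sum_range (fun l => fderiv ℂ (S.θ i a (2 * n i - l - 2)) m v
          / ((n i : ℂ) - l - 1) * fderiv ℂ (S.θ i a l) m w)]
      refine Finset.sum_congr rfl fun l _ => ?_
      rw [S.fderiv_hamTheta hm, S.fderiv_θ_of_lt hm]
    rw [e, hN', ← Finset.sum_range_reflect (fun l : ℕ => fderiv ℂ (S.θ i a (2 * n i - l - 2)) m v
        / ((n i : ℂ) - l - 1) * fderiv ℂ (S.θ i a l) m w), hN, Finset.sum_range_succ, if_pos rfl, mul_zero,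
      add_zero, ← Finset.sum_neg_distrib]
    refine Finset.sum_congr rfl fun j hj => ?_
    have hj := Finset.mem_range.1 hj
    rw [if_neg (by omega), show 2 * (N + 1) - (N - 1 - j) - 2 = N + 1 + j by omega,
      show N + 1 - 2 - j = N - 1 - j by omega]
    have e : ((N + 1 : ℕ) : ℂ) - ((N - 1 - j : ℕ) : ℂ) - 1 = (j : ℂ) + 1 := by
      rw [Nat.cast_sub (by omega), Nat.cast_sub (by omega)]
      push_cast
      ring
    rw [e]
    ring
  · rw [← Finset.sum_range_reflect (fun l => S.θ i a l m * _), Finset.sum_mul]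
    refine Finset.sum_congr rfl fun j hj => ?_
    have hj := Finset.mem_range.1 hj
    rw [show 2 * n i - (n i - 1 - j) - 1 = n i + j by omega]
    ring

end

/-! ### Vertical variation of the formal frames, and the residues they produce. -/

section

variable (hn : ∀ i, 1 ≤ n i) (hFuchs : ∑ i, (θ₀ i 0 + θ₀ i 1) = -1)
    (hreg : ∀ i, n i = 1 → ∀ k : ℤ, θ₀ i 0 - θ₀ i 1 ≠ (k : ℂ))
    {m : Param n} (hm : m ∈ phaseSpace n)
include hn hFuchs hreg hm

/-- The (1,2) entry is a function of the t_i alone, and the polar parts of the second row are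
`polarLower` and `polarTrace`, both pulled back from the base. -/
lemma noPole_varOmega_of_vertical (i : Pole μ) {v : Param n} (hv : proj v = 0) :
    NoPole (S.varOmega i m v) := by
  have e : S.varOmega i m v = variationMat (center i)
      (fun m => !![0, entB m i; entC m (nf θ₀ m) i, entD m (nf θ₀ m) i]) m v := by
    refine variationMat_congr hm v _ fun m' hm' => ?_
    rw [normalForm_eq θ₀ hn hFuchs hreg hm', omegaAt_eq hn]
  rw [e]
  intro a b
  rw [variationMat, Matrix.of_apply, variation_of_vertical i _ hv]
  fin_cases a <;> fin_cases b
  · exact ord_cvar_of_vertical (f := fun _ => 0) (g := fun _ => 0) (Fam.const 0)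
      (fun _ _ => Ord.zero.sub Ord.zero) (fun _ _ _ => rfl) hm hv
  · refine ord_cvar_of_vertical (f := fun m => entB m i) (g := fun m => entB m i) (fam_entB i)
      (fun _ _ => ?_) (fun _ _ h => entB_of_proj h i) hm hv
    rw [sub_self]
    exact Ord.zero
  · exact ord_cvar_of_vertical (f := fun m => entC m (nf θ₀ m) i) (fam_entC θ₀ i)
      (fun m hm => ord_entC_nf_sub θ₀ hn hm i) (fun _ _ h => polarLower_of_proj θ₀ h i) hm hv
  · exact ord_cvar_of_vertical (f := fun m => entD m (nf θ₀ m) i) (fam_entD θ₀ i)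
      (fun m hm => ord_entD_nf_sub θ₀ hn hFuchs hm i) (fun _ _ h => polarTrace_of_proj θ₀ h i) hm hv

/-- `F⁻¹ δ(F)` for the frame `F` of the formal solution. -/
def frameVar (i : Pole μ) (m v : Param n) : Mat2 LS :=
  (S.frame i m)⁻¹ * variationMat (center i) (S.frame i) m v

omit hn hFuchs hreg in
lemma frame_mul_frameVar (i : Pole μ) (v : Param n) :
    S.frame i m * S.frameVar i m v = variationMat (center i) (S.frame i) m v :=
  Matrix.mul_nonsing_inv_cancel_left _ _ (S.holInv_frame hm i).isUnit_det

omit hn hFuchs hreg in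
lemma noPole_frameVar (i : Pole μ) (v : Param n) : NoPole (S.frameVar i m v) :=
  (S.holInv_frame hm i).inv.1.mul
    (NoPole.variationMat (S.famM_frame i) (fun _ hm => (S.holInv_frame hm i).1) _ hm v)

/-- `F⁻¹ δ(Ω) F` for the frame `F` of the formal solution. -/
def conjVarOmega (i : Pole μ) (m v : Param n) : Mat2 LS :=
  (S.frame i m)⁻¹ * (S.varOmega i m v * S.frame i m)

lemma conjVarOmega_eq (i : Pole μ) (v : Param n) : S.conjVarOmega i m v
    = Matrix.diagonal (fun a => variation (center i) (fun m' => S.expo i m' a) m v)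
      + (S.frameVar i m v * Matrix.diagonal (S.expo i m)
        - Matrix.diagonal (S.expo i m) * S.frameVar i m v) - (S.frameVar i m v).map lD := by
  have h := conj_variation (S.holInv_frame hm i).isUnit_det (S.frame_eq hm i)
    (S.variation_frame_eq hn hFuchs hreg hm i v) (S.frame_mul_frameVar hm i v).symm
  rw [Matrix.diagonal_map lD_zero] at h
  simp only [S.lD_varLambda hm] at h
  exact h

/-- The corresponding entry of F⁻¹ δΩ F is g(L_b - L_a) - g', which is holomorphic. The difference
of exponents has exact order -n_i because the leading exponents are distinct. -/
lemma ord_frameVar_off (i : Pole μ) {v : Param n} (hv : proj v = 0) {a b : Fin 2} (hab : a ≠ b) :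
    Ord (S.frameVar i m v a b) (n i) := by
  have hlead : ∀ c, (S.expo i m c).coeff (-(n i : ℤ)) = polarCoeff θ₀ m i c 0 := fun c => by
    have := S.coeff_expo i m c 0
    rwa [S.θ_polar i c 0 (hn i) m hm, Nat.cast_zero, zero_sub] at this
  refine ord_of_mul_sub_lD (l := S.expo i m b - S.expo i m a) (hn i) (S.noPole_frameVar hm i v a b)
    ⟨(S.ord_expo i m b).sub (S.ord_expo i m a), ?_⟩ ?_
  · rw [HahnSeries.coeff_sub, hlead, hlead, sub_ne_zero]
    have h := polarCoeff_ne θ₀ hn hreg hm i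
    fin_cases a <;> fin_cases b
    · exact absurd rfl hab
    · exact h.symm
    · exact h
    · exact absurd rfl hab
  · have hW : NoPole (S.conjVarOmega i m v) := (S.holInv_frame hm i).inv.1.mul
      ((S.noPole_varOmega_of_vertical hn hFuchs hreg hm i hv).mul (S.holInv_frame hm i).1)
    rw [S.conjVarOmega_eq hn hFuchs hreg hm] at hW
    have h : Ord _ 0 := hW a b
    convert h using 1
    rw [Matrix.sub_apply, Matrix.add_apply, Matrix.sub_apply, Matrix.mul_diagonal,
      Matrix.diagonal_mul, Matrix.diagonal_apply_ne _ hab, Matrix.map_apply]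
    ring

omit hn hFuchs hreg in
-- Multiplying δ(ΦΞ) by Φ⁻¹ puts the variation into the form `constMat k * Ξ + δΞ` with k constant,
-- as required by `ord_lD_diag`.
lemma seriesMat_mul_frameVar (i : Pole μ) {v : Param n} (hv : proj v = 0) :
    seriesMat (S.Ξ i m) * S.frameVar i m v
      = constMat ((S.Φ i m)⁻¹ * Matrix.of fun a b => fderiv ℂ (fun m' => S.Φ i m' a b) m v)
          * seriesMat (S.Ξ i m)
        + variationMat (center i) (fun m' => seriesMat (S.Ξ i m')) m v := by
  have hΦ := (holInv_constMat (S.isUnit_Φ i m hm)).isUnit_det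
  have h1 := S.frame_mul_frameVar hm i v
  have h2 : variationMat (center i) (fun m' => constMat (S.Φ i m')) m v
      = constMat (Matrix.of fun a b => fderiv ℂ (fun m' => S.Φ i m' a b) m v) := by
    ext1 a b
    rw [variationMat, Matrix.of_apply, variation_of_vertical i _ hv]
    exact cvar_C hm v (S.analytic_Φ i a b)
  have h3 : variationMat (center i) (S.frame i) m v = _ :=
    variationMat_mul hm v (center i) (FamM.constMat (S.analytic_Φ i))
      (FamM.seriesMat (S.analytic_Ξ i))
  rw [h3, h2, frame, Matrix.mul_assoc] at h1
  rw [constMat_mul, ← constMat_inv (S.isUnit_Φ i m hm),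
    ← Matrix.nonsing_inv_mul_cancel_left (constMat (S.Φ i m))
      (seriesMat (S.Ξ i m) * S.frameVar i m v) hΦ, h1, Matrix.mul_add, Matrix.mul_assoc,
    Matrix.nonsing_inv_mul_cancel_left _ _ hΦ]

omit hn hFuchs hreg in
lemma seriesMat_Ξ_diag (i : Pole μ) (a : Fin 2) : seriesMat (S.Ξ i m) a a = 1 := by
  refine ext_of_nat (Ord.ofPS _) Ord.one fun k => ?_
  rw [coeff_seriesMat, coeff_one']
  rcases k with _ | k
  · rw [S.Ξ_zero i m hm]
    simp
  · rw [S.Ξ_diag i m hm _ k.succ_pos, if_neg (by omega)]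

omit hn hFuchs hreg in
lemma ord_seriesMat_Ξ_off (i : Pole μ) {a b : Fin 2} (hab : a ≠ b) :
    Ord (seriesMat (S.Ξ i m) a b) 1 := by
  have h : (seriesMat (S.Ξ i m) a b).coeff ((0 : ℕ) : ℤ) = 0 := by
    rw [coeff_seriesMat, S.Ξ_zero i m hm, Matrix.one_apply_ne hab]
  exact ord_succ (a := 0) (ord_seriesMat _ a b) h

lemma ord_lD_frameVar_diag (i : Pole μ) {v : Param n} (hv : proj v = 0) (a : Fin 2) :
    Ord (lD (S.frameVar i m v a a)) (n i) := by
  have hΞ := FamM.seriesMat (S.analytic_Ξ i)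
  refine ord_lD_diag (hn i) (S.seriesMat_Ξ_diag hm i)
    (fun a b hab => S.ord_seriesMat_Ξ_off hm i hab) (fun a => ?_) (fun a b hab => ?_)
    (S.noPole_frameVar hm i v) (fun a b hab => S.ord_frameVar_off hn hFuchs hreg hm i hv hab)
    (S.seriesMat_mul_frameVar hm i hv) a
  · rw [variationMat, Matrix.of_apply, variation_of_vertical i _ hv,
      cvar_congr hm v fun m' hm' => S.seriesMat_Ξ_diag hm' i a, cvar_const hm]
  · rw [variationMat, Matrix.of_apply, variation_of_vertical i _ hv]
    exact FamO.cvar hm v ((hΞ a b).famO fun m' hm' => S.ord_seriesMat_Ξ_off hm' i hab)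

/-- Conjugate by the frame. F⁻¹ δ_vΩ F paired with F⁻¹ δ_wF is holomorphic. Against the diagonal
δ_wΛ only diagonal entries count: the commutator drops out and the derivative of G_aa cancels the
pole of δ_wΛ_a. -/
lemma res_pole_eq (i : Pole μ) {v : Param n} (hv : proj v = 0) (w : Param n) :
    res (Matrix.trace (S.varOmega i m v * S.logVar i m w))
      = ∑ a, -res (variation (center i) (fun m' => S.expo i m' a) m v * S.varLambda i a m w) := by
  have hF := (S.holInv_frame hm i).isUnit_det
  have hW : NoPole (S.conjVarOmega i m v) := (S.holInv_frame hm i).inv.1.mul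
    ((S.noPole_varOmega_of_vertical hn hFuchs hreg hm i hv).mul (S.holInv_frame hm i).1)
  have e1 : S.logVar i m w = S.frame i m *
      (S.frameVar i m w - Matrix.diagonal fun a => S.varLambda i a m w) * (S.frame i m)⁻¹ := by
    rw [logVar, ← S.frame_mul_frameVar hm i w]
    simp only [Matrix.mul_sub, Matrix.sub_mul]
  have e2 : Matrix.trace (S.varOmega i m v * S.logVar i m w)
      = Matrix.trace (S.conjVarOmega i m v * S.frameVar i m w)
        - Matrix.trace (S.conjVarOmega i m v * Matrix.diagonal fun a => S.varLambda i a m w) := by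
    rw [← Matrix.trace_sub, ← Matrix.mul_sub, conjVarOmega, e1, Matrix.mul_assoc (S.frame i m)⁻¹,
      Matrix.trace_mul_comm (S.frame i m)⁻¹]
    simp only [Matrix.mul_assoc]
  have e3 : res (Matrix.trace (S.conjVarOmega i m v * S.frameVar i m w)) = 0 :=
    (hW.mul (S.noPole_frameVar hm i w)).trace _ (by norm_num)
  rw [e2, res, HahnSeries.coeff_sub, ← res, e3, zero_sub, Matrix.trace, HahnSeries.coeff_sum,
    ← Finset.sum_neg_distrib]
  refine Finset.sum_congr rfl fun a _ => ?_
  rw [Matrix.diag_apply, Matrix.mul_diagonal, S.conjVarOmega_eq hn hFuchs hreg hm,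
    Matrix.sub_apply, Matrix.add_apply, Matrix.sub_apply, Matrix.mul_diagonal, Matrix.diagonal_mul,
    Matrix.diagonal_apply_eq, Matrix.map_apply, mul_comm (S.expo i m a), sub_self, add_zero, sub_mul,
    HahnSeries.coeff_sub]
  have h0 := ((S.ord_lD_frameVar_diag hn hFuchs hreg hm i hv a).mul (S.ord_varLambda i a m w))
    (-1) (by omega)
  rw [h0, sub_zero, res]

lemma sum_res_pole (v : Param n) (hv : proj v = 0) (w : Param n) :
    ∑ i, res (Matrix.trace (S.varOmega i m v * S.logVar i m w))
      = ∑ i, ∑ l : Fin (n i - 1),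
          (dWedge (S.hamTheta i 0 l) (fun m' => thetaOf m' i 0 l) m v w
            + dWedge (S.hamTheta i 1 l) (fun m' => thetaOf m' i 1 l) m v w)
        + ∑ k : Fin μ, dWedge (S.hamT (some k.succ.succ)) (fun m' => tOf m' k) m v w := by
  have h1 : ∀ i, res (Matrix.trace (S.varOmega i m v * S.logVar i m w))
      = ∑ l : Fin (n i - 1),
          (dWedge (S.hamTheta i 0 l) (fun m' => thetaOf m' i 0 l) m v w
            + dWedge (S.hamTheta i 1 l) (fun m' => thetaOf m' i 1 l) m v w)
        + fderiv ℂ (S.hamT i) m v * fderiv ℂ (center i) m w := fun i => by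
    rw [S.res_pole_eq hn hFuchs hreg hm i hv, S.fderiv_hamT_of_vertical hm i hv,
      Finset.sum_congr rfl fun a _ => S.res_variation_expo_mul hn hm i a hv w,
      Finset.sum_add_distrib, ← Finset.sum_mul, Fin.sum_univ_two, ← Finset.sum_add_distrib]
    congr 1
    refine Finset.sum_congr rfl fun l _ => ?_
    have h2 : ∀ a, fderiv ℂ (fun m' => thetaOf m' i a l) m v = 0 := fun a =>
      fderiv_of_vertical (fun m m' h => congrArg (fun b : Base n => b.2 i a l) h) hv m
    rw [dWedge, dWedge, h2, h2, mul_zero, mul_zero, sub_zero, sub_zero]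
  rw [Finset.sum_congr rfl fun i _ => h1 i, Finset.sum_add_distrib]
  congr 1
  have h3 : ∀ k : Fin μ, dWedge (S.hamT (some k.succ.succ)) (fun m' => tOf m' k) m v w
      = fderiv ℂ (S.hamT (some k.succ.succ)) m v * fderiv ℂ (center (some k.succ.succ)) m w :=
    fun k => by
      have h2 : fderiv ℂ (fun m' : Param n => tOf m' k) m v = 0 :=
        fderiv_of_vertical (fun m m' h => congrArg (fun b : Base n => b.1 k) h) hv m
      rw [dWedge, h2, mul_zero, sub_zero]
      rfl
  have hc : ∀ c : ℂ, fderiv ℂ (fun _ : Param n => c) m w = 0 := fun c => by simp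
  rw [Fintype.sum_option, Fin.sum_univ_succ, Fin.sum_univ_succ, Finset.sum_congr rfl fun k _ => h3 k]
  -- The poles at ∞, 0 and 1 do not move, so only t_3, …, t_ν leave a t-term.
  rw [show fderiv ℂ (center (none : Pole μ)) m w = 0 from hc 0,
    show fderiv ℂ (center (some 0 : Pole μ)) m w = 0 from hc 0,
    show fderiv ℂ (center (some (Fin.succ 0) : Pole μ)) m w = 0 from hc 1]
  simp

end

end LocalSolutions

end

section

variable {μ : ℕ} {n : Pole μ → ℕ}

/-! ### The residues at the apparent singularities -/

lemma ord_variation {s : Param n → ℂ} {f : Param n → LS} (hf : FamO 0 f) {m : Param n}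
    (hm : m ∈ phaseSpace n) (v : Param n) : Ord (variation s f m v) 0 := by
  have h : Ord (HahnSeries.C (fderiv ℂ s m v) * lD (f m)) 0 := by
    simpa using (Ord.C _).mul (Ord.lD_zero (hf.1 m hm))
  exact (FamO.cvar hm v hf).sub h

lemma coeff_variation {s : Param n → ℂ} {f : Param n → LS} (hf : Fam f) {m : Param n}
    (hm : m ∈ phaseSpace n) (v : Param n) (k : ℤ) : (variation s f m v).coeff k
      = fderiv ℂ (fun m' => (f m').coeff k) m v
        - fderiv ℂ s m v * ((k + 1) * (f m).coeff (k + 1)) := by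
  rw [variation_eq, HahnSeries.coeff_sub, coeff_cvar hm v hf, coeff_C_mul, coeff_lD]

lemma variation_C_mul_sX {s c : Param n → ℂ} (hc : Ana c) {m : Param n}
    (hm : m ∈ phaseSpace n) (v : Param n) :
    variation s (fun m => HahnSeries.C (c m) * sX (-1)) m v
      = HahnSeries.C (fderiv ℂ c m v) * sX (-1)
        + HahnSeries.C (fderiv ℂ s m v) * HahnSeries.C (c m) * sX (-2) := by
  rw [variation_eq, cvar_mul hm v (Fam.C hc) (Fam.const _), cvar_C hm v hc, cvar_const hm,
    lD_C_mul, lD_sX, Int.cast_neg, Int.cast_one, map_neg, map_one, mul_zero, add_zero,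
    show (-1 : ℤ) - 1 = -2 by norm_num]
  ring

section

variable (θ₀ : Pole μ → Fin 2 → ℂ) (j : Fin (numApp n)) {m : Param n} (hm : m ∈ phaseSpace n)
  (v : Param n)
include hm

/-- At fixed x the variation of p/(x - q) is δp/(x - q) + p δq/(x - q)²; the remainder of the entry
is holomorphic and stays so. -/
lemma ord_variation_appC :
    Ord (variation (fun m => qOf m j) (fun m => appC m (nf θ₀ m) j) m v
      - HahnSeries.C (fderiv ℂ (fun m => pOf m j) m v) * sX (-1)
      - HahnSeries.C (fderiv ℂ (fun m => qOf m j) m v) * HahnSeries.C (pOf m j) * sX (-2)) 0 := by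
  have h1 : Fam fun m : Param n => HahnSeries.C (pOf m j) * sX (-1) :=
    (Fam.C (ana_pOf j)).mul (Fam.const _)
  have h2 := (fam_appC θ₀ j).sub h1
  have h3 := ord_variation (s := fun m => qOf m j)
    (h2.famO fun m hm => ord_appC_sub hm (nf θ₀ m) j) hm v
  have h4 := variation_add hm v (fun m => qOf m j) h1 h2
  rw [variation_C_mul_sX (ana_pOf j) hm] at h4
  simp only [add_sub_cancel] at h4
  rw [h4]
  convert h3 using 1
  ring

lemma ord_variation_appD :
    Ord (variation (fun m => qOf m j) (fun m => appD m (nf θ₀ m) j) m v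
      + HahnSeries.C (fderiv ℂ (fun m => qOf m j) m v) * sX (-2)) 0 := by
  have hc : Ana fun _ : Param n => (-1 : ℂ) := fun _ _ => analyticAt_const
  have h1 : Fam fun _ : Param n => HahnSeries.C (-1 : ℂ) * sX (-1) := Fam.const _
  have h2 := (fam_appD θ₀ j).sub h1
  have h3 := ord_variation (s := fun m => qOf m j) (h2.famO (a := 0) fun m hm => by
    have := ord_appD_add hm (nf θ₀ m) j
    rwa [map_neg, map_one, neg_one_mul, sub_neg_eq_add]) hm v
  have h4 := variation_add hm v (fun m => qOf m j) h1 h2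
  rw [variation_C_mul_sX hc hm] at h4
  simp only [add_sub_cancel] at h4
  rw [h4, fderiv_fun_const]
  convert h3 using 1
  rw [map_neg, map_one]
  simp

/-- The poles cancel, and the vanishing of the constant term is the apparent-singularity condition.
-/
lemma ord_appE : Ord (appC m (nf θ₀ m) j + HahnSeries.C (pOf m j) * appD m (nf θ₀ m) j
    - HahnSeries.C (pOf m j) * HahnSeries.C (pOf m j) * appB m j) 1 := by
  refine ord_succ (a := 0) ?_ ?_
  · have h1 : Ord (HahnSeries.C (pOf m j) * (appD m (nf θ₀ m) j + sX (-1))) 0 := by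
      simpa using (Ord.C _).mul (ord_appD_add hm (nf θ₀ m) j)
    have h2 : Ord (HahnSeries.C (pOf m j) * HahnSeries.C (pOf m j) * appB m j) 0 := by
      simpa using ((Ord.C _).mul (Ord.C _)).mul (ord_appB hm j)
    convert ((ord_appC_sub hm (nf θ₀ m) j).add h1).sub h2 using 1
    ring
  · have h := apparent_nf θ₀ hm j
    rw [← map_mul, HahnSeries.coeff_sub, HahnSeries.coeff_add, coeff_C_mul, coeff_C_mul]
    linear_combination h

/-- The constant term of the entry `(2, 2)` of the connection matrix at `q_j` after removing the
apparent singularity. -/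
def appConst (θ₀ : Pole μ → Fin 2 → ℂ) (j : Fin (numApp n)) (m : Param n) : ℂ :=
  (appD m (nf θ₀ m) j).coeff 0 - pOf m j * (appB m j).coeff 0

omit hm in
lemma ana_appConst : Ana (appConst (n := n) θ₀ j) :=
  ((fam_appD θ₀ j).ana 0).sub ((ana_pOf j).mul ((fam_appB j).ana 0))

lemma fderiv_appConst : fderiv ℂ (appConst θ₀ j) m v
    = fderiv ℂ (fun m => (appD m (nf θ₀ m) j).coeff 0) m v
      - (fderiv ℂ (fun m => pOf m j) m v * (appB m j).coeff 0
        + pOf m j * fderiv ℂ (fun m => (appB m j).coeff 0) m v) := by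
  have h1 := ((fam_appD θ₀ j).ana 0 m hm).differentiableAt
  have h2 := (ana_pOf j m hm).differentiableAt
  have h3 := ((fam_appB j).ana 0 m hm).differentiableAt
  have e : appConst θ₀ j
      = fun m => (appD m (nf θ₀ m) j).coeff 0 - pOf m j * (appB m j).coeff 0 := rfl
  rw [e, fderiv_fun_sub h1 (h2.fun_mul h3), fderiv_fun_mul h2 h3]
  simp
  ring

/-- The entry `(2, 2)` after conjugation. -/
lemma ord_appe : Ord (appD m (nf θ₀ m) j - HahnSeries.C (pOf m j) * appB m j + sX (-1)) 0 := by
  have h2 : Ord (HahnSeries.C (pOf m j) * appB m j) 0 := by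
    simpa using (Ord.C _).mul (ord_appB hm j)
  convert (ord_appD_add hm (nf θ₀ m) j).sub h2 using 1
  ring

lemma ord_appe' : Ord (appD m (nf θ₀ m) j - HahnSeries.C (pOf m j) * appB m j) (-1) := by
  have h := ((ord_appe θ₀ j hm).mono (by norm_num : (-1 : ℤ) ≤ 0)).sub (Ord.sX (-1))
  rwa [add_sub_cancel_right] at h

lemma coeff_appe_neg_one :
    (appD m (nf θ₀ m) j - HahnSeries.C (pOf m j) * appB m j).coeff (-1) = -1 := by
  have h := ord_appe θ₀ j hm (-1) (by norm_num)
  rw [HahnSeries.coeff_add, coeff_sX, if_pos rfl] at h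
  linear_combination h

/-- Residues of `Tr(M Q)` and `Tr(M B)`. -/
lemma res_trace_app (κ r : ℂ) {Q : Mat2 LS} (hQ : ∀ a b, Ord (Q a b) 1)
    {db dc dd b c d : LS} (hb : b = appB m j) (hc : c = appC m (nf θ₀ m) j)
    (hd : d = appD m (nf θ₀ m) j)
    (hdb : db = variation (fun m => qOf m j) (fun m => appB m j) m v)
    (hdc : dc = variation (fun m => qOf m j) (fun m => appC m (nf θ₀ m) j) m v)
    (hdd : dd = variation (fun m => qOf m j) (fun m => appD m (nf θ₀ m) j) m v)
    {P : LS} (hP : P = HahnSeries.C (pOf m j)) :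
    res (P * db * Q 0 0 + db * Q 1 0 + (dc + P * dd - P * P * db) * Q 0 1
          + (dd - P * db) * Q 1 1 + HahnSeries.C r * db
        + HahnSeries.C κ * (P * db * (P * b) + db * (c + P * d - P * P * b)
          + (dc + P * dd - P * P * db) * b + (dd - P * db) * (d - P * b)))
      = -(fderiv ℂ (fun m => qOf m j) m v * (Q 1 1).coeff 1)
        - κ * fderiv ℂ (appConst θ₀ j) m v := by
  have hP0 : Ord P 0 := by rw [hP]; exact Ord.C _
  have hb0 : Ord b 0 := by rw [hb]; exact ord_appB hm j
  have hdb0 : Ord db 0 := by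
    rw [hdb]
    exact ord_variation ((fam_appB j).famO fun m hm => ord_appB hm j) hm v
  have hPdb : Ord (P * db) 0 := by simpa using hP0.mul hdb0
  have hE : Ord (c + P * d - P * P * b) 1 := by
    rw [hb, hc, hd, hP]
    exact ord_appE θ₀ j hm
  have he : Ord (d - P * b) (-1) := by
    rw [hb, hd, hP]
    exact ord_appe' θ₀ j hm
  have he1 : (d - P * b).coeff (-1) = -1 := by
    rw [hb, hd, hP]
    exact coeff_appe_neg_one θ₀ j hm
  have hdc0 := ord_variation_appC θ₀ j hm v
  have hdd0 := ord_variation_appD θ₀ j hm v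
  rw [← hdc, ← hP] at hdc0
  rw [← hdd] at hdd0
  -- In the conjugated (2,1) entry the double poles p δq X⁻² of δc and of p δd cancel, leaving δp
  -- X⁻¹.
  have h21 : Ord (dc + P * dd - P * P * db
      - HahnSeries.C (fderiv ℂ (fun m => pOf m j) m v) * sX (-1)) 0 := by
    have h1 : Ord (P * (dd + HahnSeries.C (fderiv ℂ (fun m => qOf m j) m v) * sX (-2))) 0 := by
      simpa using hP0.mul hdd0
    have h2 : Ord (P * (P * db)) 0 := by simpa using hP0.mul hPdb
    convert (hdc0.add h1).sub h2 using 1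
    ring
  have h22 : Ord (dd - P * db
      + HahnSeries.C (fderiv ℂ (fun m => qOf m j) m v) * sX (-2)) 0 := by
    convert hdd0.sub hPdb using 1
    ring
  have hM21 : Ord (dc + P * dd - P * P * db) (-1) := by
    have h := (h21.mono (by norm_num : (-1 : ℤ) ≤ 0)).add
      (((Ord.C (fderiv ℂ (fun m => pOf m j) m v)).mul (Ord.sX (-1))).mono (by norm_num))
    rwa [sub_add_cancel] at h
  have hM22 : Ord (dd - P * db) (-2) := by
    have h := (h22.mono (by norm_num : (-2 : ℤ) ≤ 0)).sub
      (((Ord.C (fderiv ℂ (fun m => qOf m j) m v)).mul (Ord.sX (-2))).mono (by norm_num))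
    rwa [add_sub_cancel_right] at h
  have c21 : (dc + P * dd - P * P * db).coeff (-1) = fderiv ℂ (fun m => pOf m j) m v := by
    have h := h21 (-1) (by norm_num)
    rw [HahnSeries.coeff_sub, coeff_C_mul, coeff_sX, if_pos rfl] at h
    linear_combination h
  have c22a : (dd - P * db).coeff (-2) = -fderiv ℂ (fun m => qOf m j) m v := by
    have h := h22 (-2) (by norm_num)
    rw [HahnSeries.coeff_add, coeff_C_mul, coeff_sX, if_pos rfl] at h
    linear_combination h
  have c22b : (dd - P * db).coeff (-1) = 0 := by
    have h := h22 (-1) (by norm_num)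
    rw [HahnSeries.coeff_add, coeff_C_mul, coeff_sX, if_neg (by norm_num)] at h
    linear_combination h
  have c22c : (dd - P * db).coeff 0 = fderiv ℂ (fun m => (appD m (nf θ₀ m) j).coeff 0) m v
      - fderiv ℂ (fun m => qOf m j) m v * d.coeff 1
      - pOf m j * (fderiv ℂ (fun m => (appB m j).coeff 0) m v
        - fderiv ℂ (fun m => qOf m j) m v * b.coeff 1) := by
    rw [HahnSeries.coeff_sub, hP, coeff_C_mul, hdd, hdb, coeff_variation (fam_appD θ₀ j) hm,
      coeff_variation (fam_appB j) hm, hb, hd]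
    simp
  have e1 : (d - P * b).coeff 1 = d.coeff 1 - pOf m j * b.coeff 1 := by
    rw [HahnSeries.coeff_sub, hP, coeff_C_mul]
  have t1 : (P * db * Q 0 0).coeff (-1) = 0 := hPdb.mul (hQ 0 0) _ (by norm_num)
  have t2 : (db * Q 1 0).coeff (-1) = 0 := hdb0.mul (hQ 1 0) _ (by norm_num)
  have t3 : ((dc + P * dd - P * P * db) * Q 0 1).coeff (-1) = 0 :=
    hM21.mul (hQ 0 1) _ (by norm_num)
  have t4 : ((dd - P * db) * Q 1 1).coeff (-1)
      = -fderiv ℂ (fun m => qOf m j) m v * (Q 1 1).coeff 1 := by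
    rw [hM22.coeff_mul_of_eq (hQ 1 1) (by norm_num), c22a]
  have t5 : db.coeff (-1) = 0 := hdb0 _ (by norm_num)
  have t6 : (P * db * (P * b)).coeff (-1) = 0 := hPdb.mul (hP0.mul hb0) _ (by norm_num)
  have t7 : (db * (c + P * d - P * P * b)).coeff (-1) = 0 := hdb0.mul hE _ (by norm_num)
  have t8 : ((dc + P * dd - P * P * db) * b).coeff (-1)
      = fderiv ℂ (fun m => pOf m j) m v * b.coeff 0 := by
    rw [hM21.coeff_mul_of_eq hb0 (by norm_num), c21]
  have t9 : ((dd - P * db) * (d - P * b)).coeff (-1)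
      = (dd - P * db).coeff (-2) * (d - P * b).coeff 1
        + (dd - P * db).coeff (-1) * (d - P * b).coeff 0
        + (dd - P * db).coeff 0 * (d - P * b).coeff (-1) := by
    rw [coeff_mul_eq_sum hM22 he, show Finset.Icc (-2 : ℤ) (-1 - -1) = {-2, -1, 0} by decide,
      Finset.sum_insert (by decide), Finset.sum_insert (by decide), Finset.sum_singleton,
      ← add_assoc]
    rfl
  rw [c22a, c22b, c22c, he1, e1] at t9
  have hbc : b.coeff 0 = (appB m j).coeff 0 := by rw [hb]
  simp only [res, HahnSeries.coeff_add, coeff_C_mul]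
  -- The terms with the first-order coefficients of b and d, produced by the moving centre, cancel
  -- against those in `t9`; the rest is the derivative of the constant term d - pb.
  rw [t1, t2, t3, t4, t5, t6, t7, t8, t9, fderiv_appConst θ₀ j hm, hbc]
  ring

end

end

/-! ### The logarithmic variation of the solutions at an apparent singularity. -/

section

variable {μ : ℕ} {n : Pole μ → ℕ}

/-- The constant unipotent frame at an apparent singularity. -/
def unip (p : ℂ) : Mat2 LS := constMat !![1, 0; p, 1]

lemma unip_eq (p : ℂ) : unip p = !![1, 0; HahnSeries.C p, 1] := by
  ext1 i j
  rw [unip, constMat, Matrix.map_apply]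
  fin_cases i <;> fin_cases j <;> simp

lemma isUnit_det_unip (p : ℂ) : IsUnit (unip p).det := by
  rw [unip_eq, Matrix.det_fin_two_of]
  simp

lemma unip_conj {p : ℂ} {A : Mat2 LS} {b c d : LS} (hA : A = !![0, b; c, d]) :
    (unip p)⁻¹ * (A * unip p) = !![HahnSeries.C p * b, b;
      c + HahnSeries.C p * d - HahnSeries.C p * HahnSeries.C p * b, d - HahnSeries.C p * b] := by
  have h : A * unip p = unip p * !![HahnSeries.C p * b, b;
      c + HahnSeries.C p * d - HahnSeries.C p * HahnSeries.C p * b, d - HahnSeries.C p * b] := by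
    rw [unip_eq, hA]
    generalize (HahnSeries.C p : LS) = P
    ext1 i j
    fin_cases i <;> fin_cases j <;> simp [Matrix.mul_apply, Fin.sum_univ_two] <;> ring
  rw [h, Matrix.nonsing_inv_mul_cancel_left _ _ (isUnit_det_unip p)]

lemma variationMat_eq (s : Param n → ℂ) (A : Param n → Mat2 LS) (m v : Param n) :
    variationMat s A m v = variationMat (fun _ => 0) A m v
      - (HahnSeries.C (fderiv ℂ s m v) : LS) • (A m).map lD := by
  ext1 i j
  rw [Matrix.sub_apply, Matrix.smul_apply, Matrix.map_apply, smul_eq_mul, variationMat,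
    variationMat, Matrix.of_apply, Matrix.of_apply, variation_eq, variation_eq]
  simp

lemma smul_neg_mul (c : LS) (A B : Mat2 LS) : c • -(A * B) = -((c • A) * B) := by
  ext1 i j
  simp only [Matrix.smul_apply, Matrix.neg_apply, Matrix.mul_apply, Fin.sum_univ_two, smul_eq_mul]
  ring

lemma trace_mul_smul (c : LS) (A B : Mat2 LS) : (A * c • B).trace = c * (A * B).trace := by
  simp only [Matrix.trace_fin_two, Matrix.smul_apply, Matrix.mul_apply, Fin.sum_univ_two,
    smul_eq_mul]
  ring

lemma trace_app {P r b c d db dc dd κ : LS} {A V M Q R : Mat2 LS} (hA : A = !![0, b; c, d])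
    (hV : V = !![0, db; dc, dd])
    (hM : M = !![P * db, db; dc + P * dd - P * P * db, dd - P * db]) (hR : R = !![0, 0; r, 0]) :
    (V * R).trace + (M * Q).trace + κ * (V * A).trace
      = P * db * Q 0 0 + db * Q 1 0 + (dc + P * dd - P * P * db) * Q 0 1
          + (dd - P * db) * Q 1 1 + r * db
        + κ * (P * db * (P * b) + db * (c + P * d - P * P * b)
          + (dc + P * dd - P * P * db) * b + (dd - P * db) * (d - P * b)) := by
  simp only [hA, hV, hM, hR, Matrix.trace_fin_two, Matrix.mul_apply, Fin.sum_univ_two]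
  simp
  ring

lemma unipVar_eq (c : ℂ) : constMat !![0, 0; c, 0] = !![0, 0; HahnSeries.C c, 0] := by
  ext1 i j
  rw [constMat, Matrix.map_apply]
  fin_cases i <;> fin_cases j <;> simp

lemma variationMat_zero_apply (A : Param n → Mat2 LS) (m v : Param n) (i j : Fin 2) :
    variationMat (fun _ => 0) A m v i j = cvar (fun m => A m i j) m v := by
  rw [variationMat, Matrix.of_apply, variation_eq]
  simp

lemma variationMat_zero_const (D : Mat2 LS) {m : Param n} (hm : m ∈ phaseSpace n) (v : Param n) :
    variationMat (fun _ => 0) (fun _ => D) m v = 0 := by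
  ext1 i j
  rw [variationMat_zero_apply, cvar_const hm]
  rfl

/-- The variation of the unipotent frame. -/
def unipVar (c : ℂ) : Mat2 LS := constMat !![0, 0; c, 0]

lemma unipVar_mul_unip (c p : ℂ) : unipVar c * unip p = unipVar c := by
  rw [unipVar, unip, ← constMat_mul]
  congr 1
  ext i j
  fin_cases i <;> fin_cases j <;> simp [Matrix.mul_apply, Fin.sum_univ_two]

lemma famM_unip (j : Fin (numApp n)) : FamM fun m : Param n => unip (pOf m j) := by
  simp only [unip_eq]
  exact FamM.of (Fam.const 1) (Fam.const 0) (Fam.C (ana_pOf j)) (Fam.const 1)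

lemma variationMat_unip (j : Fin (numApp n)) {m : Param n} (hm : m ∈ phaseSpace n) (v : Param n) :
    variationMat (fun _ => 0) (fun m : Param n => unip (pOf m j)) m v
      = unipVar (fderiv ℂ (fun m => pOf m j) m v) := by
  have hc : ∀ c : ℂ, cvar (fun _ : Param n => (HahnSeries.C c : LS)) m v = HahnSeries.C 0 :=
    fun c => by rw [cvar_const hm, map_zero]
  ext1 a b
  rw [variationMat_zero_apply]
  fin_cases a <;> fin_cases b
  · exact hc 1
  · exact hc 0
  · exact cvar_C hm v (ana_pOf j)
  · exact hc 1

namespace LocalSolutions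

variable {θ₀ : Pole μ → Fin 2 → ℂ} (S : LocalSolutions n θ₀) (j : Fin (numApp n))

lemma psiq_eq (m : Param n) : S.psiq j m
    = unip (pOf m j) * (seriesMat (S.Ξq j m) * Matrix.diagonal ![1, lX]) := by
  rw [psiq, unip, Matrix.mul_assoc]

/-- The logarithmic variation of the normalized holomorphic frame at `q_j`. -/
def logVarXi (m v : Param n) : Mat2 LS :=
  variationMat (fun _ => 0) (fun m => seriesMat (S.Ξq j m)) m v * (seriesMat (S.Ξq j m))⁻¹

section

variable {m : Param n} (hm : m ∈ phaseSpace n) (v : Param n)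
include hm

lemma logVarXi_mul : S.logVarXi j m v * seriesMat (S.Ξq j m)
    = variationMat (fun _ => 0) (fun m => seriesMat (S.Ξq j m)) m v :=
  Matrix.nonsing_inv_mul_cancel_right _ _ (holInv_seriesMat (S.Ξq_zero j m hm)).isUnit_det

lemma ord_variation_Ξq (a b : Fin 2) :
    Ord (variationMat (fun _ => 0) (fun m => seriesMat (S.Ξq j m)) m v a b) 1 := by
  have hf := FamM.seriesMat (S.analytic_Ξq j) a b
  rw [variationMat_zero_apply]
  refine ord_succ (a := 0) (FamO.cvar hm v (hf.famO fun _ _ => ord_seriesMat _ a b)) ?_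
  rw [coeff_cvar hm v hf, fderiv_congr_phaseSpace (g := fun _ => (1 : Mat2 ℂ) a b) _ hm]
  · simp
  · intro m' hm'
    have := coeff_seriesMat (S.Ξq j m') a b 0
    rwa [S.Ξq_zero j m' hm'] at this

lemma ord_logVarXi (a b : Fin 2) : Ord (S.logVarXi j m v a b) 1 := by
  have h := (holInv_seriesMat (S.Ξq_zero j m hm)).inv.1
  rw [logVarXi, Matrix.mul_apply]
  exact Ord.sum fun c _ => (S.ord_variation_Ξq j hm v a c).mul (h c b)

/-- The three terms come from the unipotent factor, from Ξ_q, and from the moving centre: the latter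
contributes -δq ψ', which equals δq Ω ψ by the differential equation. The factor diag(1, X) is
constant in the local coordinate. -/
lemma logVarq_eq : S.logVarq j m v
    = unipVar (fderiv ℂ (fun m => pOf m j) m v)
      + unip (pOf m j) * S.logVarXi j m v * (unip (pOf m j))⁻¹
      + (HahnSeries.C (fderiv ℂ (fun m => qOf m j) m v) : LS)
        • omegaApp m (normalForm n θ₀ m) j := by
  have hψ := S.isUnit_det_psiq hm j
  have hΞ := FamM.seriesMat (S.analytic_Ξq j)
  have hD : FamM fun _ : Param n => (Matrix.diagonal ![1, lX] : Mat2 LS) := fun _ _ => Fam.const _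
  have h1 : (S.psiq j m).map lD = -(omegaApp m (normalForm n θ₀ m) j * S.psiq j m) :=
    eq_neg_of_add_eq_zero_left (S.solutionq j m hm)
  have h2 : variationMat (fun _ => 0) (S.psiq j) m v
      = (unipVar (fderiv ℂ (fun m => pOf m j) m v)
        + unip (pOf m j) * S.logVarXi j m v * (unip (pOf m j))⁻¹) * S.psiq j m := by
    rw [variationMat_congr hm v _ fun m' _ => S.psiq_eq j m',
      variationMat_mul hm v _ (famM_unip j) (hΞ.mul hD), variationMat_mul hm v _ hΞ hD,
      variationMat_zero_const _ hm, variationMat_unip j hm, ← S.logVarXi_mul j hm v, S.psiq_eq,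
      Matrix.mul_zero, add_zero, Matrix.add_mul]
    congr 1
    · rw [← Matrix.mul_assoc (unipVar _) (unip _), unipVar_mul_unip]
    · rw [Matrix.mul_assoc, Matrix.mul_assoc, Matrix.mul_assoc,
        Matrix.nonsing_inv_mul_cancel_left _ _ (isUnit_det_unip _)]
  rw [logVarq, variationMat_eq, h1, h2, smul_neg_mul, sub_neg_eq_add, ← Matrix.add_mul, Matrix.mul_nonsing_inv_cancel_right _ _ hψ]

end

section

variable (hn : ∀ i, 1 ≤ n i) (hFuchs : ∑ i, (θ₀ i 0 + θ₀ i 1) = -1)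
    (hreg : ∀ i, n i = 1 → ∀ k : ℤ, θ₀ i 0 - θ₀ i 1 ≠ (k : ℂ))
    {m : Param n} (hm : m ∈ phaseSpace n)
include hn hFuchs hreg hm

lemma omegaApp_normalForm : omegaApp m (normalForm n θ₀ m) j
    = !![0, appB m j; appC m (nf θ₀ m) j, appD m (nf θ₀ m) j] := by
  rw [normalForm_eq θ₀ hn hFuchs hreg hm, omegaApp_eq]

/-- After conjugation by the unipotent factor, the (2,2) entry of the equation at order X reads 2ξ -
ξ + α = 0, with ξ the wanted coefficient: the conjugated entry of Ω has residue -1 and constant term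
α = `appConst`. -/
lemma Ξq_one : S.Ξq j m 1 1 1 = -appConst θ₀ j m := by
  set Y : Mat2 LS := seriesMat (S.Ξq j m) * Matrix.diagonal ![1, lX] with hY
  have hU := isUnit_det_unip (pOf m j)
  have h1 : Y.map lD + (unip (pOf m j))⁻¹ * (omegaApp m (normalForm n θ₀ m) j * unip (pOf m j)) * Y
      = 0 := by
    have h := S.solutionq j m hm
    rw [Matrix.mul_assoc (constMat _)] at h
    change (unip (pOf m j) * Y).map lD + _ * (unip (pOf m j) * Y) = 0 at h
    have e : (unip (pOf m j)).map lD = 0 := map_lD_constMat _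
    rw [map_lD_mul, e, Matrix.zero_mul, zero_add] at h
    have h' := congrArg (fun Z => (unip (pOf m j))⁻¹ * Z) h
    simp only [Matrix.mul_add, Matrix.mul_zero, Matrix.nonsing_inv_mul_cancel_left _ _ hU] at h'
    rw [← h']
    simp only [Matrix.mul_assoc]
  rw [unip_conj (omegaApp_normalForm j hn hFuchs hreg hm)] at h1
  have h2 := congrFun (congrFun h1 1) 1
  rw [Matrix.add_apply, Matrix.map_apply, Matrix.mul_apply, Fin.sum_univ_two] at h2
  change lD (Y 1 1) + ((appC m (nf θ₀ m) j + HahnSeries.C (pOf m j) * appD m (nf θ₀ m) j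
    - HahnSeries.C (pOf m j) * HahnSeries.C (pOf m j) * appB m j) * Y 0 1
    + (appD m (nf θ₀ m) j - HahnSeries.C (pOf m j) * appB m j) * Y 1 1) = 0 at h2
  have hYe : ∀ a, Y a 1 = sX 1 * seriesMat (S.Ξq j m) a 1 := fun a => by
    rw [hY, Matrix.mul_diagonal, mul_comm]
    rfl
  have hco : ∀ a (k : ℕ), (Y a 1).coeff (k + 1) = S.Ξq j m k a 1 := fun a k => by
    rw [hYe, coeff_sX_mul, add_sub_cancel_right, coeff_seriesMat]
  have hYo : ∀ a, Ord (Y a 1) 1 := fun a => by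
    rw [hYe]
    simpa using (Ord.sX 1).mul (ord_seriesMat (S.Ξq j m) a 1)
  have y1 : (Y 1 1).coeff 1 = 1 := by
    have := hco 1 0
    rwa [S.Ξq_zero j m hm] at this
  have y2 : (Y 1 1).coeff 2 = S.Ξq j m 1 1 1 := hco 1 1
  have h3 := congrArg (fun f : LS => f.coeff 1) h2
  simp only [HahnSeries.coeff_add] at h3
  rw [coeff_lD, (ord_appE θ₀ j hm).mul (hYo 0) 1 (by norm_num),
    (ord_appe' θ₀ j hm).coeff_mul_next (hYo 1) (by norm_num), coeff_appe_neg_one θ₀ j hm] at h3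
  norm_num at h3
  rw [y1, y2] at h3
  rw [appConst]
  linear_combination h3

/-- As Ξ_q(0) = 1 is constant, the logarithmic variation at first order is just the variation of the
first coefficient of Ξ_q. -/
lemma coeff_logVarXi (v : Param n) :
    (S.logVarXi j m v 1 1).coeff 1 = -fderiv ℂ (appConst θ₀ j) m v := by
  have h := congrFun (congrFun (S.logVarXi_mul j hm v) 1) 1
  have h1 := congrArg (fun f : LS => f.coeff 1) h
  have o1 : Ord (seriesMat (S.Ξq j m) 0 1) 1 := by
    refine ord_succ (a := 0) (ord_seriesMat _ 0 1) ?_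
    have := coeff_seriesMat (S.Ξq j m) 0 1 0
    rwa [S.Ξq_zero j m hm] at this
  have c1 : (seriesMat (S.Ξq j m) 1 1).coeff 0 = 1 := by
    have := coeff_seriesMat (S.Ξq j m) 1 1 0
    rwa [S.Ξq_zero j m hm] at this
  simp only [Matrix.mul_apply, Fin.sum_univ_two, HahnSeries.coeff_add] at h1
  rw [(S.ord_logVarXi j hm v 1 0).mul o1 1 (by norm_num),
    (S.ord_logVarXi j hm v 1 1).coeff_mul_of_eq (ord_seriesMat _ 1 1) (by norm_num), c1, mul_one,
    zero_add, variationMat_zero_apply, coeff_cvar hm v (FamM.seriesMat (S.analytic_Ξq j) 1 1),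
    fderiv_congr_phaseSpace (g := fun m => -appConst θ₀ j m) (fun m' hm' => ?_) hm] at h1
  · rw [h1, fderiv_fun_neg]
    rfl
  · rw [← S.Ξq_one j hn hFuchs hreg hm']
    exact coeff_seriesMat (S.Ξq j m') 1 1 1

/-- Ξ_q contributes δ_vq δ_wα and the moving centre contributes -δ_vα δ_wq, where α = `appConst`;
the unipotent factor contributes nothing. Neither direction has to be vertical. -/
lemma res_app (v w : Param n) :
    res (Matrix.trace (S.varOmegaq j m v * S.logVarq j m w))
      = -dWedge (appConst θ₀ j) (fun m => qOf m j) m v w := by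
  have hV : S.varOmegaq j m v = !![0, variation (fun m => qOf m j) (fun m => appB m j) m v;
      variation (fun m => qOf m j) (fun m => appC m (nf θ₀ m) j) m v,
      variation (fun m => qOf m j) (fun m => appD m (nf θ₀ m) j) m v] := by
    rw [varOmegaq, variationMat_congr hm v _ fun m' hm' =>
      omegaApp_normalForm j hn hFuchs hreg hm']
    ext1 a b
    rw [variationMat, Matrix.of_apply]
    fin_cases a <;> fin_cases b
    · change variation _ (fun _ => 0) m v = 0
      rw [variation_eq, cvar_const hm, lD_zero, mul_zero, sub_zero]
    · rfl
    · rfl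
    · rfl
  have h := res_trace_app θ₀ j hm v (fderiv ℂ (fun m => qOf m j) m w)
    (fderiv ℂ (fun m => pOf m j) m w) (S.ord_logVarXi j hm w) rfl rfl rfl rfl rfl rfl rfl
  rw [S.coeff_logVarXi j hn hFuchs hreg hm] at h
  have hM := unip_conj (p := pOf m j) hV
  have t2 : Matrix.trace (S.varOmegaq j m v *
      (unip (pOf m j) * S.logVarXi j m w * (unip (pOf m j))⁻¹))
      = Matrix.trace ((unip (pOf m j))⁻¹ * (S.varOmegaq j m v * unip (pOf m j))
        * S.logVarXi j m w) := by
    rw [Matrix.mul_assoc (unip (pOf m j))⁻¹, Matrix.trace_mul_comm (unip (pOf m j))⁻¹]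
    simp only [Matrix.mul_assoc]
  rw [S.logVarq_eq j hm, Matrix.mul_add, Matrix.mul_add, Matrix.trace_add, Matrix.trace_add, t2, hM,
    omegaApp_normalForm j hn hFuchs hreg hm]
  rw [dWedge]
  refine Eq.trans ?_ (h.trans (by ring))
  congr 1
  rw [trace_mul_smul]
  exact trace_app rfl hV rfl (unipVar_eq _)

end

end LocalSolutions

end

section

open Polynomial (aeval)

variable {μ : ℕ} {n : Pole μ → ℕ}

/-! ### Darboux coordinates -/

lemma coeff_zero_aeval_xApp (m : Param n) (j : Fin (numApp n)) (p : Polynomial ℂ) :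
    (aeval (xApp m j) p).coeff 0 = p.eval (qOf m j) := by
  rw [xApp, coeff_zero_aeval (ord_C_add_X _), coeff_C_add_X]

lemma coeff_zero_inv_aeval_xApp (m : Param n) (j : Fin (numApp n)) (p w : Polynomial ℂ)
    (hw : w.eval (qOf m j) ≠ 0) :
    (aeval (xApp m j) p / aeval (xApp m j) w).coeff 0
      = p.eval (qOf m j) / w.eval (qOf m j) := by
  have hz : Ord (xApp m j) 0 := ord_C_add_X _
  have hl : Lead (aeval (xApp m j) w) 0 :=
    ⟨ord_aeval_of_nonneg hz w, by rwa [coeff_zero_aeval_xApp]⟩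
  rw [(ord_aeval_of_nonneg hz p).coeff_mul_inv hl (by norm_num), coeff_zero_aeval_xApp,
    coeff_zero_aeval_xApp, div_eq_mul_inv]

section

variable (θ₀ : Pole μ → Fin 2 → ℂ) (j : Fin (numApp n)) {m : Param n} (hm : m ∈ phaseSpace n)
include hm

lemma coeff_zero_appB :
    (appB m j).coeff 0 = (∏ k, (qOf m j - pos m k) ^ n (some k))⁻¹ := by
  have h := coeff_zero_inv_aeval_xApp m j 1
    (∏ k, (Polynomial.X - Polynomial.C (pos m k)) ^ n (some k)) (by
      rw [Polynomial.eval_prod]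
      refine Finset.prod_ne_zero_iff.2 fun k _ => ?_
      simpa using fun h => absurd (sub_eq_zero.1 h) (hm.2.2.1 j k))
  simp only [map_one, map_prod, map_pow, map_sub, Polynomial.aeval_X, aeval_C',
    Polynomial.eval_prod, Polynomial.eval_pow, Polynomial.eval_sub, Polynomial.eval_X,
    Polynomial.eval_C, Polynomial.eval_one, one_div] at h
  exact h

lemma coeff_zero_inv_sub (l : Fin (numApp n)) :
    ((-1) / (xApp m j - HahnSeries.C (qOf m l)) : LS).coeff 0 = -(qOf m j - qOf m l)⁻¹ := by
  -- For l = j the expansion is exactly -X⁻¹ with constant term 0, matching the convention 0⁻¹ = 0,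
  -- so the diagonal term can remain in all sums.
  rcases eq_or_ne j l with rfl | h
  · rw [show xApp m j - HahnSeries.C (qOf m j) = sX 1 from C_add_X_sub_self _, sub_self, inv_zero,
      neg_zero, div_eq_mul_inv, ← sX_neg]
    have e : (-1 : LS) * sX (-1) = -sX (-1) := by ring
    rw [e, HahnSeries.coeff_neg, coeff_sX]
    simp
  · have h := coeff_zero_inv_aeval_xApp m j (-1) (Polynomial.X - Polynomial.C (qOf m l)) (by
      rw [Polynomial.eval_sub, Polynomial.eval_X, Polynomial.eval_C]
      exact sub_ne_zero.2 fun h' => h (hm.2.1 h'))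
    simp only [map_neg, map_one, map_sub, Polynomial.aeval_X, aeval_C', Polynomial.eval_sub,
      Polynomial.eval_X, Polynomial.eval_C, Polynomial.eval_neg, Polynomial.eval_one] at h
    rw [h, neg_div, one_div]

lemma coeff_zero_appD : (appD m (nf θ₀ m) j).coeff 0
    = ∑ k, ((nf θ₀ m).D (some k)).eval (qOf m j) / (qOf m j - pos m k) ^ n (some k)
      - ∑ l, (qOf m j - qOf m l)⁻¹ + ((nf θ₀ m).D none).eval (qOf m j) := by
  have h : ∀ k, (aeval (xApp m j) ((nf θ₀ m).D (some k)) /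
      (xApp m j - HahnSeries.C (pos m k)) ^ n (some k)).coeff 0
      = ((nf θ₀ m).D (some k)).eval (qOf m j) / (qOf m j - pos m k) ^ n (some k) := fun k => by
    have h := coeff_zero_inv_aeval_xApp m j ((nf θ₀ m).D (some k))
      ((Polynomial.X - Polynomial.C (pos m k)) ^ n (some k)) (by
        simpa using fun h => absurd (sub_eq_zero.1 h) (hm.2.2.1 j k))
    simpa only [map_pow, map_sub, Polynomial.aeval_X, aeval_C', Polynomial.eval_pow,
      Polynomial.eval_sub, Polynomial.eval_X, Polynomial.eval_C] using h
  rw [appD, d0, HahnSeries.coeff_add, HahnSeries.coeff_add, HahnSeries.coeff_sum,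
    HahnSeries.coeff_sum, coeff_zero_aeval_xApp, Finset.sum_congr rfl fun k _ => h k,
    Finset.sum_congr rfl fun l _ => coeff_zero_inv_sub j hm l, Finset.sum_neg_distrib,
    sub_eq_add_neg]

end

lemma fderiv_qOf (j : Fin (numApp n)) (m v : Param n) :
    fderiv ℂ (fun m : Param n => qOf m j) m v = qOf v j :=
  congrFun (congrArg DFunLike.coe
    ((ContinuousLinearMap.proj (R := ℂ) (φ := fun _ : Fin (numApp n) => ℂ) j).comp
      (ContinuousLinearMap.fst ℂ (Fin (numApp n) → ℂ) _)).fderiv) v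

lemma ana_inv_sub (j l : Fin (numApp n)) : Ana fun m : Param n => (qOf m j - qOf m l)⁻¹ := by
  rcases eq_or_ne j l with rfl | h
  · simp only [sub_self]
    exact fun _ _ => analyticAt_const
  · exact ((ana_qOf j).sub (ana_qOf l)).inv fun m hm h0 => h (hm.2.1 (sub_eq_zero.1 h0))

lemma fderiv_inv_sub (j l : Fin (numApp n)) {m : Param n} (hm : m ∈ phaseSpace n) (v : Param n) :
    fderiv ℂ (fun m : Param n => (qOf m j - qOf m l)⁻¹) m v
      = -(qOf v j - qOf v l) / (qOf m j - qOf m l) ^ 2 := by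
  rcases eq_or_ne j l with rfl | h
  · simp
  · have h1 := (ana_qOf j m hm).differentiableAt
    have h2 := (ana_qOf l m hm).differentiableAt
    have h0 : qOf m j - qOf m l ≠ 0 := sub_ne_zero.2 fun h' => h (hm.2.1 h')
    have h3 := ((hasDerivAt_inv h0).comp_hasFDerivAt m (h1.fun_sub h2).hasFDerivAt).fderiv
    rw [fderiv_fun_sub h1 h2] at h3
    have h4 := congrArg (fun L : Param n →L[ℂ] ℂ => L v) h3
    simp only [smul_apply, sub_apply, fderiv_qOf, smul_eq_mul] at h4
    refine h4.trans ?_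
    field_simp

/-- Each term equals dq_l ∧ dq_j / (q_j - q_l)² for l ≠ j, which changes sign when j and l are
exchanged. -/
lemma sum_dWedge_inv_sub {m : Param n} (hm : m ∈ phaseSpace n) (v w : Param n) :
    ∑ j, ∑ l, dWedge (fun m : Param n => (qOf m j - qOf m l)⁻¹) (fun m => qOf m j) m v w = 0 := by
  have h : ∀ j l, dWedge (fun m : Param n => (qOf m j - qOf m l)⁻¹) (fun m => qOf m j) m v w
      = -dWedge (fun m : Param n => (qOf m l - qOf m j)⁻¹) (fun m => qOf m l) m v w := fun j l => by
    simp only [dWedge, fderiv_inv_sub _ _ hm, fderiv_qOf]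
    rw [show (qOf m l - qOf m j) ^ 2 = (qOf m j - qOf m l) ^ 2 by ring]
    ring
  have h1 : ∀ x : ℂ, x = -x → x = 0 := fun x hx => by linear_combination hx / 2
  refine h1 _ ?_
  conv_lhs => rw [Finset.sum_comm]
  simp only [← Finset.sum_neg_distrib]
  exact Finset.sum_congr rfl fun l _ => Finset.sum_congr rfl fun j _ => h j l

section

variable {θ₀ : Pole μ → Fin 2 → ℂ} (hn : ∀ i, 1 ≤ n i) (hFuchs : ∑ i, (θ₀ i 0 + θ₀ i 1) = -1)
    (hreg : ∀ i, n i = 1 → ∀ k : ℤ, θ₀ i 0 - θ₀ i 1 ≠ (k : ℂ))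
include hn hFuchs hreg

/-- Compared with -α_j, where α_j = `appConst`, the function η_j omits precisely the contributions
of the other apparent singularities to d_0 at q_j. -/
lemma eta_eq (j : Fin (numApp n)) {m : Param n} (hm : m ∈ phaseSpace n) :
    eta θ₀ j m = -appConst θ₀ j m - ∑ l, (qOf m j - qOf m l)⁻¹ := by
  rw [eta, normalForm_eq θ₀ hn hFuchs hreg hm, appConst, coeff_zero_appD θ₀ j hm,
    coeff_zero_appB j hm, div_eq_mul_inv]
  ring

lemma ana_eta (j : Fin (numApp n)) : Ana (eta (n := n) θ₀ j) := by
  refine Ana.congr (f := fun m => -appConst θ₀ j m - ∑ l, (qOf m j - qOf m l)⁻¹) ?_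
    fun m hm => (eta_eq hn hFuchs hreg j hm).symm
  exact (ana_appConst θ₀ j).neg.sub (Finset.analyticOnNhd_fun_sum _ fun l _ => ana_inv_sub j l)

lemma dWedge_eta (j : Fin (numApp n)) {m : Param n} (hm : m ∈ phaseSpace n) (v w : Param n) :
    dWedge (eta θ₀ j) (fun m => qOf m j) m v w
      = -dWedge (appConst θ₀ j) (fun m => qOf m j) m v w
        - ∑ l, dWedge (fun m : Param n => (qOf m j - qOf m l)⁻¹) (fun m => qOf m j) m v w := by
  have h1 := (ana_appConst θ₀ j m hm).differentiableAt
  have h2 := fun l => (ana_inv_sub j l m hm).differentiableAt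
  have h3 : fderiv ℂ (eta θ₀ j) m = -fderiv ℂ (appConst θ₀ j) m
      - ∑ l, fderiv ℂ (fun m : Param n => (qOf m j - qOf m l)⁻¹) m := by
    rw [fderiv_congr_phaseSpace (fun m' hm' => eta_eq hn hFuchs hreg j hm') hm,
      fderiv_fun_sub h1.fun_neg (DifferentiableAt.fun_sum fun l _ => h2 l), fderiv_fun_neg,
      fderiv_fun_sum fun l _ => h2 l]
  simp only [dWedge, h3, sub_apply, neg_apply, sum_apply, Finset.sum_sub_distrib, ← Finset.sum_mul]
  ring

lemma LocalSolutions.sum_res_app (S : LocalSolutions n θ₀) {m : Param n} (hm : m ∈ phaseSpace n)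
    (v w : Param n) : ∑ j, res (Matrix.trace (S.varOmegaq j m v * S.logVarq j m w))
      = ∑ j, dWedge (eta θ₀ j) (fun m => qOf m j) m v w := by
  rw [Finset.sum_congr rfl fun j _ => S.res_app j hn hFuchs hreg hm v w,
    Finset.sum_congr rfl fun j _ => dWedge_eta hn hFuchs hreg j hm v w, Finset.sum_sub_distrib,
    sum_dWedge_inv_sub hm, sub_zero]

end

/-! ### Two-forms pulled back from the space of deformation parameters -/

/-- By alternation the vertical directions lie in both kernels, so the form is determined by its
values on any lifts of base vectors. -/
lemma isSectionOfPullback_of {ω : Param n → Param n → Param n → ℂ}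
    (add : ∀ m ∈ phaseSpace n, ∀ v v' w, ω m (v + v') w = ω m v w + ω m v' w)
    (smul : ∀ m ∈ phaseSpace n, ∀ (c : ℂ) v w, ω m (c • v) w = c * ω m v w)
    (swap : ∀ m ∈ phaseSpace n, ∀ v w, ω m w v = -ω m v w)
    (ana : ∀ v w, Ana fun m => ω m v w)
    (vert : ∀ m ∈ phaseSpace n, ∀ v w, proj v = 0 → ω m v w = 0) : IsSectionOfPullback ω := by
  classical
  have add' : ∀ m ∈ phaseSpace n, ∀ v w w', ω m v (w + w') = ω m v w + ω m v w' :=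
    fun m hm v w w' => by rw [swap m hm (w + w') v, add m hm, swap m hm w v, swap m hm w' v]; ring
  have smul' : ∀ m ∈ phaseSpace n, ∀ (c : ℂ) v w, ω m v (c • w) = c * ω m v w :=
    fun m hm c v w => by rw [swap m hm (c • w) v, smul m hm, swap m hm w v]; ring
  have vert' : ∀ m ∈ phaseSpace n, ∀ v w, proj w = 0 → ω m v w = 0 :=
    fun m hm v w hw => by rw [swap m hm w v, vert m hm w v hw, neg_zero]
  -- The phase space lies in a product, so base directions lift linearly with zero q- and
  -- p-components; lifts independent of m keep the coefficients holomorphic.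
  let lift : Base n → Param n := fun x => (0, 0, x)
  have lift_add : ∀ x y, lift (x + y) = lift x + lift y := fun x y => by
    simp only [lift, Prod.mk_add_mk, add_zero]
  have lift_smul : ∀ (c : ℂ) x, lift (c • x) = c • lift x := fun c x => by
    simp only [lift, Prod.smul_mk, smul_zero]
  let β : Param n → Base n [⋀^Fin 2]→ₗ[ℂ] ℂ := fun m =>
    if hm : m ∈ phaseSpace n then
      { toFun := fun x => ω m (lift (x 0)) (lift (x 1))
        map_update_add' := fun x i y z => by
          fin_cases i
          · simp [lift_add, add m hm]
          · simp [lift_add, add' m hm]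
        map_update_smul' := fun x i c y => by
          fin_cases i
          · simp [lift_smul, smul m hm]
          · simp [lift_smul, smul' m hm]
        map_eq_zero_of_eq' := fun x i j hx hij => by
          have h0 : x 0 = x 1 := by
            fin_cases i <;> fin_cases j
            · exact absurd rfl hij
            · exact hx
            · exact hx.symm
            · exact absurd rfl hij
          have h1 := swap m hm (lift (x 1)) (lift (x 1))
          rw [h0]
          linear_combination h1 / 2 }
    else 0
  have hβ : ∀ m ∈ phaseSpace n, ∀ x y, β m ![x, y] = ω m (lift x) (lift y) := fun m hm x y => by
    simp only [β, dif_pos hm]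
    rfl
  refine ⟨β, fun x y => ?_, fun m hm v w => ?_⟩
  · exact Ana.congr (ana (lift x) (lift y)) fun m hm => (hβ m hm x y).symm
  · have hv : proj (v - lift (proj v)) = 0 := sub_self (proj v)
    have hw : proj (w - lift (proj w)) = 0 := sub_self (proj w)
    rw [hβ m hm, ← sub_add_cancel v (lift (proj v)), add m hm, vert m hm _ _ hv, zero_add,
      ← sub_add_cancel w (lift (proj w)), add' m hm, vert' m hm _ _ hw, zero_add]
    simp [proj, lift]

/-! ### Holomorphy of the Hamiltonians and of the logarithmic variations. -/

namespace LocalSolutions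

variable {θ₀ : Pole μ → Fin 2 → ℂ} (S : LocalSolutions n θ₀)

lemma ana_hamTheta (i : Pole μ) (a : Fin 2) (l : Fin (n i - 1)) : Ana (S.hamTheta i a l) :=
  AnalyticOnNhd.div (S.analytic_θ i a _) analyticOnNhd_const fun m _ => by
    have h := l.2
    intro h0
    have h1 : (n i : ℂ) = (l : ℕ) + 1 := by linear_combination h0
    have h2 : n i = l + 1 := by exact_mod_cast h1
    omega

lemma ana_hamT (i : Pole μ) : Ana (S.hamT i) :=
  Finset.analyticOnNhd_fun_sum _ fun a _ => Finset.analyticOnNhd_fun_sum _ fun _ _ =>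
    (S.analytic_θ i a _).mul (S.analytic_θ i a _)

lemma fam_varLambda (i : Pole μ) (a : Fin 2) (v : Param n) :
    Fam fun m => S.varLambda i a m v := by
  simp only [varLambda_eq]
  refine ((Fam.const _).mul (Fam.ofPS_mk fun k => ?_)).sub
    ((Fam.C (ana_fderiv (ana_center i) v)).mul (S.fam_expo i a))
  split_ifs with h
  · exact fun _ _ => analyticAt_const
  · refine AnalyticOnNhd.div (ana_fderiv (S.analytic_θ i a k) v) analyticOnNhd_const fun m _ => ?_
    rw [sub_ne_zero]
    exact_mod_cast h

lemma famM_logVar (i : Pole μ) (v : Param n) : FamM fun m => S.logVar i m v := by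
  have h1 := S.famM_frame i
  have h2 : FamM fun m => (S.frame i m)⁻¹ := FamM.inv_of_holInv h1 fun m hm => S.holInv_frame hm i
  exact ((FamM.variation v (ana_center i) h1).mul h2).sub
    ((h1.mul (FamM.diagonal fun a => S.fam_varLambda i a v)).mul h2)

lemma famM_logVarq (j : Fin (numApp n)) (v : Param n) : FamM fun m => S.logVarq j m v := by
  have h1 := S.famM_psiq j
  have hdet : ∀ m ∈ phaseSpace n, Lead (S.psiq j m).det 1 := fun m hm => by
    have h2 : HolInv (constMat !![1, 0; pOf m j, 1] * seriesMat (S.Ξq j m)) := by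
      refine IsoMon.holInv_frame ?_ (S.Ξq_zero j m hm)
      rw [Matrix.isUnit_iff_isUnit_det, Matrix.det_fin_two_of]
      simp
    rw [psiq, Matrix.det_mul, Matrix.det_diagonal, Fin.prod_univ_two]
    have h3 : Lead (![1, lX] 0 * ![1, lX] 1 : LS) 1 := by
      change Lead (1 * sX 1) 1
      rw [one_mul]
      exact Lead.sX 1
    exact (Lead.mul ⟨h2.1.det, h2.2⟩ h3).congr (by norm_num)
  exact (FamM.variation v (ana_qOf j) h1).mul
    (h1.inv (fun m hm => (hdet m hm).1) fun m hm => (hdet m hm).2)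

end LocalSolutions

lemma ana_dWedge {f g : Param n → ℂ} (hf : Ana f) (hg : Ana g) (v w : Param n) :
    Ana fun m => dWedge f g m v w :=
  ((ana_fderiv hf v).mul (ana_fderiv hg w)).sub ((ana_fderiv hf w).mul (ana_fderiv hg v))

lemma dWedge_add (f g : Param n → ℂ) (m v v' w : Param n) :
    dWedge f g m (v + v') w = dWedge f g m v w + dWedge f g m v' w := by
  simp only [dWedge, map_add]
  ring

lemma dWedge_smul (f g : Param n → ℂ) (m : Param n) (c : ℂ) (v w : Param n) :
    dWedge f g m (c • v) w = c * dWedge f g m v w := by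
  simp only [dWedge, map_smul, smul_eq_mul]
  ring

lemma dWedge_swap (f g : Param n → ℂ) (m v w : Param n) :
    dWedge f g m w v = -dWedge f g m v w := by
  simp only [dWedge]
  ring

/-! ### The difference of the isomonodromy form and the canonical form. -/

namespace LocalSolutions

variable {θ₀ : Pole μ → Fin 2 → ℂ} (S : LocalSolutions n θ₀)

/-- The difference of the isomonodromy 2-form and the canonical 2-form. -/
def defect (m v w : Param n) : ℂ :=
  S.omegaHat m v w -
    (∑ j, dWedge (eta θ₀ j) (fun m' => qOf m' j) m v w
      + ∑ i, ∑ l : Fin (n i - 1),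
          (dWedge (S.hamTheta i 0 l) (fun m' => thetaOf m' i 0 l) m v w
            + dWedge (S.hamTheta i 1 l) (fun m' => thetaOf m' i 1 l) m v w)
      + ∑ k : Fin μ, dWedge (S.hamT (some k.succ.succ)) (fun m' => tOf m' k) m v w)

lemma omegaHat_swap (m v w : Param n) : S.omegaHat m w v = -S.omegaHat m v w := by
  have h : ∀ A B C D : Mat2 LS, res (Matrix.trace (A * B - C * D))
      = -res (Matrix.trace (D * C - B * A)) := fun A B C D => by
    rw [res, res, ← HahnSeries.coeff_neg, ← Matrix.trace_neg, neg_sub, Matrix.trace_sub,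
      Matrix.trace_sub, Matrix.trace_mul_comm A, Matrix.trace_mul_comm C]
  rw [omegaHat, omegaHat, Finset.sum_congr rfl fun i _ => h _ _ _ _,
    Finset.sum_congr rfl fun j _ => h (S.varOmegaq j m w) _ _ _, Finset.sum_neg_distrib,
    Finset.sum_neg_distrib]
  ring

lemma defect_swap (m v w : Param n) : S.defect m w v = -S.defect m v w := by
  rw [defect, defect, S.omegaHat_swap, Finset.sum_congr rfl fun j _ => dWedge_swap _ _ m v w,
    Finset.sum_congr rfl fun i _ => Finset.sum_congr rfl fun l _ => by
      rw [dWedge_swap _ _ m v w, dWedge_swap _ _ m v w, ← neg_add],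
    Finset.sum_congr (s₁ := (Finset.univ : Finset (Fin μ))) rfl fun k _ => dWedge_swap _ _ m v w]
  simp only [Finset.sum_neg_distrib]
  ring

section

variable (hn : ∀ i, 1 ≤ n i) (hFuchs : ∑ i, (θ₀ i 0 + θ₀ i 1) = -1)
    (hreg : ∀ i, n i = 1 → ∀ k : ℤ, θ₀ i 0 - θ₀ i 1 ≠ (k : ℂ))
include hn hFuchs hreg

/-- In the one-sided expression of `omegaHat_eq` the first direction enters through δΩ only, so
linearity of the logarithmic variations is not needed. -/
lemma omegaHat_add {m : Param n} (hm : m ∈ phaseSpace n) (v v' w : Param n) :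
    S.omegaHat m (v + v') w = S.omegaHat m v w + S.omegaHat m v' w := by
  have h : ∀ A B C : Mat2 LS, res (Matrix.trace ((A + B) * C))
      = res (Matrix.trace (A * C)) + res (Matrix.trace (B * C)) := fun A B C => by
    rw [Matrix.add_mul, Matrix.trace_add, res, HahnSeries.coeff_add]
    rfl
  simp only [S.omegaHat_eq hn hFuchs hreg hm, varOmega, varOmegaq,
    variationMat_add_dir hm v _ (famM_omegaAt_normalForm hn hFuchs hreg _),
    variationMat_add_dir hm v _ (famM_omegaApp_normalForm hn hFuchs hreg _), h,
    Finset.sum_add_distrib]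
  ring

lemma omegaHat_smul {m : Param n} (hm : m ∈ phaseSpace n) (c : ℂ) (v w : Param n) :
    S.omegaHat m (c • v) w = c * S.omegaHat m v w := by
  have h : ∀ A B : Mat2 LS, res (Matrix.trace ((HahnSeries.C c : LS) • A * B))
      = c * res (Matrix.trace (A * B)) := fun A B => by
    rw [Matrix.trace_mul_comm, trace_mul_smul, Matrix.trace_mul_comm, res, coeff_C_mul]
    rfl
  simp only [S.omegaHat_eq hn hFuchs hreg hm, varOmega, varOmegaq,
    variationMat_smul_dir hm v _ (famM_omegaAt_normalForm hn hFuchs hreg _),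
    variationMat_smul_dir hm v _ (famM_omegaApp_normalForm hn hFuchs hreg _), h,
    ← Finset.mul_sum]
  ring

lemma ana_omegaHat (v w : Param n) : Ana fun m => S.omegaHat m v w := by
  have h1 := fun i => (FamM.trace (((famM_omegaAt_normalForm hn hFuchs hreg i).variation v
    (ana_center i)).mul (S.famM_logVar i w))).ana (-1)
  have h2 := fun j => (FamM.trace (((famM_omegaApp_normalForm hn hFuchs hreg j).variation v
    (ana_qOf j)).mul (S.famM_logVarq j w))).ana (-1)
  refine Ana.congr (AnalyticOnNhd.add (Finset.analyticOnNhd_fun_sum Finset.univ fun i _ => h1 i)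
    (Finset.analyticOnNhd_fun_sum Finset.univ fun j _ => h2 j)) fun m hm => ?_
  exact (S.omegaHat_eq hn hFuchs hreg hm v w).symm

/-- For vertical v the pole residues equal the θ- and t-terms, and the apparent residues always
equal Σ dη_j ∧ dq_j, so the defect vanishes. -/
theorem isSectionOfPullback_defect : IsSectionOfPullback S.defect := by
  refine isSectionOfPullback_of ?_ ?_ (fun m _ v w => S.defect_swap m v w) (fun v w => ?_) ?_
  · intro m hm v v' w
    simp only [defect, S.omegaHat_add hn hFuchs hreg hm, dWedge_add, Finset.sum_add_distrib]
    ring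
  · intro m hm c v w
    simp only [defect, S.omegaHat_smul hn hFuchs hreg hm, dWedge_smul, ← mul_add, ← Finset.mul_sum,
      ← mul_sub]
  · refine (S.ana_omegaHat hn hFuchs hreg v w).sub (AnalyticOnNhd.add (AnalyticOnNhd.add ?_ ?_) ?_)
    · exact Finset.analyticOnNhd_fun_sum _ fun j _ =>
        ana_dWedge (ana_eta hn hFuchs hreg j) (ana_qOf j) v w
    · exact Finset.analyticOnNhd_fun_sum _ fun i _ => Finset.analyticOnNhd_fun_sum _ fun l _ =>
        AnalyticOnNhd.add
          (ana_dWedge (S.ana_hamTheta i 0 l) (fun m _ => analyticAt_thetaOf i 0 l m) v w)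
          (ana_dWedge (S.ana_hamTheta i 1 l) (fun m _ => analyticAt_thetaOf i 1 l m) v w)
    · exact Finset.analyticOnNhd_fun_sum _ fun k _ =>
        ana_dWedge (S.ana_hamT _) (fun m _ => analyticAt_tOf k m) v w
  · intro m hm v w hv
    rw [defect, S.omegaHat_eq hn hFuchs hreg hm, S.sum_res_pole hn hFuchs hreg hm v hv w,
      sum_res_app hn hFuchs hreg S hm]
    ring

end

end LocalSolutions

end

end IsoMon

end

theorem theorem2020p1p21p13 {μ : ℕ} (n : IsoMon.Pole μ → ℕ) (hn : ∀ i, 1 ≤ n i)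
    (θ₀ : IsoMon.Pole μ → Fin 2 → ℂ)
    (hFuchs : ∑ i, (θ₀ i 0 + θ₀ i 1) = -1)
    (hreg : ∀ i, n i = 1 → ∀ k : ℤ, θ₀ i 0 - θ₀ i 1 ≠ (k : ℂ)) :
    (∀ m ∈ IsoMon.phaseSpace n, ∃! F : IsoMon.NFData μ, IsoMon.IsNormalForm n θ₀ m F) ∧
    Nonempty (IsoMon.LocalSolutions n θ₀) ∧
    ∀ S : IsoMon.LocalSolutions n θ₀,
      IsoMon.IsSectionOfPullback fun m v w =>
        S.omegaHat m v w -
          (∑ j, IsoMon.dWedge (IsoMon.eta θ₀ j) (fun m' => IsoMon.qOf m' j) m v w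
            + ∑ i, ∑ l : Fin (n i - 1),
                (IsoMon.dWedge (S.hamTheta i 0 l) (fun m' => IsoMon.thetaOf m' i 0 l) m v w
                  + IsoMon.dWedge (S.hamTheta i 1 l) (fun m' => IsoMon.thetaOf m' i 1 l) m v w)
            + ∑ k : Fin μ,
                IsoMon.dWedge (S.hamT (some k.succ.succ)) (fun m' => IsoMon.tOf m' k) m v w) := by
  exact ⟨fun m hm => IsoMon.existsUnique_isNormalForm θ₀ hn hFuchs hreg hm,
    IsoMon.nonempty_localSolutions θ₀ hn hFuchs hreg,
    fun S => S.isSectionOfPullback_defect hn hFuchs hreg⟩
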